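/- Let $(Q,\langle\cdot,\cdot\rangle)$ be a finite-dimensional smooth Riemannian manifold without boundary, with Levi-Civita connection $\nabla$, covariant derivative $D/dt$ along curves, and curvature $R(X,Y)Z=\nabla_X\nabla_YZ-\nabla_Y\nabla_XZ-\nabla_{[X,Y]}Z$. Let $T>0$, $(q_0,v_0),(q_T,v_T)\in TQ$, and let $\mu^1,\dots,\mu^r$ be smooth 1-forms on $Q$. Write $X_a=\sharp\mu^a$ for the vector field with $\langle X_a,Y\rangle=\mu^a(Y)$ for all $Y$, and $S_a:TQ\to TQ$ for the fibrewise linear operator with $d\mu^a(X,Y)=\langle S_aX,Y\rangle$ for all $X,Y$, where $d\mu^a(X,Y)=X(\mu^a(Y))-Y(\mu^a(X))-\mu^a([X,Y])$. Let $\Omega$ be the set of $C^1$, piecewise smooth curves $c:[0,T]\to Q$ with $c(0)=q_0$, $c(T)=q_T$, $\dot c(0)=v_0$, $\dot c(T)=v_T$. A curve $c\in\Omega$ is called a normal extremal, with (continuous, piecewise smooth) multipliers $\lambda_1,\dots,\lambda_r:[0,T]\to\mathbb R$, of the energy $\int_0^T\frac12\langle\frac{D^2c}{dt^2},\frac{D^2c}{dt^2}\rangle\,dt$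 subject to the constraints $\langle\mu^a(c),\frac{D^2c}{dt^2}\rangle=0$, $a=1,\dots,r$, if $c$ satisfies these constraints on every interval where it is smooth and $(c,\lambda)$ is a critical point of $$\mathcal J(c,\lambda)=\int_0^T\Big(\tfrac12\Big\langle\frac{D^2c}{dt^2},\frac{D^2c}{dt^2}\Big\rangle+\sum_a\lambda_a\Big\langle\mu^a(c),\frac{D^2c}{dt^2}\Big\rangle\Big)dt,$$ that is, $\frac{d}{ds}\big|_{s=0}\mathcal J(c_s,\lambda_s)=0$ for every variation $(c_s,\lambda_s)_{|s|<\varepsilon}$ of $(c_0,\lambda_0)=(c,\lambda)$ with $c_s\in\Omega$ for all $s$, where $(s,t)\mapsto c_s(t)$ and $(s,t)\mapsto\lambda_{a,s}(t)$ are smooth on each strip $(-\varepsilon,\varepsilon)\times[t_i,t_{i+1}]$ of some subdivision of $[0,T]$. Theorem. Let $c$ be a normal extremal with multipliers $\lambda_a$. Then on every interval $[\alpha,\beta]\subseteq[0,T]$, $\alpha<\beta$, on which $c$ and all $\lambda_a$ are smooth (hence on all of $[0,T]$ if they are smooth there, and in general on each piece of a suitable subdivision of $[0,T]$), $$\frac{D^4c}{dt^4}+R\Big(\frac{D^2c}{dt^2},\dot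 c\Big)\dot c+\sum_a\Big(\ddot\lambda_aX_a+2\dot\lambda_a\frac{DX_a}{dt}+\lambda_a\frac{D^2X_a}{dt^2}\Big)+\sum_a\lambda_a\Big(R(X_a,\dot c)\dot c+\nabla_{\frac{D^2c}{dt^2}}X_a-S_a\Big(\frac{D^2c}{dt^2}\Big)\Big)=0$$ along $c$, where derivatives at $\alpha$ and $\beta$ are one-sided and $X_a$ is evaluated along $c$. -/

import Mathlib

open Set Bundle MeasureTheory
open scoped Manifold ContDiff Topology

noncomputable section

namespace CovAcc

/-! ## Linear algebra: the Riesz isomorphism and the Koszul formula -/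

theorem exists_riesz {V : Type*} [AddCommGroup V] [Module ℝ V] [TopologicalSpace V]
    [FiniteDimensional ℝ V] (G : V →L[ℝ] V →L[ℝ] ℝ) (hpos : ∀ v, v ≠ 0 → 0 < G v v)
    (α : V →ₗ[ℝ] ℝ) : ∃ v, ∀ w, G v w = α w := by
  let L : V →ₗ[ℝ] Module.Dual ℝ V :=
    { toFun := fun v => (G v : V →ₗ[ℝ] ℝ)
      map_add' := fun a b => by ext; simp
      map_smul' := fun r a => by ext; simp }
  have hinj : Function.Injective L := by
    refine (injective_iff_map_eq_zero L).2 fun v hv => ?_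
    by_contra hne
    have h0 : G v v = 0 := congrArg (fun f : Module.Dual ℝ V => f v) hv
    exact (hpos v hne).ne' h0
  obtain ⟨v, hv⟩ := (LinearMap.injective_iff_surjective_of_finrank_eq_finrank
    (Subspace.dual_finrank_eq (K := ℝ) (V := V)).symm).1 hinj α
  exact ⟨v, fun w => congrArg (fun f : Module.Dual ℝ V => f w) hv⟩

theorem eq_of_pairing_eq {V : Type*} [AddCommGroup V] [Module ℝ V] [TopologicalSpace V]
    (G : V →L[ℝ] V →L[ℝ] ℝ) (hpos : ∀ v, v ≠ 0 → 0 < G v v)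
    {v v' : V} (h : ∀ w, G v w = G v' w) : v = v' := by
  by_contra hne
  have h1 := hpos (v - v') (sub_ne_zero.2 hne)
  have h2 : G (v - v') (v - v') = G v (v - v') - G v' (v - v') := by
    rw [map_sub G]; rfl
  rw [h2, h, sub_self] at h1
  exact lt_irrefl _ h1

theorem exists_koszul_correction {V : Type*} [AddCommGroup V] [Module ℝ V] [TopologicalSpace V]
    [IsTopologicalAddGroup V] [ContinuousSMul ℝ V] [T2Space V] [FiniteDimensional ℝ V]
    (G : V →L[ℝ] V →L[ℝ] ℝ) (hsymm : ∀ v w, G v w = G w v) (hpos : ∀ v, v ≠ 0 → 0 < G v v)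
    (N : V → V → V → ℝ) (t : V → V → V)
    (hN : ∀ X Y Z, N X Y Z = N Y X Z) (ht : ∀ X Y, t X Y = -t Y X)
    (tadd : ∀ a b c, t (a + b) c = t a c + t b c)
    (tsmul : ∀ (r : ℝ) b c, t (r • b) c = r • t b c)
    (Nadd : ∀ a b c d, N (a + b) c d = N a c d + N b c d)
    (Nsmul : ∀ (r : ℝ) b c d, N (r • b) c d = r * N b c d)
    (Nadd₃ : ∀ a b c d, N a b (c + d) = N a b c + N a b d)
    (Nsmul₃ : ∀ (r : ℝ) b c d, N b c (r • d) = r * N b c d) :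
    ∃ A : V →L[ℝ] V →L[ℝ] V, (∀ X Y, A Y X - A X Y = -t X Y) ∧
      ∀ X Y Z, G (A Y X) Z + G Y (A Z X) = N Y Z X := by
  have Gadd : ∀ a b c, G (a + b) c = G a c + G b c := fun a b c => by rw [map_add G]; rfl
  have Gsmul : ∀ (r : ℝ) b c, G (r • b) c = r * G b c := fun r b c => by rw [map_smul G]; rfl
  have Gneg : ∀ b c, G (-b) c = -G b c := fun b c => by rw [map_neg G]; rfl
  have Gsub : ∀ a b c, G (a - b) c = G a c - G b c := fun a b c => by rw [map_sub G]; rfl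
  have Gadd₂ : ∀ a b c, G a (b + c) = G a b + G a c := fun a b c => map_add (G a) b c
  have Gsmul₂ : ∀ (r : ℝ) b c, G b (r • c) = r * G b c := fun r b c => map_smul (G b) r c
  have tadd₂ : ∀ a b c, t a (b + c) = t a b + t a c := fun a b c => by
    rw [ht, tadd, ht b, ht c]; abel
  have tsmul₂ : ∀ (r : ℝ) b c, t b (r • c) = r • t b c := fun r b c => by
    rw [ht, tsmul, ht c, smul_neg, neg_neg]
  have Nadd₂ : ∀ a b c d, N a (b + c) d = N a b d + N a c d := fun a b c d => by
    rw [hN, Nadd, hN b, hN c]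
  have Nsmul₂ : ∀ (r : ℝ) a c d, N a (r • c) d = r * N a c d := fun r a c d => by
    rw [hN, Nsmul, hN c]
  let k : V → V → V → ℝ := fun Y X Z => (1 / 2 : ℝ) * (N Y Z X + N X Z Y - N X Y Z
        - G (t X Y) Z + G (t X Z) Y + G (t Y Z) X)
  have hex : ∀ Y X, ∃ v, ∀ w, G v w = k Y X w := by
    intro Y X
    refine exists_riesz G hpos
      { toFun := k Y X
        map_add' := fun a b => ?_
        map_smul' := fun r a => ?_ }
    · simp only [k, Nadd₂, Nadd₃, Gadd, Gadd₂, tadd₂]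
      ring
    · simp only [k, Nsmul₂, Nsmul₃, Gsmul, Gsmul₂, tsmul₂, smul_eq_mul, RingHom.id_apply]
      ring
  choose B hB using hex
  let A : V →L[ℝ] V →L[ℝ] V := (LinearMap.mk₂ ℝ B
    (fun a b c => eq_of_pairing_eq G hpos fun w => by
      simp only [Gadd, Gadd₂, hB, k, Nadd, Nadd₂, Nadd₃, tadd, tadd₂]
      ring)
    (fun r b c => eq_of_pairing_eq G hpos fun w => by
      simp only [Gsmul, Gsmul₂, hB, k, Nsmul, Nsmul₂, Nsmul₃, tsmul, tsmul₂]
      ring)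
    (fun a b c => eq_of_pairing_eq G hpos fun w => by
      simp only [Gadd, Gadd₂, hB, k, Nadd, Nadd₂, Nadd₃, tadd, tadd₂]
      ring)
    (fun r b c => eq_of_pairing_eq G hpos fun w => by
      simp only [Gsmul, Gsmul₂, hB, k, Nsmul, Nsmul₂, Nsmul₃, tsmul, tsmul₂]
      ring)).toContinuousBilinearMap
  have hA : ∀ Y X Z, G (A Y X) Z = k Y X Z := hB
  refine ⟨A, fun X Y => eq_of_pairing_eq G hpos fun Z => ?_, fun X Y Z => ?_⟩
  · rw [Gsub, hA, hA, Gneg]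
    simp only [k]
    rw [ht Y X, Gneg, hN Y X Z]
    ring
  · rw [hsymm Y, hA, hA]
    simp only [k]
    rw [hN Z Y X, ht Z Y, Gneg, hN X Z Y]
    ring

/-! ## The Levi-Civita connection -/

variable {E : Type*} [NormedAddCommGroup E] [NormedSpace ℝ E] [FiniteDimensional ℝ E]
  {Q : Type*} [TopologicalSpace Q] [ChartedSpace E Q] [IsManifold 𝓘(ℝ, E) ∞ Q]

/-- Vector fields on `Q` (no regularity implied). -/
abbrev VField (E : Type*) [NormedAddCommGroup E] [NormedSpace ℝ E]
    (Q : Type*) [TopologicalSpace Q] [ChartedSpace E Q] : Type _ :=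
  ∀ x : Q, TangentSpace 𝓘(ℝ, E) x

/-- Differentiability of a vector field at a point. -/
abbrev VDiffAt (X : VField E Q) (x : Q) : Prop :=
  MDifferentiableAt 𝓘(ℝ, E) (𝓘(ℝ, E).prod 𝓘(ℝ, E))
    (fun y => (TotalSpace.mk' E y (X y) : TangentBundle 𝓘(ℝ, E) Q)) x

/-- Affine connections on `Q`. For `D : Connection E Q`, `D Y x (X x)` is `∇_X Y` at `x`. -/
abbrev Connection (E : Type*) [NormedAddCommGroup E] [NormedSpace ℝ E]
    (Q : Type*) [TopologicalSpace Q] [ChartedSpace E Q] [IsManifold 𝓘(ℝ, E) ∞ Q] : Type _ :=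
  CovariantDerivative 𝓘(ℝ, E) E (TangentSpace 𝓘(ℝ, E) : Q → Type _)

/-- Smooth Riemannian metrics on `Q`; the inner product of `v, w ∈ T_x Q` is `g.inner x v w`. -/
abbrev Metric (E : Type*) [NormedAddCommGroup E] [NormedSpace ℝ E]
    (Q : Type*) [TopologicalSpace Q] [ChartedSpace E Q] [IsManifold 𝓘(ℝ, E) ∞ Q] : Type _ :=
  ContMDiffRiemannianMetric 𝓘(ℝ, E) ∞ E (TangentSpace 𝓘(ℝ, E) : Q → Type _)

instance instFiniteDimensionalTangent (x : Q) : FiniteDimensional ℝ (TangentSpace 𝓘(ℝ, E) x) :=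
  inferInstanceAs (FiniteDimensional ℝ E)

instance instT2Tangent (x : Q) : T2Space (TangentSpace 𝓘(ℝ, E) x) :=
  inferInstanceAs (T2Space E)

/-- A connection is a Levi-Civita connection of `g` if it is torsion-free and compatible
with `g`. -/
structure IsLeviCivita (g : Metric E Q) (D : Connection E Q) : Prop where
  torsion_free : ∀ (X Y : VField E Q) (x : Q), VDiffAt X x → VDiffAt Y x →
    D Y x (X x) - D X x (Y x) = VectorField.mlieBracket 𝓘(ℝ, E) X Y x
  metric : ∀ (X Y Z : VField E Q) (x : Q), VDiffAt Y x → VDiffAt Z x →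
    mvfderiv 𝓘(ℝ, E) (fun y => g.inner y (Y y) (Z y)) x (X x) =
      g.inner x (D Y x (X x)) (Z x) + g.inner x (Y x) (D Z x (X x))

theorem metric_pairing_mdifferentiableAt (g : Metric E Q) {Y Z : VField E Q} {x : Q}
    (hY : VDiffAt Y x) (hZ : VDiffAt Z x) :
    MDifferentiableAt 𝓘(ℝ, E) 𝓘(ℝ, ℝ) (fun y => g.inner y (Y y) (Z y)) x := by
  have h : MDifferentiableAt 𝓘(ℝ, E) (𝓘(ℝ, E).prod 𝓘(ℝ, ℝ))
      (fun m ↦ TotalSpace.mk' ℝ (E := Bundle.Trivial Q ℝ) m (g.inner m (Y m) (Z m))) x := by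
    apply MDifferentiableAt.clm_bundle_apply₂ (F₁ := E) (F₂ := E)
    · exact g.contMDiff.mdifferentiableAt (by simp)
    · exact hY
    · exact hZ
  rw [mdifferentiableAt_totalSpace] at h
  exact h.2

/-- In every chart the coordinatewise derivative is a covariant derivative at the centre of
the chart. -/
theorem exists_connection (E : Type*) [NormedAddCommGroup E] [NormedSpace ℝ E]
    (Q : Type*) [TopologicalSpace Q] [ChartedSpace E Q] [IsManifold 𝓘(ℝ, E) ∞ Q] :
    Nonempty (Connection E Q) := by
  have key : ∀ (X : VField E Q) (x : Q), VDiffAt X x → MDifferentiableAt 𝓘(ℝ, E) 𝓘(ℝ, E)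
      (fun y => (trivializationAt E (TangentSpace 𝓘(ℝ, E)) x).continuousLinearMapAt ℝ y (X y)) x := by
    intro X x hX
    have h := (mdifferentiableAt_section (IB := 𝓘(ℝ, E)) X).1 hX
    refine h.congr_of_eventuallyEq ?_
    filter_upwards [(trivializationAt E (TangentSpace 𝓘(ℝ, E)) x).open_baseSet.mem_nhds
      (FiberBundle.mem_baseSet_trivializationAt' x)] with y hy
    exact Trivialization.continuousLinearMapAt_apply_of_mem (R := ℝ) _ hy _
  refine ⟨⟨fun X x => ((trivializationAt E (TangentSpace 𝓘(ℝ, E)) x).symmL ℝ x) ∘L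
    mvfderiv 𝓘(ℝ, E) (fun y => (trivializationAt E (TangentSpace 𝓘(ℝ, E)) x).continuousLinearMapAt
      ℝ y (X y)) x, ?_, ?_⟩⟩
  · intro X Y x hX hY _
    have := mvfderiv_add (key X x hX) (key Y x hY)
    rw [← ContinuousLinearMap.comp_add, ← this]
    congr 2
    ext y
    simp
  · intro X f x hX hf _
    have h := mvfderiv_smul hf (key X x hX)
    have hfun : (fun y => (trivializationAt E (TangentSpace 𝓘(ℝ, E)) x).continuousLinearMapAt
        ℝ y ((f • X) y)) = f • (fun y => (trivializationAt E (TangentSpace 𝓘(ℝ, E))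
          x).continuousLinearMapAt ℝ y (X y)) := by
      ext y
      simp
    have hx : (trivializationAt E (TangentSpace 𝓘(ℝ, E)) x).symmL ℝ x
        ((trivializationAt E (TangentSpace 𝓘(ℝ, E)) x).continuousLinearMapAt ℝ x (X x)) = X x :=
      Trivialization.symmL_continuousLinearMapAt _ (FiberBundle.mem_baseSet_trivializationAt' x) _
    rw [hfun, h]
    ext v
    simp only [ContinuousLinearMap.comp_apply, add_apply,
      smul_apply, ContinuousLinearMap.smulRight_apply, map_add, map_smul, hx]

theorem metric_tensorial (g : Metric E Q) (D : Connection E Q) {Z : VField E Q} {x : Q}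
    (hZ : VDiffAt Z x) :
    TensorialAt 𝓘(ℝ, E) E (fun Y : VField E Q =>
      mvfderiv 𝓘(ℝ, E) (fun y => g.inner y (Y y) (Z y)) x
        - g.inner x (Z x) ∘L D Y x - g.inner x (Y x) ∘L D Z x) x := by
  constructor
  · intro f Y hf hY
    have h := mvfderiv_smul hf (metric_pairing_mdifferentiableAt g hY hZ)
    have hfun : (fun y => g.inner y ((f • Y) y) (Z y)) =
        f • (fun y => g.inner y (Y y) (Z y)) := by
      ext y
      simp
    ext v
    rw [hfun, h, D.isCovariantDerivativeOn.leibniz hY hf]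
    simp [g.symm x (Z x) (Y x)]
    ring
  · intro Y Y' hY hY'
    have h := mvfderiv_add (metric_pairing_mdifferentiableAt g hY hZ)
      (metric_pairing_mdifferentiableAt g hY' hZ)
    have hfun : (fun y => g.inner y ((Y + Y') y) (Z y)) =
        (fun y => g.inner y (Y y) (Z y)) + (fun y => g.inner y (Y' y) (Z y)) := by
      ext y
      simp
    ext v
    rw [hfun, h, D.isCovariantDerivativeOn.add hY hY']
    simp
    ring

set_option synthInstance.maxHeartbeats 400000 in
/-- The fundamental theorem of Riemannian geometry, existence part. -/
theorem exists_isLeviCivita (g : Metric E Q) : ∃ D : Connection E Q, IsLeviCivita g D := by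
  obtain ⟨D⟩ := exists_connection E Q
  let Φ : ∀ x : Q, VField E Q → VField E Q → (TangentSpace 𝓘(ℝ, E) x →L[ℝ] ℝ) := fun x Y Z =>
    mvfderiv 𝓘(ℝ, E) (fun y => g.inner y (Y y) (Z y)) x
        - g.inner x (Z x) ∘L D Y x - g.inner x (Y x) ∘L D Z x
  have hΦs : ∀ x Y Z, Φ x Y Z = Φ x Z Y := by
    intro x Y Z
    simp only [Φ]
    rw [funext fun y => g.symm y (Y y) (Z y), sub_right_comm]
  have hΦ₁ : ∀ x (Z : VField E Q), VDiffAt Z x → TensorialAt 𝓘(ℝ, E) E (Φ x · Z) x :=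
    fun x Z hZ => metric_tensorial g D hZ
  have hΦ₂ : ∀ x (Y : VField E Q), VDiffAt Y x → TensorialAt 𝓘(ℝ, E) E (Φ x Y) x := by
    intro x Y hY
    have := hΦ₁ x Y hY
    simp only [hΦs x _ Y] at this
    exact this
  have hA : ∀ x : Q, ∃ A : TangentSpace 𝓘(ℝ, E) x →L[ℝ] TangentSpace 𝓘(ℝ, E) x →L[ℝ]
      TangentSpace 𝓘(ℝ, E) x, (∀ X Y, A Y X - A X Y = -D.torsion x X Y) ∧
      ∀ X Y Z, g.inner x (A Y X) Z + g.inner x Y (A Z X) =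
        TensorialAt.mkHom₂ (Φ x) x (hΦ₁ x) (hΦ₂ x) Y Z X := by
    intro x
    refine exists_koszul_correction (g.inner x) (g.symm x) (g.pos x)
      (fun Y Z X => TensorialAt.mkHom₂ (Φ x) x (hΦ₁ x) (hΦ₂ x) Y Z X)
      (fun X Y => D.torsion x X Y) ?_ ?_ ?_ ?_ ?_ ?_ ?_ ?_
    · intro X Y Z
      simp only [TensorialAt.mkHom₂_apply_eq_extend, hΦs x _ (FiberBundle.extend E X)]
    · exact fun X Y => D.torsion_antisymm X Y
    · intro a b c; simp
    · intro r b c; simp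
    · intro a b c d; simp
    · intro r b c d; simp
    · intro a b c d; simp
    · intro r b c d; simp
  choose A hA₁ hA₂ using hA
  refine ⟨D.addOneForm A, ?_, ?_⟩
  · intro X Y x hX hY
    have h₁ := hA₁ x (X x) (Y x)
    rw [D.torsion_apply hX hY] at h₁
    change (D Y x (X x) + A x (Y x) (X x)) - (D X x (Y x) + A x (X x) (Y x)) = _
    rw [add_sub_add_comm, h₁]
    abel
  · intro X Y Z x hY hZ
    have h₂ := hA₂ x (X x) (Y x) (Z x)
    rw [TensorialAt.mkHom₂_apply (hΦ₁ x) (hΦ₂ x) hY hZ] at h₂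
    change _ = g.inner x (D Y x (X x) + A x (Y x) (X x)) (Z x)
      + g.inner x (Y x) (D Z x (X x) + A x (Z x) (X x))
    have e : Φ x Y Z (X x) = mvfderiv 𝓘(ℝ, E) (fun y => g.inner y (Y y) (Z y)) x (X x)
        - g.inner x (Z x) (D Y x (X x)) - g.inner x (Y x) (D Z x (X x)) := rfl
    rw [e, g.symm x (Z x)] at h₂
    rw [map_add (g.inner x), map_add (g.inner x (Y x))]
    change _ = g.inner x (D Y x (X x)) (Z x) + g.inner x (A x (Y x) (X x)) (Z x) + _
    linarith

/-- The Levi-Civita connection of `g`. -/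
def leviCivita (g : Metric E Q) : Connection E Q := (exists_isLeviCivita g).choose

theorem isLeviCivita_leviCivita (g : Metric E Q) : IsLeviCivita g (leviCivita g) :=
  (exists_isLeviCivita g).choose_spec

/-! ## Curvature, musical isomorphism, exterior derivative -/

/-- `∇_X ∇_Y Z - ∇_Y ∇_X Z - ∇_[X,Y] Z` for vector fields. -/
def curvatureField (D : Connection E Q) (X Y Z : VField E Q) : VField E Q := fun x =>
  D (fun y => D Z y (Y y)) x (X x) - D (fun y => D Z y (X y)) x (Y x)
    - D Z x (VectorField.mlieBracket 𝓘(ℝ, E) X Y x)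

/-- The curvature tensor `R(u, v) w` at `x`, computed by extending the three tangent vectors to
vector fields that are smooth near `x`. -/
def curvature (D : Connection E Q) (x : Q) (u v w : TangentSpace 𝓘(ℝ, E) x) :
    TangentSpace 𝓘(ℝ, E) x :=
  curvatureField D (FiberBundle.extend E u) (FiberBundle.extend E v) (FiberBundle.extend E w) x

/-- Smooth 1-forms on `Q`. -/
abbrev OneForm (E : Type*) [NormedAddCommGroup E] [NormedSpace ℝ E]
    (Q : Type*) [TopologicalSpace Q] [ChartedSpace E Q] [IsManifold 𝓘(ℝ, E) ∞ Q] : Type _ :=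
  ContMDiffSection 𝓘(ℝ, E) (E →L[ℝ] ℝ) ∞ (fun x : Q => TangentSpace 𝓘(ℝ, E) x →L[ℝ] ℝ)

/-- The tangent vector `v = ♯α` at `x` with `⟨v, w⟩ = α w` for all `w`. -/
def sharp (g : Metric E Q) (x : Q) (α : TangentSpace 𝓘(ℝ, E) x →L[ℝ] ℝ) :
    TangentSpace 𝓘(ℝ, E) x :=
  (exists_riesz (g.inner x) (g.pos x) (α : TangentSpace 𝓘(ℝ, E) x →ₗ[ℝ] ℝ)).choose

theorem inner_sharp (g : Metric E Q) (x : Q) (α : TangentSpace 𝓘(ℝ, E) x →L[ℝ] ℝ)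
    (w : TangentSpace 𝓘(ℝ, E) x) : g.inner x (sharp g x α) w = α w :=
  (exists_riesz (g.inner x) (g.pos x) (α : TangentSpace 𝓘(ℝ, E) x →ₗ[ℝ] ℝ)).choose_spec w

/-- The vector field `♯μ`. -/
def sharpField (g : Metric E Q) (μ : OneForm E Q) : VField E Q := fun x => sharp g x (μ x)

/-- `dμ(X, Y) = X (μ(Y)) - Y (μ(X)) - μ([X, Y])` for vector fields. -/
def extDerivField (μ : OneForm E Q) (X Y : VField E Q) (x : Q) : ℝ :=
  mvfderiv 𝓘(ℝ, E) (fun y => μ y (Y y)) x (X x) - mvfderiv 𝓘(ℝ, E) (fun y => μ y (X y)) x (Y x)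
    - μ x (VectorField.mlieBracket 𝓘(ℝ, E) X Y x)

theorem form_pairing_mdifferentiableAt (μ : OneForm E Q) {Y : VField E Q} {x : Q}
    (hY : VDiffAt Y x) : MDifferentiableAt 𝓘(ℝ, E) 𝓘(ℝ, ℝ) (fun y => μ y (Y y)) x := by
  have h : MDifferentiableAt 𝓘(ℝ, E) (𝓘(ℝ, E).prod 𝓘(ℝ, ℝ))
      (fun m ↦ TotalSpace.mk' ℝ (E := Bundle.Trivial Q ℝ) m (μ m (Y m))) x := by
    apply MDifferentiableAt.clm_bundle_apply (F₁ := E)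
    · exact μ.contMDiff.mdifferentiableAt (by simp)
    · exact hY
  rw [mdifferentiableAt_totalSpace] at h
  exact h.2

theorem extDerivField_swap (μ : OneForm E Q) (X Y : VField E Q) (x : Q) :
    extDerivField μ X Y x = -extDerivField μ Y X x := by
  unfold extDerivField
  rw [VectorField.mlieBracket_swap_apply, map_neg]
  ring

theorem extDerivField_tensorial_left (μ : OneForm E Q) (x : Q) (Y : VField E Q)
    (hY : VDiffAt Y x) : TensorialAt 𝓘(ℝ, E) E (fun X => extDerivField μ X Y x) x := by
  constructor
  · intro f X hf hX
    have h := mvfderiv_smul hf (form_pairing_mdifferentiableAt μ hX)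
    have hfun : (fun y => μ y ((f • X) y)) = f • (fun y => μ y (X y)) := by
      ext y
      simp
    unfold extDerivField
    rw [hfun, h, VectorField.mlieBracket_smul_left hf hX]
    simp
    ring
  · intro X X' hX hX'
    have h := mvfderiv_add (form_pairing_mdifferentiableAt μ hX)
      (form_pairing_mdifferentiableAt μ hX')
    have hfun : (fun y => μ y ((X + X') y)) = (fun y => μ y (X y)) + (fun y => μ y (X' y)) := by
      ext y
      simp
    unfold extDerivField
    rw [hfun, h, VectorField.mlieBracket_add_left hX hX']
    simp
    ring

theorem extDerivField_tensorial_right (μ : OneForm E Q) (x : Q) (X : VField E Q)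
    (hX : VDiffAt X x) : TensorialAt 𝓘(ℝ, E) E (fun Y => extDerivField μ X Y x) x := by
  have h := extDerivField_tensorial_left μ x X hX
  constructor
  · intro f Y hf hY
    rw [extDerivField_swap, extDerivField_swap μ X Y, h.smul hf hY, smul_neg]
  · intro Y Y' hY hY'
    rw [extDerivField_swap, extDerivField_swap μ X Y, extDerivField_swap μ X Y', h.add hY hY']
    ring

/-- The exterior derivative `dμ` as a bilinear form on each tangent space. -/
def extDeriv (μ : OneForm E Q) (x : Q) :
    TangentSpace 𝓘(ℝ, E) x →L[ℝ] TangentSpace 𝓘(ℝ, E) x →L[ℝ] ℝ :=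
  TensorialAt.mkHom₂ (fun X Y => extDerivField μ X Y x) x
    (extDerivField_tensorial_left μ x) (extDerivField_tensorial_right μ x)

theorem extDeriv_apply (μ : OneForm E Q) {X Y : VField E Q} {x : Q} (hX : VDiffAt X x)
    (hY : VDiffAt Y x) : extDeriv μ x (X x) (Y x) = extDerivField μ X Y x :=
  TensorialAt.mkHom₂_apply _ _ hX hY

/-- The operator `S` with `dμ(u, v) = ⟨S u, v⟩` for all `u, v ∈ T_x Q`. -/
def formOperator (g : Metric E Q) (μ : OneForm E Q) (x : Q) (u : TangentSpace 𝓘(ℝ, E) x) :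
    TangentSpace 𝓘(ℝ, E) x :=
  sharp g x (extDeriv μ x u)

/-! ## Curves

All derivatives along a curve are taken within a set `I` of times, which is always a
nondegenerate compact interval; at its endpoints they are one-sided. -/

/-- The velocity of the curve `c` at time `t`. -/
def velocity (c : ℝ → Q) (I : Set ℝ) (t : ℝ) : TangentSpace 𝓘(ℝ, E) (c t) :=
  mfderivWithin 𝓘(ℝ, ℝ) 𝓘(ℝ, E) c I t (1 : ℝ)

/-- The covariant derivative `DV/dt` of a vector field `V` along the curve `c`. In the chart
centred at `c t` this is `V̇ᵏ + Γᵏᵢⱼ Vⁱ ċʲ`: the second summand is the covariant derivative, in the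
direction of the velocity, of the local vector field that has constant coordinates in this chart
and extends `V t`. -/
def covDerivAlong (D : Connection E Q) (c : ℝ → Q) (I : Set ℝ)
    (V : ∀ t, TangentSpace 𝓘(ℝ, E) (c t)) (t : ℝ) : TangentSpace 𝓘(ℝ, E) (c t) :=
  (trivializationAt E (TangentSpace 𝓘(ℝ, E)) (c t)).symmL ℝ (c t)
      (derivWithin (fun τ => (trivializationAt E (TangentSpace 𝓘(ℝ, E)) (c t)
        (TotalSpace.mk' E (c τ) (V τ))).2) I t)
    + D (FiberBundle.extend E (V t)) (c t) (velocity c I t)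

/-- The covariant acceleration `D²c/dt²` for the Levi-Civita connection. -/
def accel (g : Metric E Q) (c : ℝ → Q) (I : Set ℝ) (t : ℝ) : TangentSpace 𝓘(ℝ, E) (c t) :=
  covDerivAlong (leviCivita g) c I (velocity c I) t

/-- There is a subdivision `0 = τ 0 < ⋯ < τ m = T` such that `P` holds for each consecutive pair
of its points. -/
def Piecewise (T : ℝ) (P : ℝ → ℝ → Prop) : Prop :=
  ∃ (m : ℕ) (τ : ℕ → ℝ), τ 0 = 0 ∧ τ m = T ∧ ∀ i < m, τ i < τ (i + 1) ∧ P (τ i) (τ (i + 1))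

/-- The curves `c : [0, T] → Q` that are `C¹` and piecewise smooth, with prescribed position and
velocity `p₀ = (q₀, v₀)` at time `0` and `p₁ = (q_T, v_T)` at time `T`. -/
structure IsAdmissible (T : ℝ) (p₀ p₁ : TangentBundle 𝓘(ℝ, E) Q) (c : ℝ → Q) : Prop where
  contMDiffOn_one : ContMDiffOn 𝓘(ℝ, ℝ) 𝓘(ℝ, E) 1 c (Icc 0 T)
  piecewise_smooth : Piecewise T fun a b => ContMDiffOn 𝓘(ℝ, ℝ) 𝓘(ℝ, E) ∞ c (Icc a b)
  initial : TotalSpace.mk' E (c 0) (velocity c (Icc 0 T) 0) = p₀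
  final : TotalSpace.mk' E (c T) (velocity c (Icc 0 T) T) = p₁

/-- The augmented functional
`∫₀ᵀ (½ ⟨D²c/dt², D²c/dt²⟩ + ∑ₐ λₐ ⟨μᵃ(c), D²c/dt²⟩) dt`. -/
def augmentedEnergy (g : Metric E Q) {r : ℕ} (μ : Fin r → OneForm E Q) (T : ℝ)
    (c : ℝ → Q) (lam : Fin r → ℝ → ℝ) : ℝ :=
  ∫ t in (0 : ℝ)..T,
    ((1 / 2 : ℝ) * g.inner (c t) (accel g c (Icc 0 T) t) (accel g c (Icc 0 T) t)
      + ∑ k, lam k t * μ k (c t) (accel g c (Icc 0 T) t))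

/-- `(Γ s, Λ s)`, for `|s| < ε`, is a variation of `(c, lam)` through admissible curves and
piecewise smooth multipliers. -/
structure IsVariation (T : ℝ) (p₀ p₁ : TangentBundle 𝓘(ℝ, E) Q) {r : ℕ} (c : ℝ → Q)
    (lam : Fin r → ℝ → ℝ) (ε : ℝ) (Γ : ℝ → ℝ → Q) (Λ : ℝ → Fin r → ℝ → ℝ) : Prop where
  pos : 0 < ε
  curve_zero : ∀ t ∈ Icc 0 T, Γ 0 t = c t
  multiplier_zero : ∀ k, ∀ t ∈ Icc 0 T, Λ 0 k t = lam k t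
  admissible : ∀ s ∈ Ioo (-ε) ε, IsAdmissible T p₀ p₁ (Γ s)
  curve_smooth : Piecewise T fun a b =>
    ContMDiffOn 𝓘(ℝ, ℝ × ℝ) 𝓘(ℝ, E) ∞ (fun p : ℝ × ℝ => Γ p.1 p.2) (Ioo (-ε) ε ×ˢ Icc a b)
  multiplier_smooth : ∀ k, Piecewise T fun a b =>
    ContDiffOn ℝ ∞ (fun p : ℝ × ℝ => Λ p.1 k p.2) (Ioo (-ε) ε ×ˢ Icc a b)

/-- `c` is a normal extremal, with multipliers `lam`, of the energy
`∫₀ᵀ ½ ⟨D²c/dt², D²c/dt²⟩ dt` over the admissible curves that satisfy the constraints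
`⟨μᵃ(c), D²c/dt²⟩ = 0`. -/
structure IsNormalExtremal (g : Metric E Q) {r : ℕ} (μ : Fin r → OneForm E Q) (T : ℝ)
    (p₀ p₁ : TangentBundle 𝓘(ℝ, E) Q) (c : ℝ → Q) (lam : Fin r → ℝ → ℝ) : Prop where
  admissible : IsAdmissible T p₀ p₁ c
  multiplier_smooth : ∀ k, Piecewise T fun a b => ContDiffOn ℝ ∞ (lam k) (Icc a b)
  constraint : ∀ a b, 0 ≤ a → a < b → b ≤ T → ContMDiffOn 𝓘(ℝ, ℝ) 𝓘(ℝ, E) ∞ c (Icc a b) →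
    ∀ k, ∀ t ∈ Icc a b, μ k (c t) (accel g c (Icc a b) t) = 0
  critical : ∀ ε Γ Λ, IsVariation T p₀ p₁ c lam ε Γ Λ →
    HasDerivAt (fun s => augmentedEnergy g μ T (Γ s) (Λ s)) 0 0

end CovAcc

end

open CovAcc

/-! A normal extremal is a critical point of a second-order variational problem, so the theorem is
its Euler–Lagrange equation; the work is to compute the first variation covariantly and to know
that enough variations are admissible.

*Chart calculus.* In the chart centred at `x₀` the metric and the Levi-Civita connection become
smooth families of bilinear maps `metricRep` and `christoffel`, both symmetric and related by metric
compatibility: they form a `LocalMetric`. From these properties alone follow the symmetries of the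
curvature, in particular `⟨R(p, v) v, q⟩ = ⟨R(q, v) v, p⟩` (`LocalMetric.metric_curvRep_pair`). All
objects of the statement have coordinate expressions: covariant derivatives along curves
(`coord_covDerivAlong`), the curvature (`coord_curvature`), and, by `inner_formOperator`,
the operator `S`, which is the difference of `∇X` and its adjoint.

*First variation.* Moving the curve `x` in the chart to `x + s η`, the covariant derivative in `s`
of the acceleration is `D²η + R(η, ẋ) ẋ` (`LocalMetric.hasCovDerivAt_accel`). With the acceleration
`A`, the momentum `P = A + ∑ λₖ Xₖ` and the pair symmetry of the curvature, the derivative of the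
integrand is `⟨D²P + R(P, ẋ) ẋ, η⟩ + ∑ λₖ ⟨∇_η Xₖ, A⟩` plus the total derivative of
`⟨Dη, P⟩ - ⟨η, DP⟩` (`LocalMetric.firstVariation_eq`, `LocalMetric.hasDerivAt_boundary`). Since
`⟨∇_η X, A⟩ = ⟨∇_A X - S A, η⟩`, this is the claimed equation paired with `η`.

*Admissible variations.* If `η` has compact support in an open set of times that the curve maps
into one chart, and on which curve and multipliers are smooth, then `x + s η`, extended by the
unchanged curve, is an admissible variation (`isVariation_chartVariation`). The functional splits
into a constant and the integral over the support. This needs that the integrand is integrable on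
`[0, T]` (`IsAdmissible.integrableOn_energyDensity`); otherwise the functional would have the
value `0` and criticality would say nothing. Criticality then gives the weak Euler–Lagrange
equation (`IsNormalExtremal.integral_eulerLagrange`), the fundamental lemma of the calculus of
variations gives the equation at interior times, and continuity gives it at the endpoints
(`IsNormalExtremal.eulerLagrange_eq_zero`). -/

open Set Bundle MeasureTheory
open scoped Manifold ContDiff Topology

noncomputable section

namespace CovAcc

variable {E : Type*} [NormedAddCommGroup E] [NormedSpace ℝ E] [FiniteDimensional ℝ E]
  {Q : Type*} [TopologicalSpace Q] [ChartedSpace E Q] [IsManifold 𝓘(ℝ, E) ∞ Q]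

set_option linter.unusedSectionVars false

/-! ### Vector fields and differentiability in a chart -/

/-- The components of a tangent vector in the chart centred at `x₀`. -/
def coord (x₀ y : Q) : TangentSpace 𝓘(ℝ, E) y →L[ℝ] E :=
  (trivializationAt E (TangentSpace 𝓘(ℝ, E)) x₀).continuousLinearMapAt ℝ y

/-- The tangent vector at `y` with components `v` in the chart centred at `x₀`. As `y` varies this
is the vector field with constant components `v`. -/
def frame (x₀ : Q) (v : E) : VField E Q := fun y =>
  (trivializationAt E (TangentSpace 𝓘(ℝ, E)) x₀).symmL ℝ y v

/-- The components of a vector field in the chart centred at `x₀`, as a function on the model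
space. -/
def localRep (x₀ : Q) (Y : VField E Q) (z : E) : E :=
  coord x₀ ((extChartAt 𝓘(ℝ, E) x₀).symm z) (Y ((extChartAt 𝓘(ℝ, E) x₀).symm z))

section Chart

variable {x₀ y : Q}

theorem source_eq (x₀ : Q) : (extChartAt 𝓘(ℝ, E) x₀).source = (chartAt E x₀).source :=
  extChartAt_source ..

theorem baseSet_eq (x₀ : Q) :
    (trivializationAt E (TangentSpace 𝓘(ℝ, E)) x₀).baseSet = (chartAt E x₀).source := rfl

theorem coord_apply (hy : y ∈ (chartAt E x₀).source) (w : TangentSpace 𝓘(ℝ, E) y) :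
    coord x₀ y w = (trivializationAt E (TangentSpace 𝓘(ℝ, E)) x₀ (TotalSpace.mk' E y w)).2 :=
  Trivialization.continuousLinearMapAt_apply_of_mem (R := ℝ) _ hy _

theorem coord_frame (hy : y ∈ (chartAt E x₀).source) (v : E) :
    coord x₀ y (frame x₀ v y) = v :=
  Trivialization.continuousLinearMapAt_symmL _ (R := ℝ) hy v

theorem frame_coord (hy : y ∈ (chartAt E x₀).source) (w : TangentSpace 𝓘(ℝ, E) y) :
    frame x₀ (coord x₀ y w) y = w :=
  Trivialization.symmL_continuousLinearMapAt _ (R := ℝ) hy w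

theorem coord_injective (hy : y ∈ (chartAt E x₀).source) {v w : TangentSpace 𝓘(ℝ, E) y}
    (h : coord x₀ y v = coord x₀ y w) : v = w := by
  rw [← frame_coord hy v, h, frame_coord hy w]

theorem coord_eq_mfderiv (hy : y ∈ (chartAt E x₀).source) :
    coord x₀ y = mfderiv 𝓘(ℝ, E) 𝓘(ℝ, E) (extChartAt 𝓘(ℝ, E) x₀) y :=
  TangentBundle.continuousLinearMapAt_trivializationAt hy

theorem frame_add (v w : E) : frame x₀ (v + w) = (frame x₀ v + frame x₀ w : VField E Q) := by
  ext y; simp [frame]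

theorem frame_smul (r : ℝ) (v : E) : frame x₀ (r • v) = (r • frame x₀ v : VField E Q) := by
  ext y; simp [frame]

theorem extend_eq_frame {x : Q} (v : TangentSpace 𝓘(ℝ, E) x) (hy : y ∈ (chartAt E x).source) :
    (FiberBundle.extend E v y : TangentSpace 𝓘(ℝ, E) y) = frame x (coord x x v) y := by
  rw [coord_apply (mem_chart_source E x)]
  exact (Trivialization.symmL_apply (R := ℝ) (trivializationAt E (TangentSpace 𝓘(ℝ, E)) x)
    hy _).symm

theorem symm_mem {z : E} (hz : z ∈ (extChartAt 𝓘(ℝ, E) x₀).target) :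
    (extChartAt 𝓘(ℝ, E) x₀).symm z ∈ (chartAt E x₀).source := by
  rw [← source_eq]; exact (extChartAt 𝓘(ℝ, E) x₀).map_target hz

theorem chart_mem (hy : y ∈ (chartAt E x₀).source) :
    extChartAt 𝓘(ℝ, E) x₀ y ∈ (extChartAt 𝓘(ℝ, E) x₀).target := by
  rw [← source_eq] at hy; exact (extChartAt 𝓘(ℝ, E) x₀).map_source hy

theorem symm_chart (hy : y ∈ (chartAt E x₀).source) :
    (extChartAt 𝓘(ℝ, E) x₀).symm (extChartAt 𝓘(ℝ, E) x₀ y) = y := by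
  rw [← source_eq] at hy; exact (extChartAt 𝓘(ℝ, E) x₀).left_inv hy

theorem chart_symm {z : E} (hz : z ∈ (extChartAt 𝓘(ℝ, E) x₀).target) :
    extChartAt 𝓘(ℝ, E) x₀ ((extChartAt 𝓘(ℝ, E) x₀).symm z) = z :=
  (extChartAt 𝓘(ℝ, E) x₀).right_inv hz

theorem source_mem_nhds (hy : y ∈ (chartAt E x₀).source) : (chartAt E x₀).source ∈ 𝓝 y :=
  (chartAt E x₀).open_source.mem_nhds hy

theorem target_isOpen (x₀ : Q) : IsOpen (extChartAt 𝓘(ℝ, E) x₀).target :=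
  isOpen_extChartAt_target x₀

theorem contMDiffOn_symm (x₀ : Q) : ContMDiffOn 𝓘(ℝ, E) 𝓘(ℝ, E) ∞ (extChartAt 𝓘(ℝ, E) x₀).symm
    (extChartAt 𝓘(ℝ, E) x₀).target := contMDiffOn_extChartAt_symm x₀

theorem contMDiffOn_chart (x₀ : Q) : ContMDiffOn 𝓘(ℝ, E) 𝓘(ℝ, E) ∞ (extChartAt 𝓘(ℝ, E) x₀)
    (chartAt E x₀).source := contMDiffOn_extChartAt

theorem localRep_chart (hy : y ∈ (chartAt E x₀).source) (Y : VField E Q) :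
    localRep x₀ Y (extChartAt 𝓘(ℝ, E) x₀ y) = coord x₀ y (Y y) := by
  simp only [localRep]
  rw [symm_chart hy]

theorem localRep_frame {z : E} (hz : z ∈ (extChartAt 𝓘(ℝ, E) x₀).target) (v : E) :
    localRep x₀ (frame x₀ v) z = v := coord_frame (symm_mem hz) v

/-- A function near a point of the chart domain is differentiable iff it is so in the chart. -/
theorem mdifferentiableAt_iff_comp_symm {F : Type*} [NormedAddCommGroup F] [NormedSpace ℝ F]
    {f : Q → F} (hy : y ∈ (chartAt E x₀).source) :
    MDifferentiableAt 𝓘(ℝ, E) 𝓘(ℝ, F) f y ↔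
      DifferentiableAt ℝ (f ∘ (extChartAt 𝓘(ℝ, E) x₀).symm) (extChartAt 𝓘(ℝ, E) x₀ y) := by
  constructor
  · intro h
    rw [← mdifferentiableAt_iff_differentiableAt]
    have h' : MDifferentiableAt 𝓘(ℝ, E) 𝓘(ℝ, F) f ((extChartAt 𝓘(ℝ, E) x₀).symm
      (extChartAt 𝓘(ℝ, E) x₀ y)) := by rwa [symm_chart hy]
    exact h'.comp _ (((contMDiffOn_symm x₀).contMDiffAt
      ((target_isOpen x₀).mem_nhds (chart_mem hy))).mdifferentiableAt (by simp))
  · intro h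
    rw [← mdifferentiableAt_iff_differentiableAt] at h
    have := h.comp y (((contMDiffOn_chart x₀).contMDiffAt (source_mem_nhds hy)).mdifferentiableAt
      (by simp))
    refine this.congr_of_eventuallyEq ?_
    filter_upwards [source_mem_nhds hy] with w hw
    rw [Function.comp_apply, Function.comp_apply, symm_chart hw]

theorem mvfderiv_eq_fderiv {F : Type*} [NormedAddCommGroup F] [NormedSpace ℝ F]
    {f : Q → F} (hy : y ∈ (chartAt E x₀).source) (hf : MDifferentiableAt 𝓘(ℝ, E) 𝓘(ℝ, F) f y)
    (w : TangentSpace 𝓘(ℝ, E) y) :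
    mvfderiv 𝓘(ℝ, E) f y w = fderiv ℝ (f ∘ (extChartAt 𝓘(ℝ, E) x₀).symm)
      (extChartAt 𝓘(ℝ, E) x₀ y) (coord x₀ y w) := by
  have h1 := (mdifferentiableAt_iff_comp_symm hy).1 hf
  rw [← mdifferentiableAt_iff_differentiableAt] at h1
  have h2 := ((contMDiffOn_chart x₀).contMDiffAt (source_mem_nhds hy)).mdifferentiableAt
      (by simp : (∞ : WithTop ℕ∞) ≠ 0)
  have h3 := mfderiv_comp y h1 h2
  have h4 : f =ᶠ[𝓝 y] (f ∘ (extChartAt 𝓘(ℝ, E) x₀).symm) ∘ (extChartAt 𝓘(ℝ, E) x₀) := by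
    filter_upwards [source_mem_nhds hy] with w hw
    rw [Function.comp_apply, Function.comp_apply, symm_chart hw]
  rw [← h4.mfderiv_eq, mfderiv_eq_fderiv, ← coord_eq_mfderiv hy] at h3
  exact congrArg (fun L : E →L[ℝ] F => L w) h3

theorem vdiffAt_iff_mdifferentiableAt (hy : y ∈ (chartAt E x₀).source) {Y : VField E Q} :
    VDiffAt Y y ↔ MDifferentiableAt 𝓘(ℝ, E) 𝓘(ℝ, E) (fun p => coord x₀ p (Y p)) y := by
  rw [VDiffAt, (trivializationAt E (TangentSpace 𝓘(ℝ, E)) x₀).mdifferentiableAt_section_iff _ Y hy]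
  refine Filter.EventuallyEq.mdifferentiableAt_iff ?_
  filter_upwards [source_mem_nhds hy] with w hw
  exact (coord_apply hw _).symm

theorem vdiffAt_iff (hy : y ∈ (chartAt E x₀).source) {Y : VField E Q} :
    VDiffAt Y y ↔ DifferentiableAt ℝ (localRep x₀ Y) (extChartAt 𝓘(ℝ, E) x₀ y) := by
  rw [vdiffAt_iff_mdifferentiableAt hy, mdifferentiableAt_iff_comp_symm hy]
  rfl

theorem vdiffAt_frame (hy : y ∈ (chartAt E x₀).source) (v : E) : VDiffAt (frame x₀ v) y := by
  rw [vdiffAt_iff hy]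
  refine (differentiableAt_const v).congr_of_eventuallyEq ?_
  filter_upwards [(target_isOpen x₀).mem_nhds (chart_mem hy)] with z hz
  exact localRep_frame hz v

theorem contMDiffOn_frame (v : E) : ContMDiffOn 𝓘(ℝ, E) (𝓘(ℝ, E).prod 𝓘(ℝ, E)) ∞
    (fun p => (TotalSpace.mk' E p (frame x₀ v p) : TangentBundle 𝓘(ℝ, E) Q))
    (chartAt E x₀).source := by
  rw [(trivializationAt E (TangentSpace 𝓘(ℝ, E)) x₀).contMDiffOn_section_iff
    (chartAt E x₀).open_source (baseSet_eq x₀).ge]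
  refine (contMDiffOn_const (c := v)).congr fun p hp => ?_
  rw [← coord_apply hp, coord_frame hp]

end Chart

/-! ### The Christoffel symbols -/

section Christoffel

theorem connection_sub_mvfderiv_tensorial (D : Connection E Q) {x₀ y : Q}
    (hy : y ∈ (chartAt E x₀).source) (u : TangentSpace 𝓘(ℝ, E) y) :
    TensorialAt 𝓘(ℝ, E) E (fun Y : VField E Q =>
      coord x₀ y (D Y y u) - mvfderiv 𝓘(ℝ, E) (fun p => coord x₀ p (Y p)) y u) y := by
  constructor
  · intro f Y hf hY
    have hY' := (vdiffAt_iff_mdifferentiableAt hy).1 hY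
    have h := mvfderiv_smul hf hY'
    have hfun : (fun p => coord x₀ p ((f • Y) p)) = f • (fun p => coord x₀ p (Y p)) := by
      ext p; simp
    rw [hfun, h, D.isCovariantDerivativeOn.leibniz hY hf]
    simp [smul_sub]
  · intro Y Y' hY hY'
    have h := mvfderiv_add ((vdiffAt_iff_mdifferentiableAt hy).1 hY)
      ((vdiffAt_iff_mdifferentiableAt hy).1 hY')
    have hfun : (fun p => coord x₀ p ((Y + Y') p)) =
        (fun p => coord x₀ p (Y p)) + (fun p => coord x₀ p (Y' p)) := by
      ext p; simp
    rw [hfun, h, D.isCovariantDerivativeOn.add hY hY']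
    simp
    abel

/-- The bilinear map `(u, v) ↦ ∇_u v` at `y`, for vector fields with constant components. -/
def christoffelAt (D : Connection E Q) (x₀ y : Q) (hy : y ∈ (chartAt E x₀).source) :
    E →L[ℝ] E →L[ℝ] E :=
  (LinearMap.mk₂ ℝ (fun u v => coord x₀ y (D (frame x₀ v) y (frame x₀ u y)))
    (fun u u' v => by rw [frame_add, Pi.add_apply, map_add, map_add])
    (fun r u v => by rw [frame_smul, Pi.smul_apply, map_smul, map_smul])
    (fun u v v' => by
      rw [frame_add, D.isCovariantDerivativeOn.add (vdiffAt_frame hy v) (vdiffAt_frame hy v'),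
        add_apply, map_add])
    (fun r u v => by
      rw [frame_smul, D.isCovariantDerivativeOn.smul_const r (vdiffAt_frame hy v),
        smul_apply, map_smul])).toContinuousBilinearMap

open Classical in
/-- The Christoffel symbols of a connection in the chart centred at `x₀`, as a bilinear map
`Γ(u, v) = ∇_u v` for vector fields with constant components; zero outside of the chart. -/
def christoffel (D : Connection E Q) (x₀ : Q) (z : E) : E →L[ℝ] E →L[ℝ] E :=
  if hz : z ∈ (extChartAt 𝓘(ℝ, E) x₀).target then christoffelAt D x₀ _ (symm_mem hz) else 0

theorem christoffel_apply (D : Connection E Q) {x₀ y : Q} (hy : y ∈ (chartAt E x₀).source)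
    (u v : E) : christoffel D x₀ (extChartAt 𝓘(ℝ, E) x₀ y) u v =
      coord x₀ y (D (frame x₀ v) y (frame x₀ u y)) := by
  rw [christoffel, dif_pos (chart_mem hy)]
  change coord x₀ _ (D (frame x₀ v) _ (frame x₀ u _)) = _
  rw [symm_chart hy]

/-- The covariant derivative of a vector field in coordinates. -/
theorem coord_connection (D : Connection E Q) {x₀ y : Q} (hy : y ∈ (chartAt E x₀).source)
    {Y : VField E Q} (hY : VDiffAt Y y) (u : TangentSpace 𝓘(ℝ, E) y) :
    coord x₀ y (D Y y u) = fderiv ℝ (localRep x₀ Y) (extChartAt 𝓘(ℝ, E) x₀ y) (coord x₀ y u)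
      + christoffel D x₀ (extChartAt 𝓘(ℝ, E) x₀ y) (coord x₀ y u) (coord x₀ y (Y y)) := by
  have h := (connection_sub_mvfderiv_tensorial D hy u).pointwise hY
    (vdiffAt_frame hy (coord x₀ y (Y y))) (frame_coord hy _).symm
  have h1 : mvfderiv 𝓘(ℝ, E) (fun p => coord x₀ p (frame x₀ (coord x₀ y (Y y)) p)) y = 0 := by
    have : (fun p => coord x₀ p (frame x₀ (coord x₀ y (Y y)) p)) =ᶠ[𝓝 y]
        fun _ => coord x₀ y (Y y) := by
      filter_upwards [source_mem_nhds hy] with p hp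
      exact coord_frame hp _
    have h2 := this.mfderiv_eq (I := 𝓘(ℝ, E)) (I' := 𝓘(ℝ, E))
    rw [mfderiv_const] at h2
    ext w
    exact congrArg (fun L : E →L[ℝ] E => L w) h2
  simp only [h1, zero_apply, sub_zero] at h
  rw [mvfderiv_eq_fderiv hy ((vdiffAt_iff_mdifferentiableAt hy).1 hY)] at h
  rw [christoffel_apply D hy, frame_coord hy, ← h]
  exact (add_sub_cancel _ _).symm

end Christoffel

/-! ### The Levi-Civita connection in a chart -/

/-- A vector field on the model space with constant value `w`. -/
def constField (w : E) : VField E E := fun _ => w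

theorem vdiffAt_constField (w z : E) : VDiffAt (constField w) z := by
  have h : frame z w = constField w := by
    ext y
    exact congrArg (fun L : E →L[ℝ] E => L w) (TangentBundle.symmL_model_space z y)
  rw [← h]
  exact vdiffAt_frame (mem_chart_source E z) w

theorem mlieBracket_constField (u v z : E) :
    VectorField.mlieBracket 𝓘(ℝ, E) (constField u) (constField v) z = 0 := by
  rw [← VectorField.mlieBracketWithin_univ, VectorField.mlieBracketWithin_eq_lieBracketWithin]
  change fderivWithin ℝ (fun _ : E => v) univ z u - fderivWithin ℝ (fun _ : E => u) univ z v = 0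
  simp

theorem two_le_infty : (2 : WithTop ℕ∞) ≤ ∞ :=
  WithTop.coe_le_coe.2 (le_top : (2 : ℕ∞) ≤ ⊤)

/-- Vector fields with constant components in a chart commute. -/
theorem mlieBracket_frame {x₀ y : Q} (hy : y ∈ (chartAt E x₀).source) (u v : E) :
    VectorField.mlieBracket 𝓘(ℝ, E) (frame x₀ u) (frame x₀ v) y = 0 := by
  have hφ : ContMDiffAt 𝓘(ℝ, E) 𝓘(ℝ, E) ∞ (extChartAt 𝓘(ℝ, E) x₀) y :=
    (contMDiffOn_chart x₀).contMDiffAt (source_mem_nhds hy)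
  have hpull : ∀ w : E, VectorField.mpullback 𝓘(ℝ, E) 𝓘(ℝ, E) (extChartAt 𝓘(ℝ, E) x₀)
      (constField w) =ᶠ[𝓝 y] frame x₀ w := fun w => by
    filter_upwards [source_mem_nhds hy] with p hp
    refine coord_injective hp ?_
    rw [coord_frame hp, VectorField.mpullback_apply, coord_eq_mfderiv hp]
    have hinv := isInvertible_mfderiv_extChartAt (I := 𝓘(ℝ, E)) (x := x₀) (y := p)
      (by rwa [source_eq])
    exact hinv.self_apply_inverse w
  have : IsManifold 𝓘(ℝ, E) (minSmoothness ℝ 2) Q := by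
    rw [minSmoothness_of_isRCLikeNormedField]
    exact IsManifold.of_le (n := ∞) two_le_infty
  have : IsManifold 𝓘(ℝ, E) (minSmoothness ℝ 2) E := by
    rw [minSmoothness_of_isRCLikeNormedField]
    infer_instance
  have h := VectorField.mpullback_mlieBracket (vdiffAt_constField u _) (vdiffAt_constField v _) hφ
    (by rw [minSmoothness_of_isRCLikeNormedField]; exact two_le_infty)
  rw [(hpull u).mlieBracket_vectorField_eq (hpull v)] at h
  rw [← h, VectorField.mpullback_apply, mlieBracket_constField, map_zero]

theorem christoffel_symm {g : Metric E Q} {D : Connection E Q} (hD : IsLeviCivita g D) {x₀ : Q}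
    {z : E} (hz : z ∈ (extChartAt 𝓘(ℝ, E) x₀).target) (u v : E) :
    christoffel D x₀ z u v = christoffel D x₀ z v u := by
  have hy := symm_mem hz
  have h := hD.torsion_free (frame x₀ u) (frame x₀ v) _ (vdiffAt_frame hy u) (vdiffAt_frame hy v)
  rw [mlieBracket_frame hy, sub_eq_zero] at h
  rw [← chart_symm hz, christoffel_apply D hy, christoffel_apply D hy, h]

/-- The metric in the chart centred at `x₀`, as a bilinear form depending on the point of the model
space. -/
def metricRep (g : Metric E Q) (x₀ : Q) (z : E) : E →L[ℝ] E →L[ℝ] ℝ :=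
  (LinearMap.mk₂ ℝ (fun u v => g.inner ((extChartAt 𝓘(ℝ, E) x₀).symm z)
      (frame x₀ u ((extChartAt 𝓘(ℝ, E) x₀).symm z))
      (frame x₀ v ((extChartAt 𝓘(ℝ, E) x₀).symm z)))
    (fun u u' v => by rw [frame_add, Pi.add_apply, map_add, add_apply])
    (fun r u v => by rw [frame_smul, Pi.smul_apply, map_smul, smul_apply])
    (fun u v v' => by rw [frame_add, Pi.add_apply, map_add])
    (fun r u v => by rw [frame_smul, Pi.smul_apply, map_smul])).toContinuousBilinearMap

theorem metricRep_apply (g : Metric E Q) (x₀ : Q) (z u v : E) :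
    metricRep g x₀ z u v = g.inner ((extChartAt 𝓘(ℝ, E) x₀).symm z)
      (frame x₀ u ((extChartAt 𝓘(ℝ, E) x₀).symm z))
      (frame x₀ v ((extChartAt 𝓘(ℝ, E) x₀).symm z)) := rfl

theorem metricRep_chart (g : Metric E Q) {x₀ y : Q} (hy : y ∈ (chartAt E x₀).source)
    (u v : TangentSpace 𝓘(ℝ, E) y) :
    metricRep g x₀ (extChartAt 𝓘(ℝ, E) x₀ y) (coord x₀ y u) (coord x₀ y v) = g.inner y u v := by
  rw [metricRep_apply, symm_chart hy, frame_coord hy, frame_coord hy]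

theorem metricRep_symm (g : Metric E Q) (x₀ : Q) (z u v : E) :
    metricRep g x₀ z u v = metricRep g x₀ z v u := by
  rw [metricRep_apply, metricRep_apply, g.symm]

theorem metricRep_pos (g : Metric E Q) {x₀ : Q} {z : E}
    (hz : z ∈ (extChartAt 𝓘(ℝ, E) x₀).target) {v : E} (hv : v ≠ 0) :
    0 < metricRep g x₀ z v v := by
  rw [metricRep_apply]
  refine g.pos _ _ fun h => hv ?_
  rw [← coord_frame (symm_mem hz) v, h, map_zero]

theorem contDiffOn_metricRep (g : Metric E Q) (x₀ : Q) :
    ContDiffOn ℝ ∞ (metricRep g x₀) (extChartAt 𝓘(ℝ, E) x₀).target := by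
  rw [contDiffOn_clm_apply]
  intro u
  rw [contDiffOn_clm_apply]
  intro v
  have h : ContMDiffOn 𝓘(ℝ, E) (𝓘(ℝ, E).prod 𝓘(ℝ, ℝ)) ∞
      (fun m ↦ TotalSpace.mk' ℝ (E := Bundle.Trivial Q ℝ) m
        (g.inner m (frame x₀ u m) (frame x₀ v m))) (chartAt E x₀).source := by
    apply ContMDiffOn.clm_bundle_apply₂ (F₁ := E) (F₂ := E)
    · exact g.contMDiff.contMDiffOn
    · exact contMDiffOn_frame u
    · exact contMDiffOn_frame v
  have h2 : ContMDiffOn 𝓘(ℝ, E) 𝓘(ℝ, ℝ) ∞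
      (fun m ↦ g.inner m (frame x₀ u m) (frame x₀ v m)) (chartAt E x₀).source := by
    intro p hp
    have := h p hp
    rw [contMDiffWithinAt_totalSpace] at this
    exact this.2
  rw [← contMDiffOn_iff_contDiffOn]
  refine (h2.comp (contMDiffOn_symm x₀) fun z hz => symm_mem hz).congr fun z _ => ?_
  rw [metricRep_apply]; rfl

theorem fderiv_metricRep_apply (g : Metric E Q) {x₀ : Q} {z : E}
    (hz : z ∈ (extChartAt 𝓘(ℝ, E) x₀).target) (u v w : E) :
    fderiv ℝ (metricRep g x₀) z u v w = fderiv ℝ (fun z => metricRep g x₀ z v w) z u := by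
  have h : DifferentiableAt ℝ (metricRep g x₀) z :=
    ((contDiffOn_metricRep g x₀).contDiffAt ((target_isOpen x₀).mem_nhds hz)).differentiableAt
      (by simp)
  have h1 := (h.hasFDerivAt.clm_apply (hasFDerivAt_const v z)).clm_apply (hasFDerivAt_const w z)
  rw [h1.fderiv]
  simp

theorem metricRep_compat {g : Metric E Q} {D : Connection E Q} (hD : IsLeviCivita g D) {x₀ : Q}
    {z : E} (hz : z ∈ (extChartAt 𝓘(ℝ, E) x₀).target) (u v w : E) :
    fderiv ℝ (metricRep g x₀) z u v w = metricRep g x₀ z (christoffel D x₀ z u v) w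
      + metricRep g x₀ z v (christoffel D x₀ z u w) := by
  have hy := symm_mem hz
  have h := hD.metric (frame x₀ u) (frame x₀ v) (frame x₀ w) _ (vdiffAt_frame hy v)
    (vdiffAt_frame hy w)
  rw [mvfderiv_eq_fderiv hy (metric_pairing_mdifferentiableAt g (vdiffAt_frame hy v)
    (vdiffAt_frame hy w)), coord_frame hy, chart_symm hz] at h
  rw [fderiv_metricRep_apply g hz]
  have e : (fun z => metricRep g x₀ z v w) =
      (fun y => g.inner y (frame x₀ v y) (frame x₀ w y)) ∘ (extChartAt 𝓘(ℝ, E) x₀).symm := by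
    ext z; exact metricRep_apply ..
  rw [e, h, ← metricRep_chart g hy, ← metricRep_chart g hy, ← christoffel_apply D hy,
    ← christoffel_apply D hy, chart_symm hz, coord_frame hy, coord_frame hy]

theorem metricRep_isInvertible (g : Metric E Q) {x₀ : Q} {z : E}
    (hz : z ∈ (extChartAt 𝓘(ℝ, E) x₀).target) : (metricRep g x₀ z).IsInvertible := by
  have hinj : Function.Injective (metricRep g x₀ z : E →ₗ[ℝ] E →L[ℝ] ℝ) := by
    refine (injective_iff_map_eq_zero _).2 fun v hv => ?_
    by_contra hne
    have h0 : metricRep g x₀ z v v = 0 := congrArg (fun f : E →L[ℝ] ℝ => f v) hv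
    exact (metricRep_pos g hz hne).ne' h0
  have hdim : Module.finrank ℝ E = Module.finrank ℝ (E →L[ℝ] ℝ) := by
    rw [← (LinearMap.toContinuousLinearMap (𝕜 := ℝ) (E := E) (F' := ℝ)).finrank_eq]
    exact (Subspace.dual_finrank_eq (K := ℝ) (V := E)).symm
  exact ⟨(LinearEquiv.ofInjectiveOfFinrankEq _ hinj hdim).toContinuousLinearEquiv, by ext; rfl⟩

/-- The components `X` of the vector field dual to a smooth family of covectors are smooth. -/
theorem contDiffOn_of_metricRep_eq (g : Metric E Q) {x₀ : Q} {X : E → E} {α : E → E → ℝ}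
    (hα : ∀ w, ContDiffOn ℝ ∞ (fun z => α z w) (extChartAt 𝓘(ℝ, E) x₀).target)
    (h : ∀ z ∈ (extChartAt 𝓘(ℝ, E) x₀).target, ∀ w, metricRep g x₀ z (X z) w = α z w) :
    ContDiffOn ℝ ∞ X (extChartAt 𝓘(ℝ, E) x₀).target := by
  have h1 : ContDiffOn ℝ ∞ (fun z => metricRep g x₀ z (X z)) (extChartAt 𝓘(ℝ, E) x₀).target := by
    rw [contDiffOn_clm_apply]
    exact fun w => (hα w).congr fun z hz => h z hz w
  have h2 : ContDiffOn ℝ ∞ (fun z => (metricRep g x₀ z).inverse)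
      (extChartAt 𝓘(ℝ, E) x₀).target := fun z hz =>
    ((metricRep_isInvertible g hz).contDiffAt_map_inverse).comp_contDiffWithinAt z
      (contDiffOn_metricRep g x₀ z hz)
  refine (h2.clm_apply h1).congr fun z hz => ?_
  exact ((metricRep_isInvertible g hz).inverse_apply_self _).symm

theorem contDiffOn_christoffel {g : Metric E Q} {D : Connection E Q} (hD : IsLeviCivita g D)
    (x₀ : Q) : ContDiffOn ℝ ∞ (christoffel D x₀) (extChartAt 𝓘(ℝ, E) x₀).target := by
  rw [contDiffOn_clm_apply]
  intro u
  rw [contDiffOn_clm_apply]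
  intro v
  have hd : ∀ a b c : E, ContDiffOn ℝ ∞ (fun z => fderiv ℝ (metricRep g x₀) z a b c)
      (extChartAt 𝓘(ℝ, E) x₀).target := fun a b c => by
    have h : ContDiffOn ℝ ∞ (fun z => metricRep g x₀ z b c) (extChartAt 𝓘(ℝ, E) x₀).target :=
      ((contDiffOn_metricRep g x₀).clm_apply contDiffOn_const).clm_apply contDiffOn_const
    exact ((h.fderiv_of_isOpen (target_isOpen x₀) (by simp)).clm_apply contDiffOn_const).congr
      fun z hz => fderiv_metricRep_apply g hz a b c
  refine contDiffOn_of_metricRep_eq g (α := fun z w => (1 / 2 : ℝ) *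
    (fderiv ℝ (metricRep g x₀) z u v w + fderiv ℝ (metricRep g x₀) z v u w
      - fderiv ℝ (metricRep g x₀) z w u v))
    (fun w => contDiffOn_const.mul (((hd u v w).add (hd v u w)).sub (hd w u v))) fun z hz w => ?_
  -- the Koszul formula
  rw [metricRep_compat hD hz, metricRep_compat hD hz, metricRep_compat hD hz,
    christoffel_symm hD hz v u, christoffel_symm hD hz w u, christoffel_symm hD hz w v,
    metricRep_symm g x₀ z (christoffel D x₀ z u w) v]
  ring

/-! ### Riemannian calculus on an open subset of a vector space -/

section Bilinear

/- The target `H` of the differentiated maps is kept abstract: the instance problems for spaces of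
bilinear maps are expensive. -/
variable {F H X : Type*} [NormedAddCommGroup F] [NormedSpace ℝ F] [NormedAddCommGroup H]
  [NormedSpace ℝ H] [NormedAddCommGroup X] [NormedSpace ℝ X]

theorem hasDerivAt_comp_curve {f : E → H} {x : ℝ → E} {v : E} {t : ℝ}
    (hf : DifferentiableAt ℝ f (x t)) (hx : HasDerivAt x v t) :
    HasDerivAt (fun t => f (x t)) (fderiv ℝ f (x t) v) t :=
  hf.hasFDerivAt.comp_hasDerivAt t hx

theorem hasDerivAt_linear {B : E → E →L[ℝ] H} {x V : ℝ → E} {v V' : E} {t : ℝ}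
    (hB : DifferentiableAt ℝ B (x t)) (hx : HasDerivAt x v t) (hV : HasDerivAt V V' t) :
    HasDerivAt (fun t => B (x t) (V t)) (fderiv ℝ B (x t) v (V t) + B (x t) V') t :=
  (hasDerivAt_comp_curve hB hx).clm_apply hV

theorem hasDerivAt_bilinear {B : E → E →L[ℝ] E →L[ℝ] F} {x V W : ℝ → E} {v V' W' : E} {t : ℝ}
    (hB : DifferentiableAt ℝ B (x t)) (hx : HasDerivAt x v t) (hV : HasDerivAt V V' t)
    (hW : HasDerivAt W W' t) :
    HasDerivAt (fun t => B (x t) (V t) (W t))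
      (fderiv ℝ B (x t) v (V t) (W t) + B (x t) V' (W t) + B (x t) (V t) W') t :=
  (hasDerivAt_linear hB hx hV).clm_apply hW

theorem fderiv_linear_apply {B : E → E →L[ℝ] H} {x : E} (hB : DifferentiableAt ℝ B x) (v : E) :
    DifferentiableAt ℝ (fun y => B y v) x ∧
      ∀ u, fderiv ℝ (fun y => B y v) x u = fderiv ℝ B x u v := by
  have h1 := hB.hasFDerivAt.clm_apply (hasFDerivAt_const v x)
  refine ⟨h1.differentiableAt, fun u => ?_⟩
  rw [h1.fderiv]
  simp

theorem fderiv_bilinear_apply {B : E → E →L[ℝ] E →L[ℝ] F} {x : E} (hB : DifferentiableAt ℝ B x)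
    (u v w : E) : fderiv ℝ (fun y => B y v w) x u = fderiv ℝ B x u v w := by
  have h1 := fderiv_linear_apply hB v
  rw [(fderiv_linear_apply h1.1 w).2, h1.2]

theorem contDiffOn_linear {n : WithTop ℕ∞} {s : Set X} {U : Set E} {x V : X → E}
    {B : E → E →L[ℝ] H}
    (hB : ContDiffOn ℝ n B U) (hx : ContDiffOn ℝ n x s) (hxU : MapsTo x s U)
    (hV : ContDiffOn ℝ n V s) : ContDiffOn ℝ n (fun p => B (x p) (V p)) s :=
  (hB.comp hx hxU).clm_apply hV

theorem contDiffOn_bilinear {n : WithTop ℕ∞} {s : Set X} {U : Set E} {x V W : X → E}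
    {B : E → E →L[ℝ] E →L[ℝ] F}
    (hB : ContDiffOn ℝ n B U) (hx : ContDiffOn ℝ n x s) (hxU : MapsTo x s U)
    (hV : ContDiffOn ℝ n V s) (hW : ContDiffOn ℝ n W s) :
    ContDiffOn ℝ n (fun p => B (x p) (V p) (W p)) s :=
  (contDiffOn_linear hB hx hxU hV).clm_apply hW

theorem differentiableAt_of_contDiffOn {f : E → H} {U : Set E} {x : E}
    (hf : ContDiffOn ℝ ∞ f U) (hU : IsOpen U) (hx : x ∈ U) : DifferentiableAt ℝ f x :=
  (hf.contDiffAt (hU.mem_nhds hx)).differentiableAt (by simp)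

end Bilinear

/-- A Riemannian metric `G` on the open set `U` of the model space together with the Christoffel
symbols `Γ` of its Levi-Civita connection, characterized by symmetry and metric compatibility. -/
structure LocalMetric (U : Set E) (G : E → E →L[ℝ] E →L[ℝ] ℝ) (Γ : E → E →L[ℝ] E →L[ℝ] E) :
    Prop where
  isOpen : IsOpen U
  contDiffOn_metric : ContDiffOn ℝ ∞ G U
  contDiffOn_symbols : ContDiffOn ℝ ∞ Γ U
  symm : ∀ x u v, G x u v = G x v u
  pos : ∀ x ∈ U, ∀ v, v ≠ 0 → 0 < G x v v
  symbols_symm : ∀ x ∈ U, ∀ u v, Γ x u v = Γ x v u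
  compat : ∀ x ∈ U, ∀ u v w, fderiv ℝ G x u v w = G x (Γ x u v) w + G x v (Γ x u w)

/-- The curvature `R(u, v) w` in terms of the Christoffel symbols. -/
def curvRep (Γ : E → E →L[ℝ] E →L[ℝ] E) (x u v w : E) : E :=
  fderiv ℝ Γ x u v w - fderiv ℝ Γ x v u w + Γ x u (Γ x v w) - Γ x v (Γ x u w)

/-- The vector field `V` along the curve `x`, whose velocity at time `t` is `v`, has covariant
derivative `V'` at time `t`, that is, `V̇ + Γ(v, V) = V'`. -/
def HasCovDerivAt (Γ : E → E →L[ℝ] E →L[ℝ] E) (x : ℝ → E) (v : E) (V : ℝ → E) (V' : E) (t : ℝ) :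
    Prop :=
  HasDerivAt V (V' - Γ (x t) v (V t)) t

namespace LocalMetric

variable {U : Set E} {G : E → E →L[ℝ] E →L[ℝ] ℝ} {Γ : E → E →L[ℝ] E →L[ℝ] E}

theorem differentiableAt_metric (h : LocalMetric U G Γ) {x : E} (hx : x ∈ U) :
    DifferentiableAt ℝ G x :=
  differentiableAt_of_contDiffOn (H := E →L[ℝ] E →L[ℝ] ℝ) h.contDiffOn_metric h.isOpen hx

theorem differentiableAt_symbols (h : LocalMetric U G Γ) {x : E} (hx : x ∈ U) :
    DifferentiableAt ℝ Γ x :=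
  differentiableAt_of_contDiffOn (H := E →L[ℝ] E →L[ℝ] E) h.contDiffOn_symbols h.isOpen hx

/-- The product rule for the inner product of two vector fields along a curve. -/
theorem hasDerivAt_metric (h : LocalMetric U G Γ) {x V W : ℝ → E} {v V' W' : E} {t : ℝ}
    (hxt : x t ∈ U) (hx : HasDerivAt x v t) (hV : HasCovDerivAt Γ x v V V' t)
    (hW : HasCovDerivAt Γ x v W W' t) :
    HasDerivAt (fun t => G (x t) (V t) (W t)) (G (x t) V' (W t) + G (x t) (V t) W') t := by
  have h1 := hasDerivAt_bilinear (h.differentiableAt_metric hxt) hx hV hW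
  rw [h.compat _ hxt, map_sub, map_sub, sub_apply] at h1
  exact h1.congr_deriv (by ring)

theorem fderiv_symbols_symm (h : LocalMetric U G Γ) {x : E} (hx : x ∈ U) (u v w : E) :
    fderiv ℝ Γ x u v w = fderiv ℝ Γ x u w v := by
  have he : (fun y => Γ y v w) =ᶠ[𝓝 x] fun y => Γ y w v := by
    filter_upwards [h.isOpen.mem_nhds hx] with y hy using h.symbols_symm y hy v w
  rw [← fderiv_bilinear_apply (h.differentiableAt_symbols hx),
    ← fderiv_bilinear_apply (h.differentiableAt_symbols hx), he.fderiv_eq]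

/-- The first Bianchi identity. -/
theorem curvRep_bianchi (h : LocalMetric U G Γ) {x : E} (hx : x ∈ U) (u v w : E) :
    curvRep Γ x u v w + curvRep Γ x v w u + curvRep Γ x w u v = 0 := by
  simp only [curvRep]
  rw [h.fderiv_symbols_symm hx u v w, h.fderiv_symbols_symm hx v u w,
    h.fderiv_symbols_symm hx w v u, h.symbols_symm x hx v w, h.symbols_symm x hx u w,
    h.symbols_symm x hx v u]
  abel

theorem curvRep_swap (x u v w : E) : curvRep Γ x u v w = -curvRep Γ x v u w := by
  simp only [curvRep]; abel

/-- The curvature is skew with respect to the metric, because second derivatives of the metric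
commute. -/
theorem metric_curvRep_skew (h : LocalMetric U G Γ) {x : E} (hx : x ∈ U) (u v w z : E) :
    G x (curvRep Γ x u v w) z + G x w (curvRep Γ x u v z) = 0 := by
  set f : E → ℝ := fun y => G y w z with hf
  have hfs : ContDiffOn ℝ ∞ f U :=
    contDiffOn_bilinear h.contDiffOn_metric contDiffOn_id (mapsTo_id U) contDiffOn_const
      contDiffOn_const
  have hf' : ∀ y ∈ U, ∀ b, fderiv ℝ f y b = G y (Γ y b w) z + G y w (Γ y b z) := by
    intro y hy b
    rw [← h.compat y hy]
    exact fderiv_bilinear_apply (h.differentiableAt_metric hy) b w z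
  have key : ∀ a b, fderiv ℝ (fderiv ℝ f) x a b =
      G x (fderiv ℝ Γ x a b w + Γ x a (Γ x b w)) z + G x (Γ x b w) (Γ x a z)
      + (G x (Γ x a w) (Γ x b z) + G x w (fderiv ℝ Γ x a b z + Γ x a (Γ x b z))) := by
    intro a b
    obtain ⟨l, hl, h0⟩ : ∃ l : ℝ → E, HasDerivAt l a 0 ∧ l 0 = x :=
      ⟨fun s => x + s • a, by simpa using ((hasDerivAt_id (0 : ℝ)).smul_const a).const_add x,
        by simp⟩
    have h0U : l 0 ∈ U := by rwa [h0]
    have hc : ∀ y : E, HasCovDerivAt Γ l a (fun _ => y) (Γ x a y) 0 := by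
      intro y
      rw [HasCovDerivAt, h0, sub_self]
      exact hasDerivAt_const (0 : ℝ) y
    have hs : ∀ y : E, HasCovDerivAt Γ l a (fun s => Γ (l s) b y)
        (fderiv ℝ Γ x a b y + Γ x a (Γ x b y)) 0 := by
      intro y
      have h1 := hasDerivAt_bilinear (h.differentiableAt_symbols h0U) hl
        (hasDerivAt_const (0 : ℝ) b) (hasDerivAt_const (0 : ℝ) y)
      rw [map_zero, map_zero, zero_apply, add_zero, add_zero] at h1
      rw [HasCovDerivAt, h0, add_sub_cancel_right]
      rwa [h0] at h1
    have h1 := (h.hasDerivAt_metric h0U hl (hs w) (hc z)).add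
      (h.hasDerivAt_metric h0U hl (hc w) (hs z))
    have h2 : DifferentiableAt ℝ (fderiv ℝ f) x :=
      ((hfs.fderiv_of_isOpen h.isOpen (m := 1)
        (by simpa [one_add_one_eq_two] using two_le_infty)).contDiffAt
        (h.isOpen.mem_nhds hx)).differentiableAt (by simp)
    have h3 := hasDerivAt_linear (h0 ▸ h2) hl (hasDerivAt_const (0 : ℝ) b)
    rw [map_zero, add_zero, h0] at h3
    have he : (fun s : ℝ => fderiv ℝ f (l s) b) =ᶠ[𝓝 0]
        fun s => G (l s) (Γ (l s) b w) z + G (l s) w (Γ (l s) b z) := by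
      filter_upwards [hl.continuousAt.eventually_mem (h.isOpen.mem_nhds h0U)] with s hs
      exact hf' _ hs b
    have h4 := (h3.congr_of_eventuallyEq he.symm).unique h1
    rwa [h0] at h4
  have hsym := (hfs.contDiffAt (h.isOpen.mem_nhds hx)).isSymmSndFDerivAt
    (by rw [minSmoothness_of_isRCLikeNormedField]; exact two_le_infty) u v
  rw [key, key] at hsym
  simp only [curvRep, map_sub, map_add, sub_apply, add_apply] at hsym ⊢
  linarith

theorem metric_curvRep_pair (h : LocalMetric U G Γ) {x : E} (hx : x ∈ U) (p q v : E) :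
    G x (curvRep Γ x p v v) q = G x (curvRep Γ x q v v) p := by
  have hb : ∀ a b c d, G x (curvRep Γ x a b c) d + G x (curvRep Γ x b c a) d
      + G x (curvRep Γ x c a b) d = 0 := fun a b c d => by
    rw [← add_apply, ← map_add, ← add_apply, ← map_add, h.curvRep_bianchi hx, map_zero, zero_apply]
  have ha : ∀ a b c d, G x (curvRep Γ x a b c) d = -G x (curvRep Γ x b a c) d := fun a b c d => by
    rw [curvRep_swap, map_neg, neg_apply]
  have hs : ∀ a b c d, G x (curvRep Γ x a b c) d = -G x (curvRep Γ x a b d) c := fun a b c d => by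
    have := h.metric_curvRep_skew hx a b c d
    rw [h.symm x c] at this
    linarith
  have h1 := hb p v v q
  have h2 := hb q v v p
  have h3 := hb v p q v
  linarith [ha v p v q, ha v q v p, hs v v p q, ha v v p q, ha v v q p, hs p v v q, hs q v v p,
    hs p q v v, ha v q p v, ha v p q v, ha q p v v, hs q v p v, hs p v q v, hs v q p v,
    hs v p q v, ha p q v v]

/-- Commuting the covariant derivatives of a variation `x + s η` of the curve `x`: the covariant
derivative in `s` of the acceleration is `D²η/dt² + R(η, ẋ) ẋ`. -/
theorem hasCovDerivAt_accel (h : LocalMetric U G Γ) {x v η η₁ Dη : ℝ → E} {a η₂ D2η : E} {t : ℝ}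
    (hxt : x t ∈ U) (hx : HasDerivAt x (v t) t) (hv : HasDerivAt v a t)
    (hη : HasDerivAt η (η₁ t) t) (hη₁ : HasDerivAt η₁ η₂ t)
    (hDη : ∀ τ, Dη τ = η₁ τ + Γ (x τ) (v τ) (η τ)) (hD2η : HasCovDerivAt Γ x (v t) Dη D2η t) :
    HasCovDerivAt Γ (fun s => x t + s • η t) (η t)
      (fun s => a + s • η₂ + Γ (x t + s • η t) (v t + s • η₁ t) (v t + s • η₁ t))
      (D2η + curvRep Γ (x t) (η t) (v t) (v t)) 0 := by
  have hl : ∀ p q : E, HasDerivAt (fun s : ℝ => p + s • q) q 0 := fun p q => by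
    simpa using ((hasDerivAt_id (0 : ℝ)).smul_const q).const_add p
  have h1 := (hl a η₂).add (hasDerivAt_bilinear (x := fun s => x t + s • η t)
    (h.differentiableAt_symbols (by simpa using hxt)) (hl (x t) (η t))
    (hl (v t) (η₁ t)) (hl (v t) (η₁ t)))
  rw [HasCovDerivAt, funext hDη] at hD2η
  have h2 := hη₁.add (hasDerivAt_bilinear (h.differentiableAt_symbols hxt) hx hv hη)
  have h3 := hD2η.unique h2
  rw [sub_eq_iff_eq_add] at h3
  unfold HasCovDerivAt
  refine h1.congr_deriv ?_
  rw [h3]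
  simp only [curvRep, zero_smul, add_zero, map_add]
  rw [h.symbols_symm _ hxt (η₁ t) (v t), h.symbols_symm _ hxt (η t) a,
    h.fderiv_symbols_symm hxt (v t) (v t) (η t), h.symbols_symm _ hxt (v t) (η t)]
  abel

end LocalMetric

/-! ### Covariant derivatives along curves in a chart -/

theorem localMetric_chart {g : Metric E Q} {D : Connection E Q} (hD : IsLeviCivita g D) (x₀ : Q) :
    LocalMetric (extChartAt 𝓘(ℝ, E) x₀).target (metricRep g x₀) (christoffel D x₀) where
  isOpen := target_isOpen x₀
  contDiffOn_metric := contDiffOn_metricRep g x₀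
  contDiffOn_symbols := contDiffOn_christoffel hD x₀
  symm := metricRep_symm g x₀
  pos _ hz _ hv := metricRep_pos g hz hv
  symbols_symm _ hz := christoffel_symm hD hz
  compat _ hz := metricRep_compat hD hz

/-- The velocity of a curve in coordinates. -/
theorem coord_velocity {x₀ : Q} {c : ℝ → Q} {I : Set ℝ} {t : ℝ}
    (hI : UniqueDiffWithinAt ℝ I t) (hc : MDifferentiableWithinAt 𝓘(ℝ, ℝ) 𝓘(ℝ, E) c I t)
    (hct : c t ∈ (chartAt E x₀).source) :
    HasDerivWithinAt (extChartAt 𝓘(ℝ, E) x₀ ∘ c) (coord x₀ (c t) (velocity c I t)) I t := by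
  have h1 : MDifferentiableAt 𝓘(ℝ, E) 𝓘(ℝ, E) (extChartAt 𝓘(ℝ, E) x₀) (c t) :=
    ((contMDiffOn_chart x₀).contMDiffAt (source_mem_nhds hct)).mdifferentiableAt (by simp)
  have h2 := mfderiv_comp_mfderivWithin t h1 hc hI.uniqueMDiffWithinAt
  have h3 := h1.comp_mdifferentiableWithinAt t hc
  rw [mdifferentiableWithinAt_iff_differentiableWithinAt] at h3
  rw [mfderivWithin_eq_fderivWithin, ← coord_eq_mfderiv hct] at h2
  have h4 := h3.hasDerivWithinAt
  rw [← fderivWithin_derivWithin, h2] at h4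
  exact h4

/-- The change of components from the chart centred at `x₁` to the chart centred at `x₀`. -/
def coordChange (x₁ x₀ y : Q) : E →L[ℝ] E :=
  (coord x₀ y).comp ((trivializationAt E (TangentSpace 𝓘(ℝ, E)) x₁).symmL ℝ y)

theorem coordChange_coord {x₁ x₀ y : Q} (hy : y ∈ (chartAt E x₁).source)
    (w : TangentSpace 𝓘(ℝ, E) y) : coordChange x₁ x₀ y (coord x₁ y w) = coord x₀ y w :=
  congrArg (coord x₀ y) (frame_coord hy w)

theorem coordChange_apply (x₁ x₀ y : Q) (v : E) :
    coordChange x₁ x₀ y v = coord x₀ y (frame x₁ v y) := rfl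

theorem contMDiffAt_coordChange {x₁ x₀ y : Q} (h₁ : y ∈ (chartAt E x₁).source)
    (h₀ : y ∈ (chartAt E x₀).source) :
    ContMDiffAt 𝓘(ℝ, E) 𝓘(ℝ, E →L[ℝ] E) ∞ (coordChange (E := E) x₁ x₀) y := by
  have h := contMDiffAt_coordChangeL (n := ∞) (IB := 𝓘(ℝ, E))
    (e := trivializationAt E (TangentSpace 𝓘(ℝ, E)) x₁)
    (e' := trivializationAt E (TangentSpace 𝓘(ℝ, E)) x₀) h₁ h₀
  refine h.congr_of_eventuallyEq ?_
  filter_upwards [source_mem_nhds h₁, source_mem_nhds h₀] with p hp₁ hp₀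
  ext v
  rw [coordChange_apply, coord_apply hp₀, ContinuousLinearEquiv.coe_coe,
    Trivialization.coordChangeL_apply _ _ ⟨hp₁, hp₀⟩, frame,
    Trivialization.symmL_apply (R := ℝ) _ hp₁]

theorem differentiableWithinAt_coordChange {x₁ x₀ : Q} {c : ℝ → Q} {I : Set ℝ} {t : ℝ}
    (hc : MDifferentiableWithinAt 𝓘(ℝ, ℝ) 𝓘(ℝ, E) c I t)
    (h₁ : c t ∈ (chartAt E x₁).source) (h₀ : c t ∈ (chartAt E x₀).source) :
    DifferentiableWithinAt ℝ (fun τ => coordChange (E := E) x₁ x₀ (c τ)) I t := by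
  have := ((contMDiffAt_coordChange h₁ h₀).mdifferentiableAt (by simp)).comp_mdifferentiableWithinAt
    t hc
  rwa [mdifferentiableWithinAt_iff_differentiableWithinAt] at this

theorem eventually_source {x₀ : Q} {c : ℝ → Q} {I : Set ℝ} {t : ℝ}
    (hc : MDifferentiableWithinAt 𝓘(ℝ, ℝ) 𝓘(ℝ, E) c I t) (hct : c t ∈ (chartAt E x₀).source) :
    ∀ᶠ τ in 𝓝[I] t, c τ ∈ (chartAt E x₀).source :=
  hc.continuousWithinAt (source_mem_nhds hct)

theorem vdiffAt_extend {x : Q} (v : TangentSpace 𝓘(ℝ, E) x) :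
    VDiffAt (FiberBundle.extend E v : VField E Q) x := by
  refine (vdiffAt_frame (mem_chart_source E x) (coord x x v)).congr_of_eventuallyEq ?_
  filter_upwards [source_mem_nhds (mem_chart_source E x)] with y hy
  rw [extend_eq_frame v hy]

/-- The covariant derivative along a curve is given by `V̇ + Γ(ẋ, V)` in every chart. -/
theorem coord_covDerivAlong (D : Connection E Q) {x₀ : Q} {c : ℝ → Q} {I : Set ℝ} {t : ℝ}
    {V : ∀ t, TangentSpace 𝓘(ℝ, E) (c t)} {v' : E}
    (ht : t ∈ I) (hI : UniqueDiffWithinAt ℝ I t)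
    (hc : MDifferentiableWithinAt 𝓘(ℝ, ℝ) 𝓘(ℝ, E) c I t) (hct : c t ∈ (chartAt E x₀).source)
    (hV : HasDerivWithinAt (fun τ => coord x₀ (c τ) (V τ)) v' I t) :
    coord x₀ (c t) (covDerivAlong D c I V t) = v' +
      christoffel D x₀ (extChartAt 𝓘(ℝ, E) x₀ (c t)) (coord x₀ (c t) (velocity c I t))
        (coord x₀ (c t) (V t)) := by
  have h₁ : c t ∈ (chartAt E (c t)).source := mem_chart_source E (c t)
  -- the components `w` of `V` in the chart centred at `c t`
  set w : ℝ → E := fun τ => (trivializationAt E (TangentSpace 𝓘(ℝ, E)) (c t)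
        (TotalSpace.mk' E (c τ) (V τ))).2 with hw
  have hw1 : w =ᶠ[𝓝[I] t] fun τ => coord (c t) (c τ) (V τ) := by
    filter_upwards [eventually_source hc h₁] with τ hτ
    exact (coord_apply hτ _).symm
  have hwd : DifferentiableWithinAt ℝ w I t := by
    have h := (differentiableWithinAt_coordChange hc hct h₁).clm_apply hV.differentiableWithinAt
    refine h.congr_of_eventuallyEq_of_mem ?_ ht
    filter_upwards [hw1, eventually_source hc hct] with τ h1 h2
    rw [h1, coordChange_coord h2]
  have hB := differentiableWithinAt_coordChange hc h₁ hct
  have hwt : w t = coord (c t) (c t) (V t) := hw1.self_of_nhdsWithin ht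
  have hv' : v' = derivWithin (fun τ => coordChange (E := E) (c t) x₀ (c τ)) I t (w t)
      + coordChange (c t) x₀ (c t) (derivWithin w I t) := by
    refine hI.eq_deriv _ (hV.congr_of_eventuallyEq_of_mem ?_ ht)
      (hB.hasDerivWithinAt.clm_apply hwd.hasDerivWithinAt)
    filter_upwards [hw1, eventually_source hc h₁] with τ h1 h2
    rw [h1, coordChange_coord h2]
  have hext := vdiffAt_extend (V t)
  have h2 : fderiv ℝ (localRep x₀ (FiberBundle.extend E (V t))) (extChartAt 𝓘(ℝ, E) x₀ (c t))
      (coord x₀ (c t) (velocity c I t))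
      = derivWithin (fun τ => coordChange (E := E) (c t) x₀ (c τ)) I t (w t) := by
    have hd := ((vdiffAt_iff hct).1 hext).hasFDerivAt.comp_hasDerivWithinAt t
      (coord_velocity hI hc hct)
    refine (hI.eq_deriv _ ?_ hd).symm
    have h3 := hB.hasDerivWithinAt.clm_apply (hasDerivWithinAt_const t I (w t))
    rw [map_zero, add_zero] at h3
    refine h3.congr_of_eventuallyEq_of_mem ?_ ht
    filter_upwards [eventually_source hc h₁, eventually_source hc hct] with τ h1 h2
    rw [Function.comp_apply, Function.comp_apply, localRep_chart h2, extend_eq_frame _ h1, hwt]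
    rfl
  rw [covDerivAlong, map_add, coord_connection D hct hext, h2, FiberBundle.extend_apply_self, hv',
    coordChange_apply]
  simp only [frame]
  abel

/-! ### Curvature and dual vector fields in a chart -/

theorem eventually_localRep_connection (D : Connection E Q) {x₀ : Q} {z : E}
    (hz : z ∈ (extChartAt 𝓘(ℝ, E) x₀).target) {Y Z : VField E Q}
    (hZ : ContDiffAt ℝ ∞ (localRep x₀ Z) z) :
    localRep x₀ (fun y => D Z y (Y y)) =ᶠ[𝓝 z] fun z' =>
      fderiv ℝ (localRep x₀ Z) z' (localRep x₀ Y z') +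
        christoffel D x₀ z' (localRep x₀ Y z') (localRep x₀ Z z') := by
  filter_upwards [(target_isOpen x₀).mem_nhds hz,
    (hZ.of_le (m := 1) (by simp)).eventually (by simp)] with z' hz' hd
  have h := coord_connection D (symm_mem hz') (Y := Z) ((vdiffAt_iff (symm_mem hz')).2
    (by rw [chart_symm hz']; exact hd.differentiableAt (by simp))) (Y _)
  rw [chart_symm hz'] at h
  exact h

theorem vdiffAt_connection (D : Connection E Q) {x₀ : Q} {z : E}
    (hz : z ∈ (extChartAt 𝓘(ℝ, E) x₀).target) {Y Z : VField E Q}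
    (hΓ : DifferentiableAt ℝ (christoffel D x₀) z)
    (hY : ContDiffAt ℝ ∞ (localRep x₀ Y) z) (hZ : ContDiffAt ℝ ∞ (localRep x₀ Z) z) :
    DifferentiableAt ℝ (localRep x₀ (fun y => D Z y (Y y))) z ∧ ∀ u : E,
      fderiv ℝ (localRep x₀ (fun y => D Z y (Y y))) z u =
        fderiv ℝ (fderiv ℝ (localRep x₀ Z)) z u (localRep x₀ Y z)
        + fderiv ℝ (localRep x₀ Z) z (fderiv ℝ (localRep x₀ Y) z u)
        + (fderiv ℝ (christoffel D x₀) z u (localRep x₀ Y z) (localRep x₀ Z z)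
          + christoffel D x₀ z (fderiv ℝ (localRep x₀ Y) z u) (localRep x₀ Z z)
          + christoffel D x₀ z (localRep x₀ Y z) (fderiv ℝ (localRep x₀ Z) z u)) := by
  have he := eventually_localRep_connection D hz (Y := Y) hZ
  have hY1 : DifferentiableAt ℝ (localRep x₀ Y) z := hY.differentiableAt (by simp)
  have hZ1 : DifferentiableAt ℝ (localRep x₀ Z) z := hZ.differentiableAt (by simp)
  have hZ2 : DifferentiableAt ℝ (fderiv ℝ (localRep x₀ Z)) z :=
    (hZ.fderiv_right (m := 1) (by simpa [one_add_one_eq_two] using two_le_infty)).differentiableAt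
      (by simp)
  have hd := (hZ2.clm_apply hY1).add ((hΓ.clm_apply hY1).clm_apply hZ1)
  have hd' := hd.congr_of_eventuallyEq he
  refine ⟨hd', fun u => ?_⟩
  obtain ⟨l, hl, h0⟩ : ∃ l : ℝ → E, HasDerivAt l u 0 ∧ l 0 = z :=
    ⟨fun s => z + s • u, by simpa using ((hasDerivAt_id (0 : ℝ)).smul_const u).const_add z, by simp⟩
  rw [he.fderiv_eq]
  subst h0
  exact (hasDerivAt_comp_curve hd hl).unique
    ((hasDerivAt_linear hZ2 hl (hasDerivAt_comp_curve hY1 hl)).add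
      (hasDerivAt_bilinear hΓ hl (hasDerivAt_comp_curve hY1 hl) (hasDerivAt_comp_curve hZ1 hl)))

/-- The curvature of the Levi-Civita connection in coordinates. -/
theorem coord_curvatureField {g : Metric E Q} {D : Connection E Q} (hD : IsLeviCivita g D)
    {x₀ y : Q} (hy : y ∈ (chartAt E x₀).source) {X Y Z : VField E Q}
    (hX : ContDiffAt ℝ ∞ (localRep x₀ X) (extChartAt 𝓘(ℝ, E) x₀ y))
    (hY : ContDiffAt ℝ ∞ (localRep x₀ Y) (extChartAt 𝓘(ℝ, E) x₀ y))
    (hZ : ContDiffAt ℝ ∞ (localRep x₀ Z) (extChartAt 𝓘(ℝ, E) x₀ y)) :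
    coord x₀ y (curvatureField D X Y Z y) =
      curvRep (christoffel D x₀) (extChartAt 𝓘(ℝ, E) x₀ y)
        (coord x₀ y (X y)) (coord x₀ y (Y y)) (coord x₀ y (Z y)) := by
  have hz := chart_mem hy
  have hL := localMetric_chart hD x₀
  have hX1 : VDiffAt X y := (vdiffAt_iff hy).2 (hX.differentiableAt (by simp))
  have hY1 : VDiffAt Y y := (vdiffAt_iff hy).2 (hY.differentiableAt (by simp))
  have hZ1 : VDiffAt Z y := (vdiffAt_iff hy).2 (hZ.differentiableAt (by simp))
  have hYZ := vdiffAt_connection D hz (hL.differentiableAt_symbols hz) hY hZ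
  have hXZ := vdiffAt_connection D hz (hL.differentiableAt_symbols hz) hX hZ
  have hsym := (hZ.isSymmSndFDerivAt
    (by rw [minSmoothness_of_isRCLikeNormedField]; exact two_le_infty))
    (coord x₀ y (X y)) (coord x₀ y (Y y))
  rw [curvatureField, ← hD.torsion_free X Y y hX1 hY1, map_sub, map_sub,
    coord_connection D hy ((vdiffAt_iff hy).2 hYZ.1), hYZ.2,
    coord_connection D hy ((vdiffAt_iff hy).2 hXZ.1), hXZ.2,
    coord_connection D hy hZ1, map_sub]
  simp only [coord_connection D hy hZ1, coord_connection D hy hX1, coord_connection D hy hY1,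
    localRep_chart hy, curvRep, hsym, map_add, map_sub, add_apply]
  rw [hL.symbols_symm _ hz (coord x₀ y (Y y)) (coord x₀ y (X y))]
  abel

theorem contDiffAt_localRep_extend {x₀ y : Q} (hy : y ∈ (chartAt E x₀).source)
    (v : TangentSpace 𝓘(ℝ, E) y) :
    ContDiffAt ℝ ∞ (localRep x₀ (FiberBundle.extend E v)) (extChartAt 𝓘(ℝ, E) x₀ y) := by
  have h1 : ContMDiffAt 𝓘(ℝ, E) 𝓘(ℝ, E →L[ℝ] E) ∞ (coordChange (E := E) y x₀)
      ((extChartAt 𝓘(ℝ, E) x₀).symm (extChartAt 𝓘(ℝ, E) x₀ y)) := by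
    rw [symm_chart hy]
    exact contMDiffAt_coordChange (mem_chart_source E y) hy
  have hs := (contMDiffOn_symm x₀).contMDiffAt ((target_isOpen x₀).mem_nhds (chart_mem hy))
  have h2 := h1.comp _ hs
  rw [contMDiffAt_iff_contDiffAt] at h2
  refine (h2.clm_apply (contDiffAt_const (c := coord y y v))).congr_of_eventuallyEq ?_
  have h3 := hs.continuousAt.eventually_mem
    (by rw [symm_chart hy]; exact source_mem_nhds (mem_chart_source E y))
  filter_upwards [h3] with z hz
  rw [Function.comp_apply, coordChange_apply, localRep, extend_eq_frame v hz]

theorem coord_curvature {g : Metric E Q} {D : Connection E Q} (hD : IsLeviCivita g D)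
    {x₀ y : Q} (hy : y ∈ (chartAt E x₀).source) (u v w : TangentSpace 𝓘(ℝ, E) y) :
    coord x₀ y (curvature D y u v w) =
      curvRep (christoffel D x₀) (extChartAt 𝓘(ℝ, E) x₀ y)
        (coord x₀ y u) (coord x₀ y v) (coord x₀ y w) := by
  rw [curvature, coord_curvatureField hD hy (contDiffAt_localRep_extend hy u)
    (contDiffAt_localRep_extend hy v) (contDiffAt_localRep_extend hy w)]
  simp only [FiberBundle.extend_apply_self]

theorem contDiffOn_localRep_sharpField (g : Metric E Q) (μ : OneForm E Q) (x₀ : Q) :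
    ContDiffOn ℝ ∞ (localRep x₀ (sharpField g μ)) (extChartAt 𝓘(ℝ, E) x₀).target := by
  refine contDiffOn_of_metricRep_eq g (α := fun z w => μ ((extChartAt 𝓘(ℝ, E) x₀).symm z)
    (frame x₀ w ((extChartAt 𝓘(ℝ, E) x₀).symm z))) (fun w => ?_) fun z hz w => ?_
  · have h : ContMDiffOn 𝓘(ℝ, E) (𝓘(ℝ, E).prod 𝓘(ℝ, ℝ)) ∞
        (fun m ↦ TotalSpace.mk' ℝ (E := Bundle.Trivial Q ℝ) m (μ m (frame x₀ w m)))
        (chartAt E x₀).source := by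
      apply ContMDiffOn.clm_bundle_apply (F₁ := E)
      · exact μ.contMDiff.contMDiffOn
      · exact contMDiffOn_frame w
    have h2 : ContMDiffOn 𝓘(ℝ, E) 𝓘(ℝ, ℝ) ∞ (fun m ↦ μ m (frame x₀ w m))
        (chartAt E x₀).source := by
      intro p hp
      have := h p hp
      rw [contMDiffWithinAt_totalSpace] at this
      exact this.2
    rw [← contMDiffOn_iff_contDiffOn]
    exact h2.comp (contMDiffOn_symm x₀) fun z hz => symm_mem hz
  · rw [metricRep_apply, localRep, frame_coord (symm_mem hz), sharpField, inner_sharp]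

theorem vdiffAt_sharpField (g : Metric E Q) (μ : OneForm E Q) (y : Q) :
    VDiffAt (sharpField g μ) y :=
  (vdiffAt_iff (mem_chart_source E y)).2 (differentiableAt_of_contDiffOn
    (contDiffOn_localRep_sharpField g μ y) (target_isOpen y) (chart_mem (mem_chart_source E y)))

/-- The operator `S` is the difference of `∇X` and its adjoint, for `X = ♯μ`. -/
theorem inner_formOperator {g : Metric E Q} {D : Connection E Q} (hD : IsLeviCivita g D)
    (μ : OneForm E Q) (y : Q) (u v : TangentSpace 𝓘(ℝ, E) y) :
    g.inner y (formOperator g μ y u) v =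
      g.inner y (D (sharpField g μ) y u) v - g.inner y (D (sharpField g μ) y v) u := by
  have hu := vdiffAt_extend u
  have hv := vdiffAt_extend v
  have hX := vdiffAt_sharpField g μ y
  have hμ : ∀ Y : VField E Q, (fun p => μ p (Y p)) = fun p => g.inner p (sharpField g μ p) (Y p) :=
    fun Y => funext fun p => (inner_sharp g p (μ p) (Y p)).symm
  have h := extDeriv_apply μ hu hv
  rw [extDerivField, hμ, hμ, ← hD.torsion_free _ _ y hu hv] at h
  rw [hD.metric _ _ _ y hX hv, hD.metric _ _ _ y hX hu, ← inner_sharp g y (μ y)] at h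
  simp only [FiberBundle.extend_apply_self, map_sub] at h
  rw [formOperator, inner_sharp, h]
  change _ + g.inner y (sharp g y (μ y)) _ - (_ + g.inner y (sharp g y (μ y)) _) - _ = _
  ring

/-! ### The first variation in a chart -/

section FirstVariation

variable {r : ℕ} {U : Set E} {G : E → E →L[ℝ] E →L[ℝ] ℝ} {Γ : E → E →L[ℝ] E →L[ℝ] E}

/-- The integrand of the augmented functional in coordinates, as a function of the position `y`,
the velocity `v` and the second derivative `a`; the fields `X k` represent the constraints and
the numbers `l k` are the multipliers. -/
def lagrangian (G : E → E →L[ℝ] E →L[ℝ] ℝ) (Γ : E → E →L[ℝ] E →L[ℝ] E) (X : Fin r → E → E)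
    (l : Fin r → ℝ) (y v a : E) : ℝ :=
  (1 / 2 : ℝ) * G y (a + Γ y v v) (a + Γ y v v) + ∑ k, l k * G y (X k y) (a + Γ y v v)

/-- The Euler–Lagrange expression, paired with `w`: here `A` is the covariant acceleration,
`P = A + ∑ l k X k` is the momentum conjugate to it, and `P₂` is the second covariant derivative
of `P`. -/
def eulerLagrange (G : E → E →L[ℝ] E →L[ℝ] ℝ) (Γ : E → E →L[ℝ] E →L[ℝ] E) (X : Fin r → E → E)
    (l : Fin r → ℝ) (y v A P P₂ w : E) : ℝ :=
  G y (P₂ + curvRep Γ y P v v) w + ∑ k, l k * G y (fderiv ℝ (X k) y w + Γ y w (X k y)) A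

theorem LocalMetric.hasDerivAt_lagrangian (h : LocalMetric U G Γ) {X : Fin r → E → E}
    {l : Fin r → ℝ} {x v η η₁ Dη : ℝ → E} {a η₂ D2η A P : E} {t : ℝ}
    (hX : ∀ k, DifferentiableAt ℝ (X k) (x t))
    (hxt : x t ∈ U) (hx : HasDerivAt x (v t) t) (hv : HasDerivAt v a t)
    (hη : HasDerivAt η (η₁ t) t) (hη₁ : HasDerivAt η₁ η₂ t)
    (hDη : ∀ τ, Dη τ = η₁ τ + Γ (x τ) (v τ) (η τ)) (hD2η : HasCovDerivAt Γ x (v t) Dη D2η t)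
    (hA : A = a + Γ (x t) (v t) (v t)) (hP : P = A + ∑ k, l k • X k (x t)) :
    HasDerivAt (fun s : ℝ => lagrangian G Γ X l (x t + s • η t) (v t + s • η₁ t) (a + s • η₂))
      (G (x t) D2η P + G (x t) (curvRep Γ (x t) (η t) (v t) (v t)) P
        + ∑ k, l k * G (x t) (fderiv ℝ (X k) (x t) (η t) + Γ (x t) (η t) (X k (x t))) A) 0 := by
  have hy : HasDerivAt (fun s : ℝ => x t + s • η t) (η t) 0 := by
    simpa using ((hasDerivAt_id (0 : ℝ)).smul_const (η t)).const_add (x t)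
  have hy0 : x t + (0 : ℝ) • η t = x t := by simp
  have hyU : x t + (0 : ℝ) • η t ∈ U := by rwa [hy0]
  have hAs := h.hasCovDerivAt_accel hxt hx hv hη hη₁ hDη hD2η
  have hXs : ∀ k, HasCovDerivAt Γ (fun s : ℝ => x t + s • η t) (η t)
      (fun s => X k (x t + s • η t))
      (fderiv ℝ (X k) (x t) (η t) + Γ (x t) (η t) (X k (x t))) 0 := by
    intro k
    have h1 := hasDerivAt_comp_curve (x := fun s : ℝ => x t + s • η t) (by rw [hy0]; exact hX k) hy
    unfold HasCovDerivAt
    refine h1.congr_deriv ?_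
    simp only [hy0]
    abel
  have h1 := ((h.hasDerivAt_metric hyU hy hAs hAs).const_mul (1 / 2 : ℝ)).add
    (HasDerivAt.fun_sum (u := Finset.univ)
      fun k _ => (h.hasDerivAt_metric hyU hy (hXs k) hAs).const_mul (l k))
  refine h1.congr_deriv ?_
  simp only [zero_smul, add_zero, ← hA, hP, map_add, map_sum, map_smul, add_apply, smul_eq_mul,
    mul_add, Finset.sum_add_distrib, h.symm _ A, h.symm _ (X _ (x t))]
  ring

/-- The part of the first variation that is a total derivative. -/
theorem LocalMetric.hasDerivAt_boundary (h : LocalMetric U G Γ) {x v η η₁ Dη P P₁ : ℝ → E}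
    {D2η P₂ : E} {t : ℝ} (hxt : x t ∈ U) (hx : HasDerivAt x (v t) t)
    (hη : HasDerivAt η (η₁ t) t)
    (hDη : ∀ τ, Dη τ = η₁ τ + Γ (x τ) (v τ) (η τ)) (hD2η : HasCovDerivAt Γ x (v t) Dη D2η t)
    (hP : HasCovDerivAt Γ x (v t) P (P₁ t) t) (hP₁ : HasCovDerivAt Γ x (v t) P₁ P₂ t) :
    HasDerivAt (fun t => G (x t) (Dη t) (P t) - G (x t) (η t) (P₁ t))
      (G (x t) D2η (P t) - G (x t) (η t) P₂) t := by
  have h0 : HasCovDerivAt Γ x (v t) η (Dη t) t := by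
    unfold HasCovDerivAt
    rwa [hDη, add_sub_cancel_right]
  exact ((h.hasDerivAt_metric hxt hx hD2η hP).sub (h.hasDerivAt_metric hxt hx h0 hP₁)).congr_deriv
    (by ring)

/-- Splitting of the first variation into the Euler–Lagrange expression and a total derivative. -/
theorem LocalMetric.firstVariation_eq (h : LocalMetric U G Γ) (X : Fin r → E → E)
    (l : Fin r → ℝ) {y : E} (hy : y ∈ U) (v η D2η A P P₂ : E) :
    G y D2η P + G y (curvRep Γ y η v v) P
        + ∑ k, l k * G y (fderiv ℝ (X k) y η + Γ y η (X k y)) A =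
      eulerLagrange G Γ X l y v A P P₂ η + (G y D2η P - G y η P₂) := by
  rw [eulerLagrange, map_add, add_apply, h.metric_curvRep_pair hy η P, h.symm y P₂]
  ring

end FirstVariation

/-- Differentiation under the integral sign for an integrand that is continuously differentiable
in both variables. -/
theorem hasDerivAt_integral_of_contDiffOn {L : ℝ → ℝ → ℝ} {ε p q : ℝ} {J : Set ℝ} (hε : 0 < ε)
    (hJ : IsOpen J) (hpq : p ≤ q) (hJpq : Icc p q ⊆ J)
    (hL : ContDiffOn ℝ 1 (fun z : ℝ × ℝ => L z.1 z.2) (Ioo (-ε) ε ×ˢ J)) {L' : ℝ → ℝ}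
    (hL' : ∀ t ∈ J, HasDerivAt (fun s => L s t) (L' t) 0) :
    ContinuousOn L' J ∧
      HasDerivAt (fun s => ∫ t in p..q, L s t) (∫ t in p..q, L' t) 0 := by
  set f : ℝ × ℝ → ℝ := fun z => L z.1 z.2 with hf
  have hO : IsOpen (Ioo (-ε) ε ×ˢ J) := isOpen_Ioo.prod hJ
  have hd : ∀ s ∈ Ioo (-ε) ε, ∀ t ∈ J,
      HasDerivAt (fun s => L s t) (fderiv ℝ f (s, t) (1, 0)) s := by
    intro s hs t ht
    have h1 : DifferentiableAt ℝ f (s, t) :=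
      (hL.contDiffAt (hO.mem_nhds ⟨hs, ht⟩)).differentiableAt (by simp)
    exact h1.hasFDerivAt.comp_hasDerivAt (f := fun s => (s, t)) s
      ((hasDerivAt_id s).prodMk (hasDerivAt_const s t))
  have hcont : ContinuousOn (fun z : ℝ × ℝ => fderiv ℝ f z (1, 0)) (Ioo (-ε) ε ×ˢ J) :=
    (hL.continuousOn_fderiv_of_isOpen hO le_rfl).clm_apply continuousOn_const
  have h0 : (0 : ℝ) ∈ Ioo (-ε) ε := ⟨by linarith, hε⟩
  have hslice : ∀ s ∈ Ioo (-ε) ε, ∀ F : ℝ × ℝ → ℝ, ContinuousOn F (Ioo (-ε) ε ×ˢ J) →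
      ContinuousOn (fun t => F (s, t)) J := fun s hs F hF =>
    hF.comp (by fun_prop) fun t ht => ⟨hs, ht⟩
  have hL'eq : ∀ t ∈ J, L' t = fderiv ℝ f (0, t) (1, 0) := fun t ht =>
    (hL' t ht).unique (hd 0 h0 t ht)
  have hc0 := hslice 0 h0 _ hcont
  refine ⟨hc0.congr hL'eq, ?_⟩
  obtain ⟨C, hC⟩ := (isCompact_Icc.prod isCompact_Icc).exists_bound_of_continuousOn
    (hcont.mono (prod_mono (Icc_subset_Ioo (by linarith : -ε < -(ε / 2))
      (by linarith : ε / 2 < ε)) hJpq))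
  have hu : uIoc p q ⊆ Icc p q := by rw [uIoc_of_le hpq]; exact Ioc_subset_Icc_self
  have hball : Metric.ball (0 : ℝ) (ε / 2) ⊆ Icc (-(ε / 2)) (ε / 2) := by
    rw [Real.ball_eq_Ioo]
    simpa using Ioo_subset_Icc_self (a := -(ε / 2)) (b := ε / 2)
  have hball' : Icc (-(ε / 2)) (ε / 2) ⊆ Ioo (-ε) ε := Icc_subset_Ioo (by linarith) (by linarith)
  have hint : ∀ s ∈ Ioo (-ε) ε, IntervalIntegrable (L s) volume p q := fun s hs =>
    ContinuousOn.intervalIntegrable_of_Icc hpq ((hslice s hs _ hL.continuousOn).mono hJpq)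
  have h1 := (intervalIntegral.hasDerivAt_integral_of_dominated_loc_of_deriv_le
    (F := L) (F' := fun s t => fderiv ℝ f (s, t) (1, 0)) (x₀ := (0 : ℝ)) (μ := volume)
    (s := Metric.ball 0 (ε / 2)) (a := p) (b := q) (bound := fun _ => C)
    (Metric.ball_mem_nhds _ (by linarith)) ?_ (hint 0 h0) ?_ ?_ ?_ ?_).2
  · refine h1.congr_deriv (intervalIntegral.integral_congr fun t ht => ?_)
    rw [uIcc_of_le hpq] at ht
    exact (hL'eq t (hJpq ht)).symm
  · filter_upwards [Ioo_mem_nhds h0.1 h0.2] with s hs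
    exact (hint s hs).def'.aestronglyMeasurable
  · exact (ContinuousOn.intervalIntegrable_of_Icc hpq (hc0.mono hJpq)).def'.aestronglyMeasurable
  · exact Filter.Eventually.of_forall fun t ht s hs => hC (s, t) ⟨hball hs, hu ht⟩
  · exact intervalIntegrable_const
  · exact Filter.Eventually.of_forall fun t ht s hs =>
      hd s (hball' (hball hs)) t (hJpq (hu ht))

/-! ### Dependence on the germ of the curve and of the set of times -/

theorem covDerivAlong_congr_curve (D : Connection E Q) {c₁ c₂ : ℝ → Q} {I : Set ℝ} {t : ℝ}
    {V₁ : ∀ t, TangentSpace 𝓘(ℝ, E) (c₁ t)} {V₂ : ∀ t, TangentSpace 𝓘(ℝ, E) (c₂ t)} (ht : t ∈ I)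
    (hV : (fun τ => TotalSpace.mk' E (c₁ τ) (V₁ τ)) =ᶠ[𝓝[I] t]
      fun τ => TotalSpace.mk' E (c₂ τ) (V₂ τ))
    (hv : TotalSpace.mk' E (c₁ t) (velocity (E := E) c₁ I t) =
      TotalSpace.mk' E (c₂ t) (velocity (E := E) c₂ I t)) :
    TotalSpace.mk' E (c₁ t) (covDerivAlong D c₁ I V₁ t) =
      TotalSpace.mk' E (c₂ t) (covDerivAlong D c₂ I V₂ t) := by
  -- all fibres are the model space `E`, so the covariant derivative is a function of untyped data
  let Φ : (Q → E) → Q → E → E → TangentBundle 𝓘(ℝ, E) Q := fun d p v w =>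
    TotalSpace.mk' E p ((trivializationAt E (TangentSpace 𝓘(ℝ, E)) p).symmL ℝ p (d p)
      + D (FiberBundle.extend E (show TangentSpace 𝓘(ℝ, E) p from v)) p w)
  have hVt : TotalSpace.mk' E (c₁ t) (V₁ t) = TotalSpace.mk' E (c₂ t) (V₂ t) :=
    hV.self_of_nhdsWithin ht
  have hp : c₁ t = c₂ t := congrArg TotalSpace.proj hv
  have h1 : (velocity c₁ I t : E) = (velocity c₂ I t : E) :=
    congrArg (fun P : TangentBundle 𝓘(ℝ, E) Q => (P.2 : E)) hv
  have h2 : (V₁ t : E) = (V₂ t : E) :=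
    congrArg (fun P : TangentBundle 𝓘(ℝ, E) Q => (P.2 : E)) hVt
  have h3 : ∀ p : Q, derivWithin (fun τ => (trivializationAt E (TangentSpace 𝓘(ℝ, E)) p
      (TotalSpace.mk' E (c₁ τ) (V₁ τ))).2) I t = derivWithin (fun τ =>
      (trivializationAt E (TangentSpace 𝓘(ℝ, E)) p (TotalSpace.mk' E (c₂ τ) (V₂ τ))).2) I t := by
    intro p
    refine Filter.EventuallyEq.derivWithin_eq ?_ (by rw [hVt])
    filter_upwards [hV] with τ hτ
    rw [hτ]
  let d₁ : Q → E := fun p => derivWithin (fun τ => (trivializationAt E (TangentSpace 𝓘(ℝ, E)) p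
      (TotalSpace.mk' E (c₁ τ) (V₁ τ))).2) I t
  let d₂ : Q → E := fun p => derivWithin (fun τ => (trivializationAt E (TangentSpace 𝓘(ℝ, E)) p
      (TotalSpace.mk' E (c₂ τ) (V₂ τ))).2) I t
  have hd : d₁ = d₂ := funext h3
  have h4 : Φ d₁ (c₁ t) (V₁ t) (velocity (E := E) c₁ I t) =
      Φ d₂ (c₂ t) (V₂ t) (velocity (E := E) c₂ I t) := by
    have h5 : ∀ (p q : Q), p = q → ∀ v w v' w' : E, v = v' → w = w' →
        Φ d₁ p v w = Φ d₂ q v' w' := by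
      rintro p _ rfl v w _ _ rfl rfl
      rw [hd]
    exact h5 _ _ hp _ _ _ _ h2 h1
  exact h4

theorem velocity_congr_curve {c₁ c₂ : ℝ → Q} {I : Set ℝ} {t : ℝ} (ht : t ∈ I)
    (h : c₁ =ᶠ[𝓝[I] t] c₂) :
    TotalSpace.mk' E (c₁ t) (velocity (E := E) c₁ I t) =
      TotalSpace.mk' E (c₂ t) (velocity (E := E) c₂ I t) := by
  have h1 : mfderivWithin 𝓘(ℝ, ℝ) 𝓘(ℝ, E) c₁ I t = mfderivWithin 𝓘(ℝ, ℝ) 𝓘(ℝ, E) c₂ I t :=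
    h.mfderivWithin_eq (h.self_of_nhdsWithin ht)
  have h2 : (velocity (E := E) c₁ I t : E) = (velocity (E := E) c₂ I t : E) :=
    congrArg (fun L : ℝ →L[ℝ] E => L (1 : ℝ)) h1
  exact congrArg₂ (fun (p : Q) (v : E) =>
    (TotalSpace.mk' E p (show TangentSpace 𝓘(ℝ, E) p from v) : TangentBundle 𝓘(ℝ, E) Q))
    (h.self_of_nhdsWithin ht) h2

theorem accel_congr_curve (g : Metric E Q) {c₁ c₂ : ℝ → Q} {I : Set ℝ} {t : ℝ} (ht : t ∈ I)
    (h : c₁ =ᶠ[𝓝[I] t] c₂) :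
    TotalSpace.mk' E (c₁ t) (accel g c₁ I t) = TotalSpace.mk' E (c₂ t) (accel g c₂ I t) := by
  refine covDerivAlong_congr_curve _ ht ?_ (velocity_congr_curve ht h)
  filter_upwards [eventually_eventually_nhdsWithin.2 h, self_mem_nhdsWithin] with τ hτ hτI
  exact velocity_congr_curve hτI hτ

theorem velocity_congr_set {c : ℝ → Q} {I K : Set ℝ} {t : ℝ} (h : I =ᶠ[𝓝 t] K) :
    ∀ᶠ τ in 𝓝 t, velocity (E := E) c I τ = velocity c K τ := by
  filter_upwards [eventually_eventually_nhds.2 h] with τ hτ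
  rw [velocity, velocity, mfderivWithin_congr_set hτ]

theorem covDerivAlong_congr_set (D : Connection E Q) {c : ℝ → Q} {I K : Set ℝ} {t : ℝ}
    {V W : ∀ t, TangentSpace 𝓘(ℝ, E) (c t)} (h : I =ᶠ[𝓝 t] K) (hVW : ∀ᶠ τ in 𝓝 t, V τ = W τ) :
    ∀ᶠ τ in 𝓝 t, covDerivAlong D c I V τ = covDerivAlong D c K W τ := by
  filter_upwards [eventually_eventually_nhds.2 h, eventually_eventually_nhds.2 hVW,
    velocity_congr_set (E := E) (c := c) h] with τ hτ hVτ hvτ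
  rw [covDerivAlong, covDerivAlong, hvτ, hVτ.self_of_nhds, derivWithin_congr_set hτ]
  congr 2
  refine Filter.EventuallyEq.derivWithin_eq ?_ (by rw [hVτ.self_of_nhds])
  filter_upwards [mem_nhdsWithin_of_mem_nhds hVτ] with σ hσ
  rw [hσ]

theorem accel_congr_set (g : Metric E Q) {c : ℝ → Q} {I K : Set ℝ} {t : ℝ} (h : I =ᶠ[𝓝 t] K) :
    ∀ᶠ τ in 𝓝 t, accel g c I τ = accel g c K τ :=
  covDerivAlong_congr_set _ h (velocity_congr_set h)

/-- The integrand of the augmented functional. -/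
def energyDensity (g : Metric E Q) {r : ℕ} (μ : Fin r → OneForm E Q) (l : Fin r → ℝ) (c : ℝ → Q)
    (I : Set ℝ) (t : ℝ) : ℝ :=
  (1 / 2 : ℝ) * g.inner (c t) (accel g c I t) (accel g c I t)
    + ∑ k, l k * μ k (c t) (accel g c I t)

theorem energyDensity_congr_curve (g : Metric E Q) {r : ℕ} (μ : Fin r → OneForm E Q)
    (l : Fin r → ℝ) {c₁ c₂ : ℝ → Q} {I : Set ℝ} {t : ℝ} (ht : t ∈ I) (h : c₁ =ᶠ[𝓝[I] t] c₂) :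
    energyDensity g μ l c₁ I t = energyDensity g μ l c₂ I t :=
  congrArg (fun P : TangentBundle 𝓘(ℝ, E) Q =>
    (1 / 2 : ℝ) * g.inner P.1 P.2 P.2 + ∑ k, l k * μ k P.1 P.2) (accel_congr_curve g ht h)

theorem energyDensity_congr_set (g : Metric E Q) {r : ℕ} (μ : Fin r → OneForm E Q)
    (l : Fin r → ℝ) {c : ℝ → Q} {I K : Set ℝ} {t : ℝ} (h : I =ᶠ[𝓝 t] K) :
    energyDensity g μ l c I t = energyDensity g μ l c K t := by
  rw [energyDensity, (accel_congr_set g h).self_of_nhds]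
  rfl

/-! ### Smooth curves in a chart -/

/-- The curve `c` is smooth on `K` and stays in the domain of the chart centred at `x₀`. -/
structure ChartCurve (x₀ : Q) (c : ℝ → Q) (K : Set ℝ) : Prop where
  uniqueDiffOn : UniqueDiffOn ℝ K
  contMDiffOn : ContMDiffOn 𝓘(ℝ, ℝ) 𝓘(ℝ, E) ∞ c K
  mapsTo : MapsTo c K (chartAt E x₀).source

/-- The covariant derivative, within `K`, of the vector field `w` along the curve `x`. -/
def covRep (Γ : E → E →L[ℝ] E →L[ℝ] E) (x : ℝ → E) (K : Set ℝ) (w : ℝ → E) (t : ℝ) : E :=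
  derivWithin w K t + Γ (x t) (derivWithin x K t) (w t)

theorem hasCovDerivAt_covRep {Γ : E → E →L[ℝ] E →L[ℝ] E} {x w : ℝ → E} {K : Set ℝ} {t : ℝ}
    (hK : K ∈ 𝓝 t) (hw : DifferentiableWithinAt ℝ w K t) :
    HasCovDerivAt Γ x (derivWithin x K t) w (covRep Γ x K w t) t := by
  rw [HasCovDerivAt, covRep, add_sub_cancel_right]
  exact hw.hasDerivWithinAt.hasDerivAt hK

theorem HasCovDerivAt.add {Γ : E → E →L[ℝ] E →L[ℝ] E} {x V W : ℝ → E} {v V' W' : E} {t : ℝ}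
    (hV : HasCovDerivAt Γ x v V V' t) (hW : HasCovDerivAt Γ x v W W' t) :
    HasCovDerivAt Γ x v (fun t => V t + W t) (V' + W') t := by
  unfold HasCovDerivAt at *
  exact (HasDerivAt.fun_add hV hW).congr_deriv (by rw [map_add]; abel)

theorem HasCovDerivAt.smul {Γ : E → E →L[ℝ] E →L[ℝ] E} {x V : ℝ → E} {v V' : E} {l : ℝ → ℝ}
    {l' : ℝ} {t : ℝ} (hl : HasDerivAt l l' t) (hV : HasCovDerivAt Γ x v V V' t) :
    HasCovDerivAt Γ x v (fun t => l t • V t) (l' • V t + l t • V') t := by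
  unfold HasCovDerivAt at *
  refine (HasDerivAt.fun_smul hl hV).congr_deriv ?_
  rw [map_smul, smul_sub]; abel

theorem HasCovDerivAt.sum {Γ : E → E →L[ℝ] E →L[ℝ] E} {x : ℝ → E} {v : E} {t : ℝ} {ι : Type*}
    {s : Finset ι} {V : ι → ℝ → E} {V' : ι → E} (hV : ∀ k ∈ s, HasCovDerivAt Γ x v (V k) (V' k) t) :
    HasCovDerivAt Γ x v (fun t => ∑ k ∈ s, V k t) (∑ k ∈ s, V' k) t := by
  unfold HasCovDerivAt at *
  refine (HasDerivAt.fun_sum hV).congr_deriv ?_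
  rw [map_sum, Finset.sum_sub_distrib]

section ChartCurve

variable {x₀ : Q} {c : ℝ → Q} {K : Set ℝ} {t : ℝ}

theorem contDiffOn_covRep {U : Set E} {Γ : E → E →L[ℝ] E →L[ℝ] E} {x w : ℝ → E}
    (hΓ : ContDiffOn ℝ ∞ Γ U) (hK : UniqueDiffOn ℝ K) (hx : ContDiffOn ℝ ∞ x K)
    (hxU : MapsTo x K U) (hw : ContDiffOn ℝ ∞ w K) : ContDiffOn ℝ ∞ (covRep Γ x K w) K :=
  (hw.derivWithin hK (by simp)).add
    (contDiffOn_bilinear hΓ hx hxU (hx.derivWithin hK (by simp)) hw)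

theorem ChartCurve.mono {K' : Set ℝ} (h : ChartCurve (E := E) x₀ c K) (hK' : UniqueDiffOn ℝ K')
    (hs : K' ⊆ K) : ChartCurve (E := E) x₀ c K' :=
  ⟨hK', h.contMDiffOn.mono hs, h.mapsTo.mono_left hs⟩

theorem ChartCurve.contDiffOn (h : ChartCurve (E := E) x₀ c K) :
    ContDiffOn ℝ ∞ (extChartAt 𝓘(ℝ, E) x₀ ∘ c) K :=
  contMDiffOn_iff_contDiffOn.1 ((contMDiffOn_chart x₀).comp h.contMDiffOn h.mapsTo)

theorem ChartCurve.mapsTo_target (h : ChartCurve (E := E) x₀ c K) :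
    MapsTo (extChartAt 𝓘(ℝ, E) x₀ ∘ c) K (extChartAt 𝓘(ℝ, E) x₀).target := fun _ ht =>
  chart_mem (h.mapsTo ht)

theorem ChartCurve.coord_velocity (h : ChartCurve (E := E) x₀ c K) (ht : t ∈ K) :
    coord x₀ (c t) (velocity c K t) = derivWithin (extChartAt 𝓘(ℝ, E) x₀ ∘ c) K t :=
  ((CovAcc.coord_velocity (h.uniqueDiffOn t ht)
    ((h.contMDiffOn t ht).mdifferentiableWithinAt (by simp)) (h.mapsTo ht)).derivWithin
      (h.uniqueDiffOn t ht)).symm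

theorem ChartCurve.coord_covDerivAlong (h : ChartCurve (E := E) x₀ c K) (D : Connection E Q)
    {V : ∀ t, TangentSpace 𝓘(ℝ, E) (c t)} {w : ℝ → E} (hw : ContDiffOn ℝ ∞ w K)
    (hVw : ∀ t ∈ K, coord x₀ (c t) (V t) = w t) (ht : t ∈ K) :
    coord x₀ (c t) (covDerivAlong D c K V t) =
      covRep (christoffel D x₀) (extChartAt 𝓘(ℝ, E) x₀ ∘ c) K w t := by
  have h1 : HasDerivWithinAt (fun τ => coord x₀ (c τ) (V τ)) (derivWithin w K t) K t :=
    ((hw.differentiableOn (by simp)) t ht).hasDerivWithinAt.congr hVw (hVw t ht)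
  rw [CovAcc.coord_covDerivAlong D ht (h.uniqueDiffOn t ht)
    ((h.contMDiffOn t ht).mdifferentiableWithinAt (by simp)) (h.mapsTo ht) h1,
    h.coord_velocity ht, hVw t ht]
  rfl

/-- The components of the covariant acceleration. -/
def accelRep (Γ : E → E →L[ℝ] E →L[ℝ] E) (x : ℝ → E) (K : Set ℝ) : ℝ → E :=
  covRep Γ x K (derivWithin x K)

theorem ChartCurve.coord_accel (h : ChartCurve (E := E) x₀ c K) (g : Metric E Q) (ht : t ∈ K) :
    coord x₀ (c t) (accel g c K t) =
      accelRep (christoffel (leviCivita g) x₀) (extChartAt 𝓘(ℝ, E) x₀ ∘ c) K t :=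
  h.coord_covDerivAlong _ (h.contDiffOn.derivWithin h.uniqueDiffOn (by simp))
    (fun _ => h.coord_velocity) ht

theorem ChartCurve.energyDensity_eq (h : ChartCurve (E := E) x₀ c K) (g : Metric E Q) {r : ℕ}
    (μ : Fin r → OneForm E Q) (l : Fin r → ℝ) (ht : t ∈ K) :
    energyDensity g μ l c K t =
      lagrangian (metricRep g x₀) (christoffel (leviCivita g) x₀)
        (fun k => localRep x₀ (sharpField g (μ k))) l ((extChartAt 𝓘(ℝ, E) x₀ ∘ c) t)
        (derivWithin (extChartAt 𝓘(ℝ, E) x₀ ∘ c) K t)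
        (derivWithin (derivWithin (extChartAt 𝓘(ℝ, E) x₀ ∘ c) K) K t) := by
  have h1 := h.coord_accel g ht
  have h2 : ∀ k, μ k (c t) (accel g c K t) =
      g.inner (c t) (sharpField g (μ k) (c t)) (accel g c K t) := fun k =>
    (inner_sharp g (c t) (μ k (c t)) _).symm
  simp only [energyDensity, lagrangian, h2, ← metricRep_chart g (h.mapsTo ht), h1,
    Function.comp_apply, localRep_chart (h.mapsTo ht)]
  rfl

theorem contDiffOn_lagrangian {X : Type*} [NormedAddCommGroup X] [NormedSpace ℝ X] {r : ℕ}
    {U : Set E} {G : E → E →L[ℝ] E →L[ℝ] ℝ} {Γ : E → E →L[ℝ] E →L[ℝ] E} {F : Fin r → E → E}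
    {l : Fin r → X → ℝ} {y v a : X → E} {s : Set X}
    (hG : ContDiffOn ℝ ∞ G U) (hΓ : ContDiffOn ℝ ∞ Γ U) (hF : ∀ k, ContDiffOn ℝ ∞ (F k) U)
    (hl : ∀ k, ContDiffOn ℝ ∞ (l k) s) (hy : ContDiffOn ℝ ∞ y s) (hyU : MapsTo y s U)
    (hv : ContDiffOn ℝ ∞ v s) (ha : ContDiffOn ℝ ∞ a s) :
    ContDiffOn ℝ ∞ (fun p => lagrangian G Γ F (fun k => l k p) (y p) (v p) (a p)) s := by
  have hA := ha.add (contDiffOn_bilinear hΓ hy hyU hv hv)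
  exact (contDiffOn_const.mul (contDiffOn_bilinear hG hy hyU hA hA)).add
    (ContDiffOn.sum fun k _ => (hl k).mul
      (contDiffOn_bilinear hG hy hyU ((hF k).comp hy hyU) hA))

end ChartCurve

/-! ### Integrability of the energy density -/

theorem Piecewise.mono {T : ℝ} {P P' : ℝ → ℝ → Prop} (h : Piecewise T P)
    (hP : ∀ a b, P a b → P' a b) : Piecewise T P' := by
  obtain ⟨m, τ, h0, hm, hτ⟩ := h
  exact ⟨m, τ, h0, hm, fun i hi => ⟨(hτ i hi).1, hP _ _ (hτ i hi).2⟩⟩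

theorem Piecewise.eventually_right {T t : ℝ} {P : Set ℝ → Prop}
    (hP : ∀ s s', s ⊆ s' → P s' → P s) (h : Piecewise T fun a b => P (Icc a b))
    (ht : t ∈ Ico 0 T) : ∀ᶠ b in 𝓝[>] t, P (Icc t b) := by
  obtain ⟨m, τ, h0, hm, hτ⟩ := h
  obtain ⟨i, hi, h1, h2⟩ : ∃ i < m, τ i ≤ t ∧ t < τ (i + 1) := by
    by_contra! hcon
    have : ∀ j ≤ m, τ j ≤ t := by
      intro j
      induction j with
      | zero => intro _; rw [h0]; exact ht.1
      | succ j ih => intro hj; exact hcon j hj (ih (by omega))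
    exact absurd (hm ▸ this m le_rfl) (not_le.2 ht.2)
  filter_upwards [Ioo_mem_nhdsGT h2] with b hb
  exact hP _ _ (Icc_subset_Icc h1 hb.2.le) (hτ i hi).2

theorem Piecewise.eventually_left {T t : ℝ} {P : Set ℝ → Prop}
    (hP : ∀ s s', s ⊆ s' → P s' → P s) (h : Piecewise T fun a b => P (Icc a b))
    (ht : t ∈ Ioc 0 T) : ∀ᶠ a in 𝓝[<] t, P (Icc a t) := by
  obtain ⟨m, τ, h0, hm, hτ⟩ := h
  obtain ⟨i, hi, h1, h2⟩ : ∃ i < m, τ i < t ∧ t ≤ τ (i + 1) := by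
    by_contra! hcon
    have : ∀ j ≤ m, τ j < t := by
      intro j
      induction j with
      | zero => intro _; rw [h0]; exact ht.1
      | succ j ih => intro hj; exact hcon j hj (ih (by omega))
    exact absurd (hm ▸ this m le_rfl) (not_lt.2 ht.2)
  filter_upwards [Ioo_mem_nhdsLT h1] with a ha
  exact hP _ _ (Icc_subset_Icc ha.1.le h2) (hτ i hi).2

theorem integrableOn_energyDensity_Ioo (g : Metric E Q) {r : ℕ} (μ : Fin r → OneForm E Q)
    {lam : Fin r → ℝ → ℝ} {c : ℝ → Q} {x₀ : Q} {T a b : ℝ} (ha : 0 ≤ a) (hb : b ≤ T)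
    (hc : ChartCurve (E := E) x₀ c (Icc a b)) (hlam : ∀ k, ContDiffOn ℝ ∞ (lam k) (Icc a b)) :
    IntegrableOn (fun t => energyDensity g μ (fun k => lam k t) c (Icc 0 T) t) (Ioo a b) := by
  have hv := hc.contDiffOn.derivWithin hc.uniqueDiffOn (m := ∞) (by simp)
  have h1 := contDiffOn_lagrangian (contDiffOn_metricRep g x₀)
    (contDiffOn_christoffel (isLeviCivita_leviCivita g) x₀)
    (fun k => contDiffOn_localRep_sharpField g (μ k) x₀) hlam hc.contDiffOn hc.mapsTo_target hv
    (hv.derivWithin hc.uniqueDiffOn (m := ∞) (by simp))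
  refine ((h1.continuousOn.integrableOn_Icc).mono_set Ioo_subset_Icc_self).congr_fun ?_
    measurableSet_Ioo
  intro t ht
  have hset : Icc 0 T =ᶠ[𝓝 t] Icc a b := by
    filter_upwards [Icc_mem_nhds ht.1 ht.2] with τ hτ
    exact propext ⟨fun _ => hτ, fun _ => Icc_subset_Icc ha hb hτ⟩
  change _ = energyDensity g μ _ c _ t
  rw [energyDensity_congr_set g μ _ hset, hc.energyDensity_eq g μ _ (Ioo_subset_Icc_self ht)]

/-- The integrand of the augmented functional is bounded near every time on either side, because
one-sided neighbourhoods of that time lie in one piece of all the subdivisions. -/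
theorem IsAdmissible.integrableOn_energyDensity (g : Metric E Q) {r : ℕ}
    (μ : Fin r → OneForm E Q) {lam : Fin r → ℝ → ℝ} {c : ℝ → Q} {T : ℝ}
    {p₀ p₁ : TangentBundle 𝓘(ℝ, E) Q} (h : IsAdmissible T p₀ p₁ c)
    (hlam : ∀ k, Piecewise T fun a b => ContDiffOn ℝ ∞ (lam k) (Icc a b)) :
    IntegrableOn (fun t => energyDensity g μ (fun k => lam k t) c (Icc 0 T) t) (Icc 0 T) := by
  set f := fun t => energyDensity g μ (fun k => lam k t) c (Icc 0 T) t with hf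
  refine LocallyIntegrableOn.integrableOn_isCompact (fun t ht => ?_) isCompact_Icc
  have hsrc : ∀ᶠ τ in 𝓝[Icc 0 T] t, c τ ∈ (chartAt E (c t)).source :=
    h.contMDiffOn_one.continuousOn t ht (source_mem_nhds (mem_chart_source E (c t)))
  have hright : IntegrableAtFilter f (𝓝[Icc 0 T ∩ Ioi t] t) := by
    rcases ht.2.eq_or_lt with rfl | htT
    · refine ⟨∅, ?_, integrableOn_empty⟩
      rw [show Icc 0 t ∩ Ioi t = ∅ from eq_empty_of_forall_notMem fun τ hτ =>
        absurd hτ.1.2 (not_le.2 hτ.2), nhdsWithin_empty]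
      trivial
    · have h1 := h.piecewise_smooth.eventually_right
        (P := fun s => ContMDiffOn 𝓘(ℝ, ℝ) 𝓘(ℝ, E) ∞ c s) (fun s s' hs h => h.mono hs) ⟨ht.1, htT⟩
      have h2 := Filter.eventually_all.2 fun k => (hlam k).eventually_right
        (P := fun s => ContDiffOn ℝ ∞ (lam k) s) (fun s s' hs h => h.mono hs) ⟨ht.1, htT⟩
      have hGE : {τ | c τ ∈ (chartAt E (c t)).source} ∈ 𝓝[≥] t := by
        rw [← nhdsWithin_Icc_eq_nhdsGE htT]
        exact nhdsWithin_mono t (Icc_subset_Icc_left ht.1) hsrc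
      obtain ⟨u, hu, hu'⟩ := mem_nhdsGE_iff_exists_Icc_subset.1 hGE
      obtain ⟨b, ⟨hb1, hb2⟩, hb3, hb4⟩ :=
        ((h1.and h2).and ((Ioo_mem_nhdsGT (lt_min hu htT)))).exists
      obtain ⟨hb4, hb5⟩ := lt_min_iff.1 hb4
      refine ⟨Ioo t b, ?_, integrableOn_energyDensity_Ioo g μ ht.1 hb5.le
        ⟨uniqueDiffOn_Icc hb3, hb1, fun τ hτ => hu' ⟨hτ.1, hτ.2.trans hb4.le⟩⟩ hb2⟩
      exact nhdsWithin_mono t inter_subset_right (Ioo_mem_nhdsGT hb3)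
  have hleft : IntegrableAtFilter f (𝓝[Icc 0 T ∩ Iio t] t) := by
    rcases ht.1.eq_or_lt with rfl | ht0
    · refine ⟨∅, ?_, integrableOn_empty⟩
      rw [show Icc 0 T ∩ Iio 0 = ∅ from eq_empty_of_forall_notMem fun τ hτ =>
        absurd hτ.1.1 (not_le.2 hτ.2), nhdsWithin_empty]
      trivial
    · have h1 := h.piecewise_smooth.eventually_left
        (P := fun s => ContMDiffOn 𝓘(ℝ, ℝ) 𝓘(ℝ, E) ∞ c s) (fun s s' hs h => h.mono hs) ⟨ht0, ht.2⟩
      have h2 := Filter.eventually_all.2 fun k => (hlam k).eventually_left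
        (P := fun s => ContDiffOn ℝ ∞ (lam k) s) (fun s s' hs h => h.mono hs) ⟨ht0, ht.2⟩
      have hLE : {τ | c τ ∈ (chartAt E (c t)).source} ∈ 𝓝[≤] t := by
        rw [← nhdsWithin_Icc_eq_nhdsLE ht0]
        exact nhdsWithin_mono t (Icc_subset_Icc_right ht.2) hsrc
      obtain ⟨u, hu, hu'⟩ := mem_nhdsLE_iff_exists_Icc_subset.1 hLE
      obtain ⟨a, ⟨ha1, ha2⟩, ha3, ha4⟩ :=
        ((h1.and h2).and ((Ioo_mem_nhdsLT (max_lt hu ht0)))).exists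
      obtain ⟨ha3, ha5⟩ := max_lt_iff.1 ha3
      refine ⟨Ioo a t, ?_, integrableOn_energyDensity_Ioo g μ ha5.le ht.2
        ⟨uniqueDiffOn_Icc ha4, ha1, fun τ hτ => hu' ⟨ha3.le.trans hτ.1, hτ.2⟩⟩ ha2⟩
      exact nhdsWithin_mono t inter_subset_right (Ioo_mem_nhdsLT ha4)
  have hpure : IntegrableAtFilter f (pure t) :=
    ⟨{t}, by simp, integrableOn_singleton
      (hx := by rw [Real.volume_singleton]; exact ENNReal.zero_lt_top)⟩
  refine (IntegrableAtFilter.sup_iff.2 ⟨IntegrableAtFilter.sup_iff.2 ⟨hleft, hpure⟩,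
    hright⟩).filter_mono ?_
  rw [← nhdsWithin_singleton, ← nhdsWithin_union, ← nhdsWithin_union]
  refine nhdsWithin_mono t fun τ hτ => ?_
  rcases lt_trichotomy τ t with h1 | h1 | h1
  · exact Or.inl (Or.inl ⟨hτ, h1⟩)
  · exact Or.inl (Or.inr h1)
  · exact Or.inr ⟨hτ, h1⟩

/-! ### Variations supported in a chart -/

open Classical in
/-- The variation of the curve `c` that moves it, in the chart centred at `x₀`, by `s • η`. Outside
the support of `η` the curve, which may leave the chart there, is not changed. -/
def chartVariation (x₀ : Q) (c : ℝ → Q) (η : ℝ → E) (s t : ℝ) : Q :=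
  if t ∈ tsupport η then
    (extChartAt 𝓘(ℝ, E) x₀).symm (extChartAt 𝓘(ℝ, E) x₀ (c t) + s • η t) else c t

section Variation

variable {x₀ : Q} {c : ℝ → Q} {η : ℝ → E} {J : Set ℝ} {ε s t : ℝ}

theorem chartVariation_eventuallyEq (ht : t ∉ tsupport η) :
    chartVariation x₀ c η s =ᶠ[𝓝 t] c := by
  filter_upwards [(isClosed_tsupport η).isOpen_compl.mem_nhds ht] with τ hτ
  exact if_neg hτ

theorem chartVariation_eq (ht : c t ∈ (chartAt E x₀).source) : chartVariation x₀ c η s t =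
    (extChartAt 𝓘(ℝ, E) x₀).symm (extChartAt 𝓘(ℝ, E) x₀ (c t) + s • η t) := by
  by_cases h : t ∈ tsupport η
  · exact if_pos h
  · rw [chartVariation, if_neg h, image_eq_zero_of_notMem_tsupport h, smul_zero, add_zero,
      symm_chart ht]

theorem chartVariation_zero (hc : MapsTo c J (chartAt E x₀).source) (hηJ : tsupport η ⊆ J) :
    chartVariation x₀ c η 0 t = c t := by
  by_cases h : t ∈ tsupport η
  · rw [chartVariation_eq (hc (hηJ h)), zero_smul, add_zero, symm_chart (hc (hηJ h))]
  · exact if_neg h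

theorem exists_pos_forall_mem_target (hc : ChartCurve (E := E) x₀ c J) (hη : Continuous η)
    (hηc : HasCompactSupport η) (hηJ : tsupport η ⊆ J) :
    ∃ ε > (0 : ℝ), ∀ s ∈ Ioo (-ε) ε, ∀ t ∈ J,
      extChartAt 𝓘(ℝ, E) x₀ (c t) + s • η t ∈ (extChartAt 𝓘(ℝ, E) x₀).target := by
  obtain ⟨δ, hδ, hδU⟩ := (hηc.image_of_continuousOn
    (hc.contDiffOn.continuousOn.mono hηJ)).exists_thickening_subset_open (target_isOpen x₀)
    (image_subset_iff.2 fun t ht => hc.mapsTo_target (hηJ ht))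
  obtain ⟨M, hM⟩ := hη.bounded_above_of_compact_support hηc
  have hM0 : 0 ≤ M := (norm_nonneg _).trans (hM 0)
  refine ⟨δ / (M + 1), by positivity, fun s hs t ht => ?_⟩
  by_cases h : t ∈ tsupport η
  · refine hδU (Metric.mem_thickening_iff.2 ⟨_, mem_image_of_mem _ h, ?_⟩)
    rw [dist_eq_norm, Function.comp_apply, add_sub_cancel_left, norm_smul, Real.norm_eq_abs]
    have h1 : |s| < δ / (M + 1) := abs_lt.2 hs
    calc |s| * ‖η t‖ ≤ |s| * (M + 1) := by gcongr; linarith [hM t]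
      _ < δ := (lt_div_iff₀ (by positivity)).1 h1
  · rw [image_eq_zero_of_notMem_tsupport h, smul_zero, add_zero]
    exact hc.mapsTo_target ht

theorem contMDiffOn_chartVariation (hc : ChartCurve (E := E) x₀ c J) (hJ : IsOpen J)
    (hη : ContDiff ℝ ∞ η) (hηJ : tsupport η ⊆ J)
    (hε : ∀ s ∈ Ioo (-ε) ε, ∀ t ∈ J,
      extChartAt 𝓘(ℝ, E) x₀ (c t) + s • η t ∈ (extChartAt 𝓘(ℝ, E) x₀).target)
    {n : WithTop ℕ∞} (hn : n ≤ ∞) {S : Set ℝ} (hS : ContMDiffOn 𝓘(ℝ, ℝ) 𝓘(ℝ, E) n c S) :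
    ContMDiffOn 𝓘(ℝ, ℝ × ℝ) 𝓘(ℝ, E) n (fun z : ℝ × ℝ => chartVariation x₀ c η z.1 z.2)
      (Ioo (-ε) ε ×ˢ S) := by
  rintro ⟨s, t⟩ ⟨hs, ht⟩
  by_cases h : t ∈ tsupport η
  · have h1 : ContDiffOn ℝ ∞ (fun z : ℝ × ℝ => (extChartAt 𝓘(ℝ, E) x₀ ∘ c) z.2 + z.1 • η z.2)
        (Ioo (-ε) ε ×ˢ J) :=
      (hc.contDiffOn.comp contDiffOn_snd fun z hz => hz.2).add
        (contDiffOn_fst.smul (hη.comp contDiff_snd).contDiffOn)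
    have h2 : ContMDiffOn 𝓘(ℝ, ℝ × ℝ) 𝓘(ℝ, E) ∞
        (fun z : ℝ × ℝ => chartVariation x₀ c η z.1 z.2) (Ioo (-ε) ε ×ˢ J) :=
      ((contMDiffOn_symm x₀).comp h1.contMDiffOn fun z hz => hε z.1 hz.1 z.2 hz.2).congr
        fun z hz => chartVariation_eq (hc.mapsTo hz.2)
    exact ((h2.contMDiffAt ((isOpen_Ioo.prod hJ).mem_nhds ⟨hs, hηJ h⟩)).of_le
      hn).contMDiffWithinAt
  · have h1 : ContMDiffWithinAt 𝓘(ℝ, ℝ × ℝ) 𝓘(ℝ, E) n (fun z : ℝ × ℝ => c z.2)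
        (Ioo (-ε) ε ×ˢ S) (s, t) :=
      ContMDiffWithinAt.comp (I' := 𝓘(ℝ, ℝ)) (s, t) (hS t ht)
        (contDiff_snd.contMDiff (s, t)).contMDiffWithinAt fun z hz => hz.2
    refine h1.congr_of_eventuallyEq_of_mem ?_ ⟨hs, ht⟩
    have h2 : {z : ℝ × ℝ | z.2 ∉ tsupport η} ∈ 𝓝 (s, t) :=
      ((isClosed_tsupport η).isOpen_compl.preimage continuous_snd).mem_nhds h
    filter_upwards [mem_nhdsWithin_of_mem_nhds h2] with z hz
    exact if_neg hz

theorem contMDiffOn_chartVariation_slice (hc : ChartCurve (E := E) x₀ c J) (hJ : IsOpen J)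
    (hη : ContDiff ℝ ∞ η) (hηJ : tsupport η ⊆ J)
    (hε : ∀ s ∈ Ioo (-ε) ε, ∀ t ∈ J,
      extChartAt 𝓘(ℝ, E) x₀ (c t) + s • η t ∈ (extChartAt 𝓘(ℝ, E) x₀).target)
    {n : WithTop ℕ∞} (hn : n ≤ ∞) {S : Set ℝ} (hS : ContMDiffOn 𝓘(ℝ, ℝ) 𝓘(ℝ, E) n c S)
    (hs : s ∈ Ioo (-ε) ε) :
    ContMDiffOn 𝓘(ℝ, ℝ) 𝓘(ℝ, E) n (chartVariation x₀ c η s) S :=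
  (contMDiffOn_chartVariation hc hJ hη hηJ hε hn hS).comp (t := Ioo (-ε) ε ×ˢ S)
    (contDiff_const.prodMk contDiff_id).contMDiff.contMDiffOn
    fun _ hτ => ⟨hs, hτ⟩

theorem isVariation_chartVariation {T : ℝ} {p₀ p₁ : TangentBundle 𝓘(ℝ, E) Q}
    (h : IsAdmissible T p₀ p₁ c) {r : ℕ} {lam : Fin r → ℝ → ℝ}
    (hlam : ∀ k, Piecewise T fun a b => ContDiffOn ℝ ∞ (lam k) (Icc a b)) (hT : 0 ≤ T)
    (hc : ChartCurve (E := E) x₀ c J) (hJ : IsOpen J) (hJT : J ⊆ Ioo 0 T)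
    (hη : ContDiff ℝ ∞ η) (hηJ : tsupport η ⊆ J) (hε0 : 0 < ε)
    (hε : ∀ s ∈ Ioo (-ε) ε, ∀ t ∈ J,
      extChartAt 𝓘(ℝ, E) x₀ (c t) + s • η t ∈ (extChartAt 𝓘(ℝ, E) x₀).target) :
    IsVariation T p₀ p₁ c lam ε (chartVariation x₀ c η) fun _ => lam where
  pos := hε0
  curve_zero t _ := chartVariation_zero hc.mapsTo hηJ
  multiplier_zero _ _ _ := rfl
  admissible s hs :=
    { contMDiffOn_one := contMDiffOn_chartVariation_slice hc hJ hη hηJ hε (by simp)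
        h.contMDiffOn_one hs
      piecewise_smooth := h.piecewise_smooth.mono fun a b hab =>
        contMDiffOn_chartVariation_slice hc hJ hη hηJ hε le_rfl hab hs
      initial := (velocity_congr_curve (left_mem_Icc.2 hT)
        ((chartVariation_eventuallyEq fun h0 => lt_irrefl _ (hJT (hηJ h0)).1).filter_mono
          nhdsWithin_le_nhds)).trans h.initial
      final := (velocity_congr_curve (right_mem_Icc.2 hT)
        ((chartVariation_eventuallyEq fun h0 => lt_irrefl _ (hJT (hηJ h0)).2).filter_mono
          nhdsWithin_le_nhds)).trans h.final }
  curve_smooth := h.piecewise_smooth.mono fun a b hab =>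
    contMDiffOn_chartVariation hc hJ hη hηJ hε le_rfl hab
  multiplier_smooth k := (hlam k).mono fun a b hab =>
    hab.comp contDiffOn_snd fun _ hz => hz.2

theorem energyDensity_chartVariation (g : Metric E Q) {r : ℕ} (μ : Fin r → OneForm E Q)
    (l : Fin r → ℝ) {I : Set ℝ} (hc : ChartCurve (E := E) x₀ c J) (hJ : IsOpen J) (hJI : J ⊆ I)
    (hη : ContDiff ℝ ∞ η) (hηJ : tsupport η ⊆ J)
    (hε : ∀ s ∈ Ioo (-ε) ε, ∀ t ∈ J,
      extChartAt 𝓘(ℝ, E) x₀ (c t) + s • η t ∈ (extChartAt 𝓘(ℝ, E) x₀).target)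
    (hs : s ∈ Ioo (-ε) ε) (ht : t ∈ J) :
    energyDensity g μ l (chartVariation x₀ c η s) I t =
      lagrangian (metricRep g x₀) (christoffel (leviCivita g) x₀)
        (fun k => localRep x₀ (sharpField g (μ k))) l
        ((extChartAt 𝓘(ℝ, E) x₀ ∘ c) t + s • η t)
        (derivWithin (extChartAt 𝓘(ℝ, E) x₀ ∘ c) J t + s • deriv η t)
        (derivWithin (derivWithin (extChartAt 𝓘(ℝ, E) x₀ ∘ c) J) J t + s • deriv (deriv η) t) := by
  have hu := hc.uniqueDiffOn
  have hset : I =ᶠ[𝓝 t] J := by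
    filter_upwards [hJ.mem_nhds ht] with τ hτ
    exact propext ⟨fun _ => hτ, fun _ => hJI hτ⟩
  have hcs : ChartCurve (E := E) x₀ (chartVariation x₀ c η s) J :=
    ⟨hu, contMDiffOn_chartVariation_slice hc hJ hη hηJ hε le_rfl hc.contMDiffOn hs,
      fun τ hτ => by
        rw [chartVariation_eq (hc.mapsTo hτ)]
        exact symm_mem (hε s hs τ hτ)⟩
  have h0 : ∀ τ ∈ J, (extChartAt 𝓘(ℝ, E) x₀ ∘ chartVariation x₀ c η s) τ =
      (extChartAt 𝓘(ℝ, E) x₀ ∘ c) τ + s • η τ := fun τ hτ => by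
    rw [Function.comp_apply, chartVariation_eq (hc.mapsTo hτ), chart_symm (hε s hs τ hτ)]
    rfl
  have hη1 : ContDiff ℝ ∞ (deriv η) := (contDiff_infty_iff_deriv.1 hη).2
  have hd : ∀ {f : ℝ → E} {ζ : ℝ → E}, ContDiffOn ℝ ∞ f J → ContDiff ℝ ∞ ζ → ∀ τ ∈ J,
      derivWithin (fun τ => f τ + s • ζ τ) J τ = derivWithin f J τ + s • deriv ζ τ := by
    intro f ζ hf hζ τ hτ
    have h1 := (((hf.differentiableOn (by simp)) τ hτ).hasDerivWithinAt).add
      (((hζ.differentiable (by simp)) τ).hasDerivAt.hasDerivWithinAt.const_smul s)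
    exact h1.derivWithin (hu τ hτ)
  have h1 : ∀ τ ∈ J, derivWithin (extChartAt 𝓘(ℝ, E) x₀ ∘ chartVariation x₀ c η s) J τ =
      derivWithin (extChartAt 𝓘(ℝ, E) x₀ ∘ c) J τ + s • deriv η τ := fun τ hτ => by
    rw [derivWithin_congr h0 (h0 τ hτ)]
    exact hd hc.contDiffOn hη τ hτ
  rw [energyDensity_congr_set g μ l hset, hcs.energyDensity_eq g μ l ht, h0 t ht, h1 t ht,
    derivWithin_congr h1 (h1 t ht),
    hd (hc.contDiffOn.derivWithin hu (by simp)) hη1 t ht]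

end Variation

/-! ### The Euler–Lagrange equation in a chart -/

theorem continuousOn_linear {H : Type*} [NormedAddCommGroup H] [NormedSpace ℝ H] {s : Set ℝ}
    {U : Set E} {x V : ℝ → E} {B : E → E →L[ℝ] H} (hB : ContinuousOn B U) (hx : ContinuousOn x s)
    (hxU : MapsTo x s U) (hV : ContinuousOn V s) : ContinuousOn (fun t => B (x t) (V t)) s :=
  (hB.comp hx hxU).clm_apply hV

theorem continuousOn_bilinear {F : Type*} [NormedAddCommGroup F] [NormedSpace ℝ F] {s : Set ℝ}
    {U : Set E} {x V W : ℝ → E} {B : E → E →L[ℝ] E →L[ℝ] F} (hB : ContinuousOn B U)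
    (hx : ContinuousOn x s) (hxU : MapsTo x s U) (hV : ContinuousOn V s) (hW : ContinuousOn W s) :
    ContinuousOn (fun t => B (x t) (V t) (W t)) s :=
  (continuousOn_linear hB hx hxU hV).clm_apply hW

theorem continuousOn_trilinear {F : Type*} [NormedAddCommGroup F] [NormedSpace ℝ F] {s : Set ℝ}
    {U : Set E} {x V W Z : ℝ → E} {B : E → E →L[ℝ] E →L[ℝ] E →L[ℝ] F} (hB : ContinuousOn B U)
    (hx : ContinuousOn x s) (hxU : MapsTo x s U) (hV : ContinuousOn V s) (hW : ContinuousOn W s)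
    (hZ : ContinuousOn Z s) : ContinuousOn (fun t => B (x t) (V t) (W t) (Z t)) s :=
  (continuousOn_bilinear hB hx hxU hV hW).clm_apply hZ

section EulerLagrange

variable {r : ℕ} {U : Set E} {G : E → E →L[ℝ] E →L[ℝ] ℝ} {Γ : E → E →L[ℝ] E →L[ℝ] E}

theorem LocalMetric.continuousOn_curvRep (h : LocalMetric U G Γ) {x u v w : ℝ → E} {s : Set ℝ}
    (hx : ContinuousOn x s) (hxU : MapsTo x s U) (hu : ContinuousOn u s) (hv : ContinuousOn v s)
    (hw : ContinuousOn w s) : ContinuousOn (fun t => curvRep Γ (x t) (u t) (v t) (w t)) s := by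
  have hdΓ : ContinuousOn (fderiv ℝ Γ) U :=
    h.contDiffOn_symbols.continuousOn_fderiv_of_isOpen h.isOpen (by simp)
  have hΓ := h.contDiffOn_symbols.continuousOn
  have h1 : ∀ {u v w : ℝ → E}, ContinuousOn u s → ContinuousOn v s → ContinuousOn w s →
      ContinuousOn (fun t => fderiv ℝ Γ (x t) (u t) (v t) (w t)) s := fun hu hv hw =>
    continuousOn_trilinear hdΓ hx hxU hu hv hw
  have h2 : ∀ {u v : ℝ → E}, ContinuousOn u s → ContinuousOn v s →
      ContinuousOn (fun t => Γ (x t) (u t) (v t)) s := fun hu hv =>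
    continuousOn_bilinear hΓ hx hxU hu hv
  exact (((h1 hu hv hw).sub (h1 hv hu hw)).add (h2 hu (h2 hv hw))).sub (h2 hv (h2 hu hw))

theorem LocalMetric.continuousOn_eulerLagrange (h : LocalMetric U G Γ) {X : Fin r → E → E}
    (hX : ∀ k, ContDiffOn ℝ ∞ (X k) U) {l : Fin r → ℝ → ℝ} {x v A P P₂ w : ℝ → E} {s : Set ℝ}
    (hl : ∀ k, ContinuousOn (l k) s) (hx : ContinuousOn x s) (hxU : MapsTo x s U)
    (hv : ContinuousOn v s) (hA : ContinuousOn A s) (hP : ContinuousOn P s)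
    (hP₂ : ContinuousOn P₂ s) (hw : ContinuousOn w s) :
    ContinuousOn (fun t => eulerLagrange G Γ X (fun k => l k t) (x t) (v t) (A t) (P t) (P₂ t)
      (w t)) s := by
  have hR := h.continuousOn_curvRep hx hxU hP hv hv
  have hdX : ∀ k, ContinuousOn (fderiv ℝ (X k)) U := fun k =>
    (hX k).continuousOn_fderiv_of_isOpen h.isOpen (by simp)
  have hX' : ∀ k, ContinuousOn (fun t => X k (x t)) s := fun k => (hX k).continuousOn.comp hx hxU
  have hΓ := h.contDiffOn_symbols.continuousOn
  have hG := h.contDiffOn_metric.continuousOn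
  exact (continuousOn_bilinear hG hx hxU (hP₂.add hR) hw).add (continuousOn_finsetSum _ fun k _ =>
    (hl k).mul (continuousOn_bilinear hG hx hxU
      ((continuousOn_linear (hdX k) hx hxU hw).add
        (continuousOn_bilinear hΓ hx hxU hw (hX' k))) hA))

theorem eulerLagrange_smul (X : Fin r → E → E) (l : Fin r → ℝ) (y v A P P₂ w : E) (ρ : ℝ) :
    eulerLagrange G Γ X l y v A P P₂ (ρ • w) = ρ * eulerLagrange G Γ X l y v A P P₂ w := by
  simp only [eulerLagrange, map_smul, smul_apply, ← smul_add, smul_eq_mul, mul_add, Finset.mul_sum]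
  congr 1
  exact Finset.sum_congr rfl fun k _ => by ring

end EulerLagrange

section Critical

variable {g : Metric E Q} {r : ℕ} {μ : Fin r → OneForm E Q} {T : ℝ}
  {p₀ p₁ : TangentBundle 𝓘(ℝ, E) Q} {c : ℝ → Q} {lam : Fin r → ℝ → ℝ} {x₀ : Q} {p q : ℝ}

/-- Only the integral over the support depends on the parameter of the variation. The other
integrals can be split off because the integrand is integrable for every admissible curve. -/
theorem augmentedEnergy_chartVariation {J : Set ℝ} {η : ℝ → E} {ε : ℝ}
    (h : IsNormalExtremal g μ T p₀ p₁ c lam) (hc : ChartCurve (E := E) x₀ c J) (hJ : IsOpen J)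
    (hJT : J ⊆ Ioo 0 T) (hpq : p ≤ q) (hpqJ : Icc p q ⊆ J)
    (hη : ContDiff ℝ ∞ η) (hηpq : tsupport η ⊆ Ioo p q) (hε0 : 0 < ε)
    (hε : ∀ s ∈ Ioo (-ε) ε, ∀ t ∈ J,
      extChartAt 𝓘(ℝ, E) x₀ (c t) + s • η t ∈ (extChartAt 𝓘(ℝ, E) x₀).target) :
    ∃ C, ∀ s ∈ Ioo (-ε) ε, augmentedEnergy g μ T (chartVariation x₀ c η s) lam = C +
      ∫ t in p..q, lagrangian (metricRep g x₀) (christoffel (leviCivita g) x₀)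
        (fun k => localRep x₀ (sharpField g (μ k))) (fun k => lam k t)
        ((extChartAt 𝓘(ℝ, E) x₀ ∘ c) t + s • η t)
        (derivWithin (extChartAt 𝓘(ℝ, E) x₀ ∘ c) J t + s • deriv η t)
        (derivWithin (derivWithin (extChartAt 𝓘(ℝ, E) x₀ ∘ c) J) J t
          + s • deriv (deriv η) t) := by
  have hp0 : 0 < p := (hJT (hpqJ (left_mem_Icc.2 hpq))).1
  have hqT : q < T := (hJT (hpqJ (right_mem_Icc.2 hpq))).2
  have hηJ : tsupport η ⊆ J := hηpq.trans (Ioo_subset_Icc_self.trans hpqJ)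
  set f : (ℝ → Q) → ℝ → ℝ := fun c t => energyDensity g μ (fun k => lam k t) c (Icc 0 T) t with hf
  have hvar := isVariation_chartVariation h.admissible h.multiplier_smooth
    (hp0.le.trans (hpq.trans hqT.le)) hc hJ hJT hη hηJ hε0 hε
  refine ⟨(∫ t in (0 : ℝ)..p, f c t) + ∫ t in q..T, f c t, fun s hs => ?_⟩
  have hint := (hvar.admissible s hs).integrableOn_energyDensity g μ h.multiplier_smooth
  have hii : ∀ a b, 0 ≤ a → a ≤ b → b ≤ T →
      IntervalIntegrable (f (chartVariation x₀ c η s)) volume a b := fun a b ha hab hb =>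
    (intervalIntegrable_iff_integrableOn_Icc_of_le hab).2
      (hint.mono_set (Icc_subset_Icc ha hb))
  have hout : ∀ t ∈ Icc 0 T, t ∉ Ioo p q → f (chartVariation x₀ c η s) t = f c t :=
    fun t ht htpq => energyDensity_congr_curve g μ _ ht
      ((chartVariation_eventuallyEq fun h => htpq (hηpq h)).filter_mono nhdsWithin_le_nhds)
  have h1 : ∫ t in (0 : ℝ)..p, f (chartVariation x₀ c η s) t = ∫ t in (0 : ℝ)..p, f c t := by
    refine intervalIntegral.integral_congr fun t ht => ?_
    rw [uIcc_of_le hp0.le] at ht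
    exact hout t ⟨ht.1, by linarith [ht.2]⟩ fun h => not_lt.2 ht.2 h.1
  have h2 : ∫ t in q..T, f (chartVariation x₀ c η s) t = ∫ t in q..T, f c t := by
    refine intervalIntegral.integral_congr fun t ht => ?_
    rw [uIcc_of_le hqT.le] at ht
    exact hout t ⟨by linarith [ht.1], ht.2⟩ fun h => not_lt.2 ht.1 h.2
  change ∫ t in (0 : ℝ)..T, f (chartVariation x₀ c η s) t = _
  rw [← intervalIntegral.integral_add_adjacent_intervals
      (hii 0 p le_rfl hp0.le (hpq.trans hqT.le)) (hii p T hp0.le (hpq.trans hqT.le) le_rfl),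
    ← intervalIntegral.integral_add_adjacent_intervals
      (hii p q hp0.le hpq hqT.le) (hii q T (hp0.le.trans hpq) hqT.le le_rfl), h1, h2,
    add_left_comm, add_comm]
  congr 1
  refine intervalIntegral.integral_congr fun t ht => ?_
  rw [uIcc_of_le hpq] at ht
  exact energyDensity_chartVariation g μ _ hc hJ (hJT.trans Ioo_subset_Icc_self) hη hηJ hε hs
    (hpqJ ht)

/-- The weak form of the Euler–Lagrange equation. -/
theorem IsNormalExtremal.integral_eulerLagrange {J : Set ℝ} {η P P₁ P₂ : ℝ → E}
    (h : IsNormalExtremal g μ T p₀ p₁ c lam) (hc : ChartCurve (E := E) x₀ c J) (hJ : IsOpen J)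
    (hlam : ∀ k, ContDiffOn ℝ ∞ (lam k) J)
    (hJT : J ⊆ Ioo 0 T) (hpq : p ≤ q) (hpqJ : Icc p q ⊆ J)
    (hη : ContDiff ℝ ∞ η) (hηpq : tsupport η ⊆ Ioo p q)
    (hP : ∀ t ∈ J, P t = accelRep (christoffel (leviCivita g) x₀) (extChartAt 𝓘(ℝ, E) x₀ ∘ c) J t
      + ∑ k, lam k t • localRep x₀ (sharpField g (μ k)) ((extChartAt 𝓘(ℝ, E) x₀ ∘ c) t))
    (hP₁ : ∀ t ∈ J, HasCovDerivAt (christoffel (leviCivita g) x₀) (extChartAt 𝓘(ℝ, E) x₀ ∘ c)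
      (derivWithin (extChartAt 𝓘(ℝ, E) x₀ ∘ c) J t) P (P₁ t) t)
    (hP₂ : ∀ t ∈ J, HasCovDerivAt (christoffel (leviCivita g) x₀) (extChartAt 𝓘(ℝ, E) x₀ ∘ c)
      (derivWithin (extChartAt 𝓘(ℝ, E) x₀ ∘ c) J t) P₁ (P₂ t) t)
    (hP₂c : ContinuousOn P₂ J) :
    ∫ t in p..q, eulerLagrange (metricRep g x₀) (christoffel (leviCivita g) x₀)
        (fun k => localRep x₀ (sharpField g (μ k))) (fun k => lam k t)
        ((extChartAt 𝓘(ℝ, E) x₀ ∘ c) t) (derivWithin (extChartAt 𝓘(ℝ, E) x₀ ∘ c) J t)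
        (accelRep (christoffel (leviCivita g) x₀) (extChartAt 𝓘(ℝ, E) x₀ ∘ c) J t)
        (P t) (P₂ t) (η t) = 0 := by
  have hM := localMetric_chart (isLeviCivita_leviCivita g) x₀
  have hηJ : tsupport η ⊆ J := hηpq.trans (Ioo_subset_Icc_self.trans hpqJ)
  have hηc : HasCompactSupport η :=
    isCompact_Icc.of_isClosed_subset (isClosed_tsupport η) (hηpq.trans Ioo_subset_Icc_self)
  obtain ⟨ε, hε0, hε⟩ := exists_pos_forall_mem_target hc hη.continuous hηc hηJ
  obtain ⟨C, hC⟩ := augmentedEnergy_chartVariation h hc hJ hJT hpq hpqJ hη hηpq hε0 hε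
  have hcrit := h.critical ε _ _ (isVariation_chartVariation h.admissible h.multiplier_smooth
    (by linarith [(hJT (hpqJ (left_mem_Icc.2 hpq))).1, (hJT (hpqJ (right_mem_Icc.2 hpq))).2])
    hc hJ hJT hη hηJ hε0 hε)
  have hXs := fun k => contDiffOn_localRep_sharpField g (μ k) x₀
  have hxs := hc.contDiffOn
  have hxU := hc.mapsTo_target
  set x := extChartAt 𝓘(ℝ, E) x₀ ∘ c with hx
  set G := metricRep g x₀ with hG
  set Γ := christoffel (leviCivita g) x₀ with hΓ
  set X : Fin r → E → E := fun k => localRep x₀ (sharpField g (μ k)) with hX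
  set v := derivWithin x J with hv
  set a := derivWithin v J with ha
  have hu := hc.uniqueDiffOn
  have hvs : ContDiffOn ℝ ∞ v J := hxs.derivWithin hu (by simp)
  have has : ContDiffOn ℝ ∞ a J := hvs.derivWithin hu (by simp)
  have hη1 : ContDiff ℝ ∞ (deriv η) := (contDiff_infty_iff_deriv.1 hη).2
  have hη2 : ContDiff ℝ ∞ (deriv (deriv η)) := (contDiff_infty_iff_deriv.1 hη1).2
  have hder : ∀ {f : ℝ → E}, ContDiffOn ℝ ∞ f J → ∀ t ∈ J, HasDerivAt f (derivWithin f J t) t :=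
    fun hf t ht => ((hf.differentiableOn (by simp)) t ht).hasDerivWithinAt.hasDerivAt
      (hJ.mem_nhds ht)
  have hder' : ∀ {f : ℝ → E}, ContDiff ℝ ∞ f → ∀ t, HasDerivAt f (deriv f t) t :=
    fun hf t => ((hf.differentiable (by simp)) t).hasDerivAt
  -- the covariant derivatives of `η`
  set Dη : ℝ → E := fun t => deriv η t + Γ (x t) (v t) (η t) with hDη
  have hDηs : ContDiffOn ℝ ∞ Dη J :=
    hη1.contDiffOn.add (contDiffOn_bilinear hM.contDiffOn_symbols hxs hxU hvs hη.contDiffOn)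
  set D2η := covRep Γ x J Dη with hD2η
  have hD2ηs : ContDiffOn ℝ ∞ D2η J := contDiffOn_covRep hM.contDiffOn_symbols hu hxs hxU hDηs
  have hD2 : ∀ t ∈ J, HasCovDerivAt Γ x (v t) Dη (D2η t) t := fun t ht =>
    hasCovDerivAt_covRep (hJ.mem_nhds ht) ((hDηs.differentiableOn (by simp)) t ht)
  -- the derivative of the integral over the support of the variation
  set L' : ℝ → ℝ := fun t => G (x t) (D2η t) (P t)
        + G (x t) (curvRep Γ (x t) (η t) (v t) (v t)) (P t)
        + ∑ k, lam k t * G (x t) (fderiv ℝ (X k) (x t) (η t) + Γ (x t) (η t) (X k (x t)))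
          (accelRep Γ x J t) with hL'
  have hL'd : ∀ t ∈ J, HasDerivAt (fun s : ℝ => lagrangian G Γ X (fun k => lam k t)
      (x t + s • η t) (v t + s • deriv η t) (a t + s • deriv (deriv η) t)) (L' t) 0 :=
    fun t ht => hM.hasDerivAt_lagrangian
      (fun k => differentiableAt_of_contDiffOn (hXs k) hM.isOpen (hxU ht)) (hxU ht)
      (hder hxs t ht) (hder hvs t ht) (hder' hη t) (hder' hη1 t) (fun _ => rfl) (hD2 t ht)
      rfl (hP t ht)
  have hLs : ContDiffOn ℝ 1 (fun z : ℝ × ℝ => lagrangian G Γ X (fun k => lam k z.2)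
      (x z.2 + z.1 • η z.2) (v z.2 + z.1 • deriv η z.2) (a z.2 + z.1 • deriv (deriv η) z.2))
      (Ioo (-ε) ε ×ˢ J) := by
    have hsnd : ∀ {F : Type _} [NormedAddCommGroup F] [NormedSpace ℝ F] {f : ℝ → F},
        ContDiffOn ℝ ∞ f J → ContDiffOn ℝ ∞ (fun z : ℝ × ℝ => f z.2) (Ioo (-ε) ε ×ˢ J) :=
      fun hf => hf.comp contDiffOn_snd fun z hz => hz.2
    have hadd : ∀ {f ζ : ℝ → E}, ContDiffOn ℝ ∞ f J → ContDiff ℝ ∞ ζ →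
        ContDiffOn ℝ ∞ (fun z : ℝ × ℝ => f z.2 + z.1 • ζ z.2) (Ioo (-ε) ε ×ˢ J) :=
      fun hf hζ => (hsnd hf).add (contDiffOn_fst.smul (hsnd hζ.contDiffOn))
    have hls : ∀ k, ContDiffOn ℝ ∞ (fun z : ℝ × ℝ => lam k z.2) (Ioo (-ε) ε ×ˢ J) :=
      fun k => (hlam k).comp contDiffOn_snd fun z hz => hz.2
    exact (contDiffOn_lagrangian hM.contDiffOn_metric hM.contDiffOn_symbols hXs hls
      (hadd hxs hη) (fun z hz => hε z.1 hz.1 z.2 hz.2) (hadd hvs hη1) (hadd has hη2)).of_le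
      (by simp)
  obtain ⟨hL'c, hint⟩ := hasDerivAt_integral_of_contDiffOn
    (L := fun s t => lagrangian G Γ X (fun k => lam k t)
      (x t + s • η t) (v t + s • deriv η t) (a t + s • deriv (deriv η) t))
    hε0 hJ hpq hpqJ hLs hL'd
  have hzero : ∫ t in p..q, L' t = 0 := by
    refine (hint.const_add C).unique (hcrit.congr_of_eventuallyEq ?_)
    filter_upwards [Ioo_mem_nhds (neg_lt_zero.2 hε0) hε0] with s hs
    exact (hC s hs).symm
  -- the total derivative integrates to zero
  have hPc : ContinuousOn P J := fun t ht => (hP₁ t ht).continuousAt.continuousWithinAt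
  set B' : ℝ → ℝ := fun t => G (x t) (D2η t) (P t) - G (x t) (η t) (P₂ t) with hB'
  have hB'c : ContinuousOn B' J := by
    have hG0 := ContDiffOn.continuousOn (F := E →L[ℝ] E →L[ℝ] ℝ) hM.contDiffOn_metric
    have hx0 := hxs.continuousOn
    have hD0 := hD2ηs.continuousOn
    have hη0 := hη.continuous.continuousOn (s := J)
    exact (continuousOn_bilinear hG0 hx0 hxU hD0 hPc).sub
      (continuousOn_bilinear hG0 hx0 hxU hη0 hP₂c)
  have hvanish : ∀ t, t ∉ Ioo p q → η t = 0 ∧ Dη t = 0 := by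
    intro t ht
    have h1 : t ∉ tsupport η := fun h => ht (hηpq h)
    have h2 : η t = 0 := image_eq_zero_of_notMem_tsupport h1
    have h3 : deriv η t = 0 := by
      by_contra hne
      exact h1 (support_deriv_subset hne)
    exact ⟨h2, by simp only [hDη, h2, h3, map_zero, add_zero]⟩
  have hB : ∫ t in p..q, B' t = 0 := by
    have h1 := intervalIntegral.integral_eq_sub_of_hasDerivAt
      (f := fun t => G (x t) (Dη t) (P t) - G (x t) (η t) (P₁ t)) (f' := B') (a := p) (b := q)
      (fun t ht => by
        rw [uIcc_of_le hpq] at ht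
        exact hM.hasDerivAt_boundary (hxU (hpqJ ht)) (hder hxs t (hpqJ ht)) (hder' hη t)
          (fun _ => rfl) (hD2 t (hpqJ ht)) (hP₁ t (hpqJ ht)) (hP₂ t (hpqJ ht)))
      (ContinuousOn.intervalIntegrable_of_Icc hpq (hB'c.mono hpqJ))
    rw [h1]
    simp only [hvanish p (by simp), hvanish q (by simp), map_zero, zero_apply, sub_zero]
  calc _ = ∫ t in p..q, (L' t - B' t) := by
        refine intervalIntegral.integral_congr fun t ht => ?_
        rw [uIcc_of_le hpq] at ht
        rw [eq_sub_iff_add_eq]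
        exact (hM.firstVariation_eq X _ (hxU (hpqJ ht)) (v t) (η t) (D2η t) _ (P t) (P₂ t)).symm
    _ = 0 := by
        rw [intervalIntegral.integral_sub
          (ContinuousOn.intervalIntegrable_of_Icc hpq (hL'c.mono hpqJ))
          (ContinuousOn.intervalIntegrable_of_Icc hpq (hB'c.mono hpqJ)), hzero, hB, sub_zero]

end Critical

section Momentum

variable {r : ℕ} {U : Set E} {G : E → E →L[ℝ] E →L[ℝ] ℝ} {Γ : E → E →L[ℝ] E →L[ℝ] E}
  {x : ℝ → E} {X : Fin r → E → E} {l : Fin r → ℝ → ℝ} {K : Set ℝ} {t : ℝ}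

/-- The momentum `P = D²x/dt² + ∑ l k X k` conjugate to the covariant acceleration. -/
def momentumRep (Γ : E → E →L[ℝ] E →L[ℝ] E) (x : ℝ → E) (X : Fin r → E → E) (l : Fin r → ℝ → ℝ)
    (K : Set ℝ) (t : ℝ) : E :=
  accelRep Γ x K t + ∑ k, l k t • X k (x t)

/-- The covariant derivative of the momentum, expanded by the product rule. -/
def momentumRepDeriv (Γ : E → E →L[ℝ] E →L[ℝ] E) (x : ℝ → E) (X : Fin r → E → E)
    (l : Fin r → ℝ → ℝ) (K : Set ℝ) (t : ℝ) : E :=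
  covRep Γ x K (accelRep Γ x K) t + ∑ k, (derivWithin (l k) K t • X k (x t)
    + l k t • covRep Γ x K (fun t => X k (x t)) t)

/-- The second covariant derivative of the momentum, expanded by the product rule. -/
def momentumRepDeriv₂ (Γ : E → E →L[ℝ] E →L[ℝ] E) (x : ℝ → E) (X : Fin r → E → E)
    (l : Fin r → ℝ → ℝ) (K : Set ℝ) (t : ℝ) : E :=
  covRep Γ x K (covRep Γ x K (accelRep Γ x K)) t
    + ∑ k, (derivWithin (derivWithin (l k) K) K t • X k (x t)
      + (2 * derivWithin (l k) K t) • covRep Γ x K (fun t => X k (x t)) t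
      + l k t • covRep Γ x K (covRep Γ x K (fun t => X k (x t))) t)

theorem contDiffOn_accelRep (hΓ : ContDiffOn ℝ ∞ Γ U) (hK : UniqueDiffOn ℝ K)
    (hx : ContDiffOn ℝ ∞ x K) (hxU : MapsTo x K U) : ContDiffOn ℝ ∞ (accelRep Γ x K) K :=
  contDiffOn_covRep hΓ hK hx hxU (hx.derivWithin hK (by simp))

theorem hasCovDerivAt_momentumRep (hΓ : ContDiffOn ℝ ∞ Γ U) (hK : UniqueDiffOn ℝ K)
    (hx : ContDiffOn ℝ ∞ x K) (hxU : MapsTo x K U) (hX : ∀ k, ContDiffOn ℝ ∞ (X k) U)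
    (hl : ∀ k, ContDiffOn ℝ ∞ (l k) K) (hKt : K ∈ 𝓝 t) :
    HasCovDerivAt Γ x (derivWithin x K t) (momentumRep Γ x X l K) (momentumRepDeriv Γ x X l K t) t
    ∧ HasCovDerivAt Γ x (derivWithin x K t) (momentumRepDeriv Γ x X l K)
        (momentumRepDeriv₂ Γ x X l K t) t := by
  have ht := mem_of_mem_nhds hKt
  have hcov : ∀ {w : ℝ → E}, ContDiffOn ℝ ∞ w K →
      HasCovDerivAt Γ x (derivWithin x K t) w (covRep Γ x K w t) t := fun hw =>
    hasCovDerivAt_covRep hKt ((hw.differentiableOn (by simp)) t ht)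
  have hder : ∀ {f : ℝ → ℝ}, ContDiffOn ℝ ∞ f K → HasDerivAt f (derivWithin f K t) t := fun hf =>
    ((hf.differentiableOn (by simp)) t ht).hasDerivWithinAt.hasDerivAt hKt
  have hA := contDiffOn_accelRep hΓ hK hx hxU
  have hXx : ∀ k, ContDiffOn ℝ ∞ (fun t => X k (x t)) K := fun k => (hX k).comp hx hxU
  have hl' : ∀ k, ContDiffOn ℝ ∞ (derivWithin (l k) K) K := fun k =>
    (hl k).derivWithin hK (by simp)
  have hs : ∀ {w : ℝ → E}, ContDiffOn ℝ ∞ w K → ContDiffOn ℝ ∞ (covRep Γ x K w) K :=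
    fun hw => contDiffOn_covRep hΓ hK hx hxU hw
  refine ⟨(hcov hA).add (.sum fun k _ => .smul (hder (hl k)) (hcov (hXx k))), ?_⟩
  have h := (hcov (hs hA)).add (.sum (s := Finset.univ) fun k _ =>
    (HasCovDerivAt.smul (hder (hl' k)) (hcov (hXx k))).add
      (HasCovDerivAt.smul (hder (hl k)) (hcov (hs (hXx k)))))
  have he : momentumRepDeriv₂ Γ x X l K t = covRep Γ x K (covRep Γ x K (accelRep Γ x K)) t
      + ∑ k, ((derivWithin (derivWithin (l k) K) K t • X k (x t)
          + derivWithin (l k) K t • covRep Γ x K (fun t => X k (x t)) t)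
        + (derivWithin (l k) K t • covRep Γ x K (fun t => X k (x t)) t
          + l k t • covRep Γ x K (covRep Γ x K (fun t => X k (x t))) t)) := by
    rw [momentumRepDeriv₂]
    refine congrArg₂ _ rfl (Finset.sum_congr rfl fun k _ => ?_)
    rw [two_mul, add_smul]
    abel
  rw [he]
  exact h

theorem continuousOn_momentumRep (hΓ : ContDiffOn ℝ ∞ Γ U) (hK : UniqueDiffOn ℝ K)
    (hx : ContDiffOn ℝ ∞ x K) (hxU : MapsTo x K U) (hX : ∀ k, ContDiffOn ℝ ∞ (X k) U)
    (hl : ∀ k, ContDiffOn ℝ ∞ (l k) K) :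
    ContinuousOn (momentumRep Γ x X l K) K ∧ ContinuousOn (momentumRepDeriv₂ Γ x X l K) K := by
  have hA := contDiffOn_accelRep hΓ hK hx hxU
  have hXx : ∀ k, ContDiffOn ℝ ∞ (fun t => X k (x t)) K := fun k => (hX k).comp hx hxU
  have hl' : ∀ k, ContDiffOn ℝ ∞ (derivWithin (l k) K) K := fun k =>
    (hl k).derivWithin hK (by simp)
  have hs : ∀ {w : ℝ → E}, ContDiffOn ℝ ∞ w K → ContDiffOn ℝ ∞ (covRep Γ x K w) K :=
    fun hw => contDiffOn_covRep hΓ hK hx hxU hw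
  constructor
  · exact (hA.add (ContDiffOn.sum fun k _ => (hl k).smul (hXx k))).continuousOn
  · exact ((hs (hs hA)).add (ContDiffOn.sum fun k _ =>
      ((((hl' k).derivWithin hK (by simp)).smul (hXx k)).add
        ((contDiffOn_const.mul (hl' k)).smul (hs (hXx k)))).add
        ((hl k).smul (hs (hs (hXx k)))))).continuousOn

theorem derivWithin_derivWithin_congr_set {F : Type*} [NormedAddCommGroup F] [NormedSpace ℝ F]
    {f : ℝ → F} {I K : Set ℝ} (h : I =ᶠ[𝓝 t] K) :
    derivWithin (derivWithin f I) I t = derivWithin (derivWithin f K) K t := by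
  rw [derivWithin_congr_set h]
  refine Filter.EventuallyEq.derivWithin_eq ?_ (derivWithin_congr_set h)
  filter_upwards [mem_nhdsWithin_of_mem_nhds (eventually_eventually_nhds.2 h)] with τ hτ
  exact derivWithin_congr_set hτ

theorem accelRep_congr_set {I : Set ℝ} (h : I =ᶠ[𝓝 t] K) :
    accelRep Γ x I t = accelRep Γ x K t := by
  rw [accelRep, accelRep, covRep, covRep, derivWithin_derivWithin_congr_set h,
    derivWithin_congr_set h]

theorem isLinearMap_bilinear_left {H : Type*} [NormedAddCommGroup H] [NormedSpace ℝ H]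
    (B : E →L[ℝ] E →L[ℝ] H) (v : E) : IsLinearMap ℝ fun u => B u v :=
  ⟨fun a b => by rw [map_add, add_apply], fun a b => by rw [map_smul, smul_apply]⟩

theorem isLinearMap_trilinear {F : Type*} [NormedAddCommGroup F] [NormedSpace ℝ F]
    (B : E →L[ℝ] E →L[ℝ] E →L[ℝ] F) (v w : E) :
    (IsLinearMap ℝ fun u => B u v w) ∧ IsLinearMap ℝ fun u => B v u w := by
  have h := isLinearMap_bilinear_left B v
  refine ⟨⟨fun a b => ?_, fun a b => ?_⟩, isLinearMap_bilinear_left (B v) w⟩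
  · rw [h.map_add, add_apply]
  · rw [h.map_smul, smul_apply]

theorem isLinearMap_curvRep (y v w : E) : IsLinearMap ℝ fun u => curvRep Γ y u v w := by
  obtain ⟨h1, h2⟩ := isLinearMap_trilinear (fderiv ℝ Γ y) v w
  have h3 := isLinearMap_bilinear_left (Γ y) (Γ y v w)
  have h4 := isLinearMap_bilinear_left (Γ y) w
  refine ⟨fun a b => ?_, fun a b => ?_⟩
  · simp only [curvRep, h1.map_add, h2.map_add, h3.map_add, h4.map_add, map_add (Γ y v)]
    abel
  · simp only [curvRep, h1.map_smul, h2.map_smul, h3.map_smul, h4.map_smul, map_smul (Γ y v),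
      smul_sub, smul_add]

theorem curvRep_momentum (y A v w : E) (a : Fin r → ℝ) (z : Fin r → E) :
    curvRep Γ y (A + ∑ k, a k • z k) v w =
      curvRep Γ y A v w + ∑ k, a k • curvRep Γ y (z k) v w := by
  let L : E →ₗ[ℝ] E := (isLinearMap_curvRep (Γ := Γ) y v w).mk'
  change L (A + ∑ k, a k • z k) = L A + ∑ k, a k • L (z k)
  rw [map_add, map_sum]
  simp only [map_smul]

end Momentum

section Critical

variable {g : Metric E Q} {r : ℕ} {μ : Fin r → OneForm E Q} {T : ℝ}
  {p₀ p₁ : TangentBundle 𝓘(ℝ, E) Q} {c : ℝ → Q} {lam : Fin r → ℝ → ℝ} {x₀ : Q} {K S : Set ℝ}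

/-- The Euler–Lagrange equation in a chart: the weak form is tested with the fields `ρ • w`, for
bump functions `ρ` and constant vectors `w`, and the equation extends to the closure by
continuity. -/
theorem IsNormalExtremal.eulerLagrange_eq_zero (h : IsNormalExtremal g μ T p₀ p₁ c lam)
    (hc : ChartCurve (E := E) x₀ c K) (hlam : ∀ k, ContDiffOn ℝ ∞ (lam k) K) (hS : IsOpen S)
    (hSK : S ⊆ K) (hST : S ⊆ Ioo 0 T) (hKS : K ⊆ closure S) (w : E) {t : ℝ} (ht : t ∈ K) :
    eulerLagrange (metricRep g x₀) (christoffel (leviCivita g) x₀)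
      (fun k => localRep x₀ (sharpField g (μ k))) (fun k => lam k t)
      ((extChartAt 𝓘(ℝ, E) x₀ ∘ c) t) (derivWithin (extChartAt 𝓘(ℝ, E) x₀ ∘ c) K t)
      (accelRep (christoffel (leviCivita g) x₀) (extChartAt 𝓘(ℝ, E) x₀ ∘ c) K t)
      (momentumRep (christoffel (leviCivita g) x₀) (extChartAt 𝓘(ℝ, E) x₀ ∘ c)
        (fun k => localRep x₀ (sharpField g (μ k))) lam K t)
      (momentumRepDeriv₂ (christoffel (leviCivita g) x₀) (extChartAt 𝓘(ℝ, E) x₀ ∘ c)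
        (fun k => localRep x₀ (sharpField g (μ k))) lam K t) w = 0 := by
  have hM := localMetric_chart (isLeviCivita_leviCivita g) x₀
  have hXs := fun k => contDiffOn_localRep_sharpField g (μ k) x₀
  have hxs := hc.contDiffOn
  have hxU := hc.mapsTo_target
  have hKu := hc.uniqueDiffOn
  have hint : ∀ {J : Set ℝ} {p q : ℝ}, IsOpen J → J ⊆ S → p ≤ q → Icc p q ⊆ J → ∀ {η : ℝ → E},
      ContDiff ℝ ∞ η → tsupport η ⊆ Ioo p q → _ := fun {J p q} hJ hJS hpq hpqJ {η} hη hηpq =>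
    h.integral_eulerLagrange (P := momentumRep (christoffel (leviCivita g) x₀)
        (extChartAt 𝓘(ℝ, E) x₀ ∘ c) (fun k => localRep x₀ (sharpField g (μ k))) lam K)
      (P₁ := momentumRepDeriv (christoffel (leviCivita g) x₀)
        (extChartAt 𝓘(ℝ, E) x₀ ∘ c) (fun k => localRep x₀ (sharpField g (μ k))) lam K)
      (P₂ := momentumRepDeriv₂ (christoffel (leviCivita g) x₀)
        (extChartAt 𝓘(ℝ, E) x₀ ∘ c) (fun k => localRep x₀ (sharpField g (μ k))) lam K)
      (hc.mono hJ.uniqueDiffOn (hJS.trans hSK)) hJ (fun k => (hlam k).mono (hJS.trans hSK))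
      (hJS.trans hST) hpq hpqJ hη hηpq
  set x := extChartAt 𝓘(ℝ, E) x₀ ∘ c with hx
  set Γ := christoffel (leviCivita g) x₀ with hΓ
  set X : Fin r → E → E := fun k => localRep x₀ (sharpField g (μ k)) with hX
  obtain ⟨hPc, hP₂c⟩ := continuousOn_momentumRep hM.contDiffOn_symbols hKu hxs hxU hXs hlam
  set f : ℝ → ℝ := fun t => eulerLagrange (metricRep g x₀) Γ X (fun k => lam k t) (x t)
    (derivWithin x K t) (accelRep Γ x K t) (momentumRep Γ x X lam K t)
    (momentumRepDeriv₂ Γ x X lam K t) w with hf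
  have hfc : ContinuousOn f K :=
    hM.continuousOn_eulerLagrange hXs (fun k => (hlam k).continuousOn) hxs.continuousOn hxU
      (hxs.derivWithin hKu (m := ∞) (by simp)).continuousOn
      (contDiffOn_accelRep hM.contDiffOn_symbols hKu hxs hxU).continuousOn hPc hP₂c
      continuousOn_const
  suffices hS0 : EqOn f (fun _ => 0) S from
    hS0.of_subset_closure hfc continuousOn_const hSK hKS ht
  intro τ hτ
  obtain ⟨p, q, hτpq, hpqS⟩ := mem_nhds_iff_exists_Ioo_subset.1 (hS.mem_nhds hτ)
  have hset : ∀ σ ∈ Ioo p q, K =ᶠ[𝓝 σ] Ioo p q := fun σ hσ => by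
    filter_upwards [isOpen_Ioo.mem_nhds hσ] with ρ hρ
    exact propext ⟨fun _ => hρ, fun _ => hSK (hpqS hρ)⟩
  have hKn : ∀ σ ∈ Ioo p q, K ∈ 𝓝 σ := fun σ hσ =>
    Filter.mem_of_superset (isOpen_Ioo.mem_nhds hσ) (hpqS.trans hSK)
  have hfJ : ContinuousOn f (Ioo p q) := hfc.mono (hpqS.trans hSK)
  have hae := isOpen_Ioo.ae_eq_zero_of_integral_contDiff_smul_eq_zero (μ := volume)
    (hfJ.locallyIntegrableOn measurableSet_Ioo) fun ρ hρ hρc hρs => by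
      obtain ⟨p', q', hpq', hp'q', hsub⟩ : ∃ p' q', p' ≤ q' ∧ Icc p' q' ⊆ Ioo p q ∧
          tsupport ρ ⊆ Ioo p' q' := by
        rcases (tsupport ρ).eq_empty_or_nonempty with hemp | hne
        · exact ⟨τ, τ, le_rfl, by simpa using hτpq, by simp [hemp]⟩
        · obtain ⟨m, hm, hm'⟩ := hρc.isCompact.exists_isLeast hne
          obtain ⟨M, hM, hM'⟩ := hρc.isCompact.exists_isGreatest hne
          have h1 := hρs hm
          have h2 := hρs hM
          obtain ⟨p', hp1, hp2⟩ := exists_between h1.1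
          obtain ⟨q', hq1, hq2⟩ := exists_between h2.2
          exact ⟨p', q', (hp2.trans_le ((hm' hM).trans hq1.le)).le, Icc_subset_Ioo hp1 hq2,
            fun σ hσ => ⟨hp2.trans_le (hm' hσ), (hM' hσ).trans_lt hq1⟩⟩
      have h1 := hint isOpen_Ioo hpqS hpq' hp'q' (η := fun t => ρ t • w)
        (hρ.smul contDiff_const) ((tsupport_smul_subset_left ρ fun _ => w).trans hsub)
        (fun σ hσ => by rw [momentumRep, accelRep_congr_set (hset σ hσ)])
        (fun σ hσ => by
          rw [← derivWithin_congr_set (hset σ hσ)]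
          exact (hasCovDerivAt_momentumRep hM.contDiffOn_symbols hKu hxs hxU hXs hlam
            (hKn σ hσ)).1)
        (fun σ hσ => by
          rw [← derivWithin_congr_set (hset σ hσ)]
          exact (hasCovDerivAt_momentumRep hM.contDiffOn_symbols hKu hxs hxU hXs hlam
            (hKn σ hσ)).2)
        (hP₂c.mono (hpqS.trans hSK))
      rw [← intervalIntegral.integral_eq_integral_of_support_subset (a := p') (b := q'), ← h1]
      · refine intervalIntegral.integral_congr fun σ hσ => ?_
        rw [uIcc_of_le hpq'] at hσ
        change ρ σ • f σ = _
        rw [eulerLagrange_smul, ← derivWithin_congr_set (hset σ (hp'q' hσ)),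
          ← accelRep_congr_set (hset σ (hp'q' hσ))]
        rfl
      · refine fun σ hσ => Ioo_subset_Ioc_self (hsub (subset_tsupport ρ ?_))
        intro h0
        exact hσ (by simp only [h0, zero_smul])
  exact Measure.eqOn_open_of_ae_eq ((ae_restrict_iff' measurableSet_Ioo).2 hae) isOpen_Ioo hfJ
    continuousOn_const hτpq

end Critical

/-! ### From the chart to the manifold -/

section Equation

variable {g : Metric E Q} {r : ℕ} {μ : Fin r → OneForm E Q} {c : ℝ → Q} {lam : Fin r → ℝ → ℝ}
  {x₀ : Q} {I K : Set ℝ} {t : ℝ}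

/-- The left-hand side of the equation of a normal extremal. -/
def extremalField (g : Metric E Q) {r : ℕ} (μ : Fin r → OneForm E Q) (c : ℝ → Q)
    (lam : Fin r → ℝ → ℝ) (I : Set ℝ) (t : ℝ) : TangentSpace 𝓘(ℝ, E) (c t) :=
  ((covDerivAlong (leviCivita g) c I)^[3] (velocity c I)) t
    + curvature (leviCivita g) (c t) (accel g c I t) (velocity c I t) (velocity c I t)
    + ∑ k, (iteratedDerivWithin 2 (lam k) I t • sharpField g (μ k) (c t)
        + (2 * derivWithin (lam k) I t) •
            covDerivAlong (leviCivita g) c I (fun τ => sharpField g (μ k) (c τ)) t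
        + lam k t • ((covDerivAlong (leviCivita g) c I)^[2] (fun τ => sharpField g (μ k) (c τ))) t)
    + ∑ k, lam k t •
        (curvature (leviCivita g) (c t) (sharpField g (μ k) (c t)) (velocity c I t) (velocity c I t)
          + leviCivita g (sharpField g (μ k)) (c t) (accel g c I t)
          - formOperator g (μ k) (c t) (accel g c I t))

theorem iteratedDerivWithin_two {f : ℝ → ℝ} (I : Set ℝ) (t : ℝ) :
    iteratedDerivWithin 2 f I t = derivWithin (derivWithin f I) I t :=
  iteratedDerivWithin_eq_iterate

theorem extremalField_congr_set (h : I =ᶠ[𝓝 t] K) :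
    extremalField g μ c lam I t = extremalField g μ c lam K t := by
  have hv := velocity_congr_set (E := E) (c := c) h
  have hA := accel_congr_set g (c := c) h
  have hC := covDerivAlong_congr_set (leviCivita g) h
    (covDerivAlong_congr_set (leviCivita g) h hA)
  have hX : ∀ k, ∀ᶠ τ in 𝓝 t,
      covDerivAlong (leviCivita g) c I (fun τ => sharpField g (μ k) (c τ)) τ =
        covDerivAlong (leviCivita g) c K (fun τ => sharpField g (μ k) (c τ)) τ := fun k =>
    covDerivAlong_congr_set (leviCivita g) h (Filter.Eventually.of_forall fun _ => rfl)
  have hX2 := fun k => covDerivAlong_congr_set (leviCivita g) h (hX k)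
  have hC' : (covDerivAlong (leviCivita g) c I)^[3] (velocity c I) t =
      (covDerivAlong (leviCivita g) c K)^[3] (velocity c K) t := hC.self_of_nhds
  have hX2' : ∀ k, (covDerivAlong (leviCivita g) c I)^[2] (fun τ => sharpField g (μ k) (c τ)) t =
      (covDerivAlong (leviCivita g) c K)^[2] (fun τ => sharpField g (μ k) (c τ)) t := fun k =>
    (hX2 k).self_of_nhds
  simp only [extremalField, hv.self_of_nhds, hA.self_of_nhds, hC', hX2',
    fun k => (hX k).self_of_nhds, iteratedDerivWithin_two, derivWithin_derivWithin_congr_set h,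
    derivWithin_congr_set h]

/-- In a chart the equation of a normal extremal is the Euler–Lagrange equation. -/
theorem ChartCurve.inner_extremalField (h : ChartCurve (E := E) x₀ c K)
    (ht : t ∈ K) (w : TangentSpace 𝓘(ℝ, E) (c t)) :
    g.inner (c t) (extremalField g μ c lam K t) w =
      eulerLagrange (metricRep g x₀) (christoffel (leviCivita g) x₀)
        (fun k => localRep x₀ (sharpField g (μ k))) (fun k => lam k t)
        ((extChartAt 𝓘(ℝ, E) x₀ ∘ c) t) (derivWithin (extChartAt 𝓘(ℝ, E) x₀ ∘ c) K t)
        (accelRep (christoffel (leviCivita g) x₀) (extChartAt 𝓘(ℝ, E) x₀ ∘ c) K t)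
        (momentumRep (christoffel (leviCivita g) x₀) (extChartAt 𝓘(ℝ, E) x₀ ∘ c)
          (fun k => localRep x₀ (sharpField g (μ k))) lam K t)
        (momentumRepDeriv₂ (christoffel (leviCivita g) x₀) (extChartAt 𝓘(ℝ, E) x₀ ∘ c)
          (fun k => localRep x₀ (sharpField g (μ k))) lam K t) (coord x₀ (c t) w) := by
  have hD := isLeviCivita_leviCivita g
  have hM := localMetric_chart hD x₀
  have hs := h.mapsTo ht
  have hxs := h.contDiffOn
  have hxU := h.mapsTo_target
  have hu := h.uniqueDiffOn
  have hA := contDiffOn_accelRep hM.contDiffOn_symbols hu hxs hxU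
  have hcov : ∀ {w : ℝ → E}, ContDiffOn ℝ ∞ w K → ContDiffOn ℝ ∞
      (covRep (christoffel (leviCivita g) x₀) (extChartAt 𝓘(ℝ, E) x₀ ∘ c) K w) K :=
    fun hw => contDiffOn_covRep hM.contDiffOn_symbols hu hxs hxU hw
  have hXs : ∀ k, ContDiffOn ℝ ∞
      (fun t => localRep x₀ (sharpField g (μ k)) ((extChartAt 𝓘(ℝ, E) x₀ ∘ c) t)) K := fun k =>
    (contDiffOn_localRep_sharpField g (μ k) x₀).comp hxs hxU
  have hX : ∀ k, ∀ t ∈ K, coord x₀ (c t) (sharpField g (μ k) (c t)) =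
      localRep x₀ (sharpField g (μ k)) ((extChartAt 𝓘(ℝ, E) x₀ ∘ c) t) := fun k t ht =>
    (localRep_chart (h.mapsTo ht) _).symm
  have hvc := h.coord_velocity ht
  have hAc := fun t (ht : t ∈ K) => h.coord_accel g ht
  have hBc := fun t (ht : t ∈ K) => h.coord_covDerivAlong (leviCivita g) hA hAc ht
  have hCc : coord x₀ (c t) ((covDerivAlong (leviCivita g) c K)^[3] (velocity c K) t) = _ :=
    h.coord_covDerivAlong (leviCivita g) (hcov hA) hBc ht
  have hDXc := fun k t (ht : t ∈ K) => h.coord_covDerivAlong (leviCivita g) (hXs k) (hX k) ht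
  have hD2Xc : ∀ k, coord x₀ (c t) ((covDerivAlong (leviCivita g) c K)^[2]
      (fun τ => sharpField g (μ k) (c τ)) t) = _ := fun k =>
    h.coord_covDerivAlong (leviCivita g) (hcov (hXs k)) (hDXc k) ht
  set A := accel g c K t with hAdef
  set v := velocity (E := E) c K t with hv
  -- the terms that do not contain `∇_A X k` or `S A`
  set M : TangentSpace 𝓘(ℝ, E) (c t) :=
    ((covDerivAlong (leviCivita g) c K)^[3] (velocity c K)) t
    + ∑ k, (iteratedDerivWithin 2 (lam k) K t • sharpField g (μ k) (c t)
        + (2 * derivWithin (lam k) K t) •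
            covDerivAlong (leviCivita g) c K (fun τ => sharpField g (μ k) (c τ)) t
        + lam k t • ((covDerivAlong (leviCivita g) c K)^[2] (fun τ => sharpField g (μ k) (c τ))) t)
    + (curvature (leviCivita g) (c t) A v v + ∑ k, lam k t •
        curvature (leviCivita g) (c t) (sharpField g (μ k) (c t)) v v) with hMdef
  have hsplit : extremalField g μ c lam K t = M + ∑ k, lam k t •
      (leviCivita g (sharpField g (μ k)) (c t) A - formOperator g (μ k) (c t) A) := by
    simp only [extremalField, hMdef, add_sub_assoc, smul_add, Finset.sum_add_distrib]
    abel
  have hMc : coord x₀ (c t) M =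
      momentumRepDeriv₂ (christoffel (leviCivita g) x₀) (extChartAt 𝓘(ℝ, E) x₀ ∘ c)
          (fun k => localRep x₀ (sharpField g (μ k))) lam K t
        + curvRep (christoffel (leviCivita g) x₀) ((extChartAt 𝓘(ℝ, E) x₀ ∘ c) t)
          (momentumRep (christoffel (leviCivita g) x₀) (extChartAt 𝓘(ℝ, E) x₀ ∘ c)
            (fun k => localRep x₀ (sharpField g (μ k))) lam K t)
          (derivWithin (extChartAt 𝓘(ℝ, E) x₀ ∘ c) K t)
          (derivWithin (extChartAt 𝓘(ℝ, E) x₀ ∘ c) K t) := by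
    rw [momentumRep, curvRep_momentum, momentumRepDeriv₂, hMdef]
    simp only [map_add, map_sum, map_smul, coord_curvature hD hs, hCc, fun k => hX k t ht,
      fun k => hDXc k t ht, hD2Xc, hAdef, hAc t ht, hvc, iteratedDerivWithin_two]
    rfl
  have hS : ∀ k, g.inner (c t) (leviCivita g (sharpField g (μ k)) (c t) A
      - formOperator g (μ k) (c t) A) w =
      g.inner (c t) (leviCivita g (sharpField g (μ k)) (c t) w) A := by
    intro k
    rw [map_sub, sub_apply, inner_formOperator hD]
    ring
  rw [hsplit, eulerLagrange, map_add, add_apply, map_sum, sum_apply, ← hMc]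
  congr 1
  · exact (metricRep_chart g hs M w).symm
  · refine Finset.sum_congr rfl fun k _ => ?_
    rw [map_smul, smul_apply, hS, smul_eq_mul, ← metricRep_chart g hs,
      coord_connection _ hs (vdiffAt_sharpField g (μ k) (c t)), hX k t ht, hAdef, hAc t ht]
    rfl

end Equation

end CovAcc

end

open CovAcc
theorem theorem1 {E : Type*} [NormedAddCommGroup E] [NormedSpace ℝ E] [FiniteDimensional ℝ E]
    {Q : Type*} [TopologicalSpace Q] [ChartedSpace E Q] [IsManifold 𝓘(ℝ, E) ∞ Q]
    (g : Metric E Q) {r : ℕ} (μ : Fin r → OneForm E Q) (T : ℝ) (hT : 0 < T)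
    (p₀ p₁ : TangentBundle 𝓘(ℝ, E) Q) (c : ℝ → Q) (lam : Fin r → ℝ → ℝ)
    (h : IsNormalExtremal g μ T p₀ p₁ c lam)
    (a b : ℝ) (ha : 0 ≤ a) (hab : a < b) (hb : b ≤ T)
    (hc : ContMDiffOn 𝓘(ℝ, ℝ) 𝓘(ℝ, E) ∞ c (Icc a b))
    (hlam : ∀ k, ContDiffOn ℝ ∞ (lam k) (Icc a b))
    (t : ℝ) (ht : t ∈ Icc a b) :
    ((covDerivAlong (leviCivita g) c (Icc a b))^[3] (velocity c (Icc a b))) t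
      + curvature (leviCivita g) (c t) (accel g c (Icc a b) t)
          (velocity c (Icc a b) t) (velocity c (Icc a b) t)
      + ∑ k, (iteratedDerivWithin 2 (lam k) (Icc a b) t • sharpField g (μ k) (c t)
          + (2 * derivWithin (lam k) (Icc a b) t) •
              covDerivAlong (leviCivita g) c (Icc a b) (fun τ => sharpField g (μ k) (c τ)) t
          + lam k t •
              ((covDerivAlong (leviCivita g) c (Icc a b))^[2]
                (fun τ => sharpField g (μ k) (c τ))) t)
      + ∑ k, lam k t •
          (curvature (leviCivita g) (c t) (sharpField g (μ k) (c t))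
              (velocity c (Icc a b) t) (velocity c (Icc a b) t)
            + leviCivita g (sharpField g (μ k)) (c t) (accel g c (Icc a b) t)
            - formOperator g (μ k) (c t) (accel g c (Icc a b) t)) = 0 := by

  change extremalField g μ c lam (Icc a b) t = 0
  -- a neighbourhood of `t` in `[a, b]` that the curve maps into the chart centred at `c t`
  obtain ⟨O, hO, htO, hOs⟩ := mem_nhdsWithin.1
    (hc.continuousOn t ht (source_mem_nhds (mem_chart_source E (c t))))
  have hset : Icc a b =ᶠ[𝓝 t] (O ∩ Icc a b : Set ℝ) := by
    filter_upwards [hO.mem_nhds htO] with τ hτ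
    exact propext ⟨fun h => ⟨hτ, h⟩, fun h => h.2⟩
  have hchart : ChartCurve (E := E) (c t) c (O ∩ Icc a b) :=
    ⟨by rw [inter_comm]; exact (uniqueDiffOn_Icc hab).inter hO, hc.mono inter_subset_right,
      fun τ hτ => hOs hτ⟩
  have hl : ∀ k, ContDiffOn ℝ ∞ (lam k) (O ∩ Icc a b) := fun k => (hlam k).mono inter_subset_right
  rw [extremalField_congr_set hset]
  refine eq_of_pairing_eq (g.inner (c t)) (g.pos (c t)) fun w => ?_
  rw [hchart.inner_extremalField ⟨htO, ht⟩, map_zero, zero_apply]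
  refine h.eulerLagrange_eq_zero (S := O ∩ Ioo a b) hchart hl (hO.inter isOpen_Ioo)
    (inter_subset_inter_right O Ioo_subset_Icc_self)
    (inter_subset_right.trans (Ioo_subset_Ioo ha hb)) ?_ _ ⟨htO, ht⟩
  rw [← closure_Ioo hab.ne]
  exact hO.inter_closure
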